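/- Let $(M,g)$ be a complete Riemannian manifold of dimension $N$ (smooth, second countable, without boundary), with volume measure $dv_g$, let $\Omega\subset M$ be open and let $p>1$. Let $\rho\in W^{1,p}_{loc}(\Omega)$ be nonnegative almost everywhere and $p$-superharmonic in $\Omega$ in the weak sense, that is, $$\int_\Omega |\nabla\rho|^{p-2}\,\nabla\rho\cdot\nabla\varphi\,dv_g\ \ge\ 0\qquad\text{for every } 0\le\varphi\in C^1_0(\Omega),$$ where $C^1_0(\Omega)$ is the set of real $C^1$ functions with compact support in $\Omega$ and $\nabla\rho$ is the weak gradient. Then the following hold. (1) Let $\delta>0$, $0\le b\le 1$, and let $s,q$ be given by $$\frac1s=\frac bp+\frac{1-b}{\delta},\qquad \frac1{q(p-1)}=\frac1p+\frac{1-b}{b\delta}$$ (with $q=0$ if $b=0$). Then for every $u\in C^1_0(\Omega)$ the function $|u|^s\,|\nabla\rho|^{q(p-1)}/\rho^{q(p-1)}$ is integrable on $\Omega$ and $$\left(\int_\Omega |u|^s\,\frac{|\nabla\rho|^{q(p-1)}}{\rho^{q(p-1)}}\,dv_g\right)^{1/s}\le\left(\frac p{p-1}\right)^{q(p-1)/s}\left(\int_\Omega|\nabla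 u|^p\,dv_g\right)^{b/p}\left(\int_\Omega|u|^\delta\,dv_g\right)^{(1-b)/\delta}.$$ Here the quotient is read as $0/0=0$ at points where $\rho=0$ if $q>0$ ($\nabla\rho=0$ almost everywhere on $\{\rho=0\}$), and as $1$ if $q=0$. (2) Suppose moreover that $\rho=d^\alpha$ almost everywhere in $\Omega$ for some real $\alpha\ne0$ and some nonnegative weakly differentiable function $d$ on $\Omega$ with $|\nabla d|=1$ almost everywhere. Let $\delta>0$ and $s=p-1+\frac{\delta}{p}$. Then for every $u\in C^1_0(\Omega)$ the function $|u|^s/d^{p-1}$ is integrable on $\Omega$ and $$\int_\Omega\frac{|u|^s}{d^{p-1}}\,dv_g\le\left(\frac{p}{|\alpha|(p-1)}\right)^{p-1}\left(\int_\Omega|\nabla u|^p\,dv_g\right)^{(p-1)/p}\left(\int_\Omega|u|^\delta\,dv_g\right)^{1/p}.$$ -/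

import Mathlib

open MeasureTheory Set
open scoped Manifold ContDiff Bundle ENNReal

noncomputable section

namespace RiemannianHardy

section Definitions

variable {N : ℕ} {M : Type*} [TopologicalSpace M] [ChartedSpace (EuclideanSpace ℝ (Fin N)) M]

/-- The `i`-th coordinate vector field `∂ᵢ` of the chart around `x₀`, at the point with
coordinates `y` (meaningful for `y` in the target of the chart): the image of the `i`-th standard
basis vector under the derivative of the inverse chart. -/
def coordVec (x₀ : M) (y : EuclideanSpace ℝ (Fin N)) (i : Fin N) :
    TangentSpace (𝓡 N) ((chartAt (EuclideanSpace ℝ (Fin N)) x₀).symm y) :=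
  mfderiv (𝓡 N) (𝓡 N) (chartAt (EuclideanSpace ℝ (Fin N)) x₀).symm y
    (EuclideanSpace.single i (1 : ℝ) : EuclideanSpace ℝ (Fin N))

variable [Bundle.RiemannianBundle (fun x : M => TangentSpace (𝓡 N) x)]

/-- The matrix `(g_ij)` of the Riemannian metric in the chart around `x₀`, at the point with
coordinates `y`. -/
def metricMatrix (x₀ : M) (y : EuclideanSpace ℝ (Fin N)) : Matrix (Fin N) (Fin N) ℝ :=
  Matrix.of fun i j => inner ℝ (coordVec x₀ y i) (coordVec x₀ y j)

variable (N) in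
/-- The gradient `∇u` of a differentiable real function with respect to the Riemannian metric:
the tangent vector with `g(∇u, v) = du(v)` for every tangent vector `v`. -/
def grad (u : M → ℝ) (x : M) : TangentSpace (𝓡 N) x :=
  haveI : FiniteDimensional ℝ (TangentSpace (𝓡 N) x) :=
    inferInstanceAs (FiniteDimensional ℝ (EuclideanSpace ℝ (Fin N)))
  haveI : CompleteSpace (TangentSpace (𝓡 N) x) := FiniteDimensional.complete ℝ _
  (InnerProductSpace.toDual ℝ (TangentSpace (𝓡 N) x)).symm
    (mfderiv (𝓡 N) 𝓘(ℝ, ℝ) u x : TangentSpace (𝓡 N) x →L[ℝ] ℝ)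

section Volume

variable [MeasurableSpace M]

variable (N) in
/-- The Riemannian volume of the domain of the chart around `x₀`: the measure with density
`√ det (g_ij)` in that chart, and zero outside the domain of the chart. -/
def chartVolume (x₀ : M) : Measure M :=
  (((volume : Measure (EuclideanSpace ℝ (Fin N))).restrict
      (chartAt (EuclideanSpace ℝ (Fin N)) x₀).target).withDensity
        fun y => ENNReal.ofReal (Real.sqrt (metricMatrix x₀ y).det)).map
    (chartAt (EuclideanSpace ℝ (Fin N)) x₀).symm

variable (N M) in
/-- The Riemannian volume measure `dv_g`. By the change of variables formula, the volumes of two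
chart domains agree on their overlap, so that their supremum is the measure which they patch
together to, that is, the measure with density `√ det (g_ij)` in every chart. -/
def riemannianVolume : Measure M := ⨆ x₀ : M, chartVolume N x₀

variable (N) in
/-- `f ∈ L^r_loc(Ω)`, for a real exponent `r > 0`. -/
def LpLoc (r : ℝ) (Ω : Set M) (f : M → ℝ) : Prop :=
  ∀ K : Set M, IsCompact K → K ⊆ Ω →
    MemLp f (ENNReal.ofReal r) ((riemannianVolume N M).restrict K)

end Volume

variable (N) in
/-- `φ ∈ C¹₀(Ω)`: `φ` is of class `C¹` with compact support contained in `Ω`. -/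
structure IsC1c (Ω : Set M) (φ : M → ℝ) : Prop where
  contMDiff : ContMDiff (𝓡 N) 𝓘(ℝ, ℝ) 1 φ
  hasCompactSupport : HasCompactSupport φ
  tsupport_subset : tsupport φ ⊆ Ω

/-- The part of `Ω` in the domain of the chart around `x₀`, seen in this chart. -/
def chartDomain (Ω : Set M) (x₀ : M) : Set (EuclideanSpace ℝ (Fin N)) :=
  (chartAt (EuclideanSpace ℝ (Fin N)) x₀).target ∩
    (chartAt (EuclideanSpace ℝ (Fin N)) x₀).symm ⁻¹' Ω

/-- The vector field `G` is the weak gradient of `f` in the open set `Ω`: in the coordinates `y` of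
every chart, `f` and the functions `g(G, ∂ᵢ)` are locally integrable, and `g(G, ∂ᵢ)` is the weak
partial derivative `∂f/∂yᵢ`. -/
structure HasWeakGradient (Ω : Set M) (f : M → ℝ) (G : (x : M) → TangentSpace (𝓡 N) x) :
    Prop where
  locallyIntegrableOn (x₀ : M) :
    LocallyIntegrableOn (fun y => f ((chartAt (EuclideanSpace ℝ (Fin N)) x₀).symm y))
      (chartDomain Ω x₀) volume
  locallyIntegrableOn_inner (x₀ : M) (i : Fin N) :
    LocallyIntegrableOn
      (fun y => inner ℝ (G ((chartAt (EuclideanSpace ℝ (Fin N)) x₀).symm y)) (coordVec x₀ y i))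
      (chartDomain Ω x₀) volume
  integral_eq (x₀ : M) (i : Fin N) (ψ : EuclideanSpace ℝ (Fin N) → ℝ) :
    ContDiff ℝ ∞ ψ → HasCompactSupport ψ → tsupport ψ ⊆ chartDomain Ω x₀ →
      ∫ y, f ((chartAt (EuclideanSpace ℝ (Fin N)) x₀).symm y) *
          fderiv ℝ ψ y (EuclideanSpace.single i (1 : ℝ)) =
        -∫ y, inner ℝ (G ((chartAt (EuclideanSpace ℝ (Fin N)) x₀).symm y)) (coordVec x₀ y i) * ψ y

variable [MeasurableSpace M]

/-- `f ∈ W^{1,p}_loc(Ω)`, with weak gradient `G`. -/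
structure MemW1pLoc (p : ℝ) (Ω : Set M) (f : M → ℝ) (G : (x : M) → TangentSpace (𝓡 N) x) :
    Prop where
  hasWeakGradient : HasWeakGradient Ω f G
  lpLoc : LpLoc N p Ω f
  lpLoc_norm : LpLoc N p Ω fun x => ‖G x‖

/-- `f`, with weak gradient `G`, is `p`-superharmonic in `Ω` in the weak sense:
`f ∈ L¹_loc(Ω)`, `|∇f| ∈ L^{p-1}_loc(Ω)`, and `-Δ_p f ≥ 0` tested against nonnegative functions
in `C¹₀(Ω)`. -/
structure IsPSuperharmonic (p : ℝ) (Ω : Set M) (f : M → ℝ)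
    (G : (x : M) → TangentSpace (𝓡 N) x) : Prop where
  hasWeakGradient : HasWeakGradient Ω f G
  lpLoc : LpLoc N 1 Ω f
  lpLoc_norm : LpLoc N (p - 1) Ω fun x => ‖G x‖
  integral_nonneg (φ : M → ℝ) : IsC1c N Ω φ → (∀ x, 0 ≤ φ x) →
    0 ≤ ∫ x in Ω, ‖G x‖ ^ (p - 2) * inner ℝ (G x) (grad N φ x) ∂(riemannianVolume N M)

end Definitions

end RiemannianHardy

end

open RiemannianHardy

set_option linter.unusedSectionVars false

/-! Everything rests on one Hardy inequality, `hardy_inequality`: ∫ (|u| |∇ρ|/ρ)^p ≤ (p/(p-1))^p ∫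
|∇u|^p. Formally, test superharmonicity with |u|^p (ρ+ε)^(1-p) and put A = |u| |∇ρ|/(ρ+ε), B = |∇u|.
Cauchy–Schwarz gives 0 ≤ ∫ (p A^(p-1) B - (p-1) A^p), and Young's inequality (`young_hardy`,
`test_le`) bounds this integrand by a positive multiple of (p/(p-1))^p B^p - A^p. Since ε > 0 and
|∇ρ| ∈ L^p_loc, A^p is integrable and can be moved to the other side; Fatou's lemma then lets ε tend
to 0.

The real work is that this test function is only Sobolev, while the hypothesis concerns C¹
functions. For F(t) = (t+ε)^(1-p), `integral_test_nonneg` shows that w F(ρ) is admissible. A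
partition of unity puts w in one chart. There the hypothesis says that the vector field √det g
|∇ρ|^(p-2) ∇ρ, which lies locally in the dual of L^p, has nonpositive distributional divergence.
Mollifying ρ after a cutoff gives smooth nonnegative functions which converge a.e. on the support of
w, with gradients converging in L^p there. As F and F' are bounded on [0, ∞), the limit follows from
Hölder and dominated convergence (`tendsto_integral_mul_mul`). The passage between manifold and
chart depends on `riemannianVolume_restrict_source`: on a chart domain, the supremum defining the
volume is the measure with density √det g.

Statement (1) is Hölder's inequality between the Hardy inequality and the L^δ norm, with |u|^s split
by the powers m = bs and n = (1-b)s, for which m/p + n/δ = 1 (`integral_interpolation_le`).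
Statement (2) is the case m = p-1, n = δ/p, combined with |∇ρ|/ρ = |α|/d where d > 0
(`norm_div_eq_of_eq_rpow`). The power is unbounded or singular, so this identity is obtained by
composing d and ρ with compactly supported functions that truncate the identity, and using
uniqueness of weak derivatives. -/

noncomputable section

namespace RiemannianHardy

open Filter Topology
open scoped Convolution

/-! ### Mollification and its convergence in L^p -/

section Mollification

variable {E : Type*} [NormedAddCommGroup E] [NormedSpace ℝ E] [FiniteDimensional ℝ E]
  [MeasurableSpace E] [BorelSpace E] {μ : Measure E} [μ.IsAddHaarMeasure]

/-- The mollification of `f` by the normalised bump function `φ`. -/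
def mollify (μ : Measure E) (φ : ContDiffBump (0 : E)) (f : E → ℝ) : E → ℝ :=
  φ.normed μ ⋆[ContinuousLinearMap.lsmul ℝ ℝ, μ] f

omit [BorelSpace E] [μ.IsAddHaarMeasure] in
lemma mollify_eq (φ : ContDiffBump (0 : E)) (f : E → ℝ) (x : E) :
    mollify μ φ f x = ∫ t, φ.normed μ t * f (x - t) ∂μ := rfl

lemma mollify_eq_swap (φ : ContDiffBump (0 : E)) (f : E → ℝ) (x : E) :
    mollify μ φ f x = ∫ t, φ.normed μ (x - t) * f t ∂μ :=
  convolution_eq_swap _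

lemma mollify_congr (φ : ContDiffBump (0 : E)) {f g : E → ℝ} (h : f =ᵐ[μ] g) :
    mollify μ φ f = mollify μ φ g :=
  convolution_congr _ EventuallyEq.rfl h

lemma mollify_sub (φ : ContDiffBump (0 : E)) {f g : E → ℝ} (hf : LocallyIntegrable f μ)
    (hg : LocallyIntegrable g μ) :
    mollify μ φ (f - g) = mollify μ φ f - mollify μ φ g := by
  have h : ∀ {k : E → ℝ}, LocallyIntegrable k μ →
      ConvolutionExists (φ.normed μ) k (ContinuousLinearMap.lsmul ℝ ℝ) μ := fun hk =>
    φ.hasCompactSupport_normed.convolutionExists_left _ φ.continuous_normed hk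
  ext x
  have h1 := (h hf x).integrable_swap
  have h2 := (h hg x).integrable_swap
  simp only [Pi.sub_apply, mollify_eq_swap, mul_sub]
  exact integral_sub h1 h2

lemma mollify_nonneg (φ : ContDiffBump (0 : E)) {f : E → ℝ} (hf : 0 ≤ᵐ[μ] f) (x : E) :
    0 ≤ mollify μ φ f x := by
  rw [mollify_eq_swap]
  refine integral_nonneg_of_ae ?_
  filter_upwards [hf] with t ht using mul_nonneg (φ.nonneg_normed _) ht

lemma contDiff_mollify (φ : ContDiffBump (0 : E)) {f : E → ℝ} (hf : LocallyIntegrable f μ) :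
    ContDiff ℝ ∞ (mollify μ φ f) :=
  φ.hasCompactSupport_normed.contDiff_convolution_left _ φ.contDiff_normed hf

lemma lintegral_normed_eq_one (φ : ContDiffBump (0 : E)) :
    ∫⁻ t, ENNReal.ofReal (φ.normed μ t) ∂μ = 1 := by
  rw [← ofReal_integral_eq_lintegral_ofReal φ.integrable_normed
    (Eventually.of_forall φ.nonneg_normed), φ.integral_normed, ENNReal.ofReal_one]

/-- Mollification does not increase the `L^p` norm. -/
lemma eLpNorm_mollify_le (φ : ContDiffBump (0 : E)) {f : E → ℝ} {p : ℝ≥0∞}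
    (hp : 1 ≤ p) (hp' : p ≠ ⊤) (hf : AEStronglyMeasurable f μ) :
    eLpNorm (mollify μ φ f) p μ ≤ eLpNorm f p μ := by
  -- A strongly measurable representative makes (x, t) ↦ g (x - t) jointly measurable, as Tonelli's
  -- theorem requires below.
  rw [mollify_congr φ hf.ae_eq_mk, eLpNorm_congr_ae hf.ae_eq_mk]
  set g := hf.mk f
  have hg : StronglyMeasurable g := hf.stronglyMeasurable_mk
  have hp0 : p ≠ 0 := (zero_lt_one.trans_le hp).ne'
  have hpr : 0 < p.toReal := ENNReal.toReal_pos hp0 hp'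
  have hm : Measurable fun t => ENNReal.ofReal (φ.normed μ t) :=
    φ.continuous_normed.measurable.ennreal_ofReal
  -- The kernel is a probability density, so Jensen's inequality takes the form "the L¹ norm is at
  -- most the L^p norm" for `ν`.
  set ν := μ.withDensity fun t => ENNReal.ofReal (φ.normed μ t) with hν
  have : IsProbabilityMeasure ν := ⟨by
    rw [hν, withDensity_apply _ MeasurableSet.univ, Measure.restrict_univ,
      lintegral_normed_eq_one]⟩
  have hgx (x : E) : StronglyMeasurable fun t => g (x - t) :=
    hg.comp_measurable (measurable_const.sub measurable_id)
  have key (x : E) : ‖mollify μ φ g x‖ₑ ^ p.toReal ≤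
      ∫⁻ t, ENNReal.ofReal (φ.normed μ t) * ‖g (x - t)‖ₑ ^ p.toReal ∂μ := by
    have h1 : ‖mollify μ φ g x‖ₑ ≤ eLpNorm (fun t => g (x - t)) 1 ν := by
      rw [eLpNorm_one_eq_lintegral_enorm, hν, lintegral_withDensity_eq_lintegral_mul _ hm
        (hgx x).enorm, mollify_eq]
      refine (enorm_integral_le_lintegral_enorm _).trans (lintegral_mono fun t => ?_)
      rw [enorm_mul, Pi.mul_apply, Real.enorm_of_nonneg (φ.nonneg_normed t)]
    have h2 := h1.trans (eLpNorm_le_eLpNorm_of_exponent_le hp (hgx x).aestronglyMeasurable)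
    rw [eLpNorm_eq_lintegral_rpow_enorm_toReal hp0 hp', hν,
      lintegral_withDensity_eq_lintegral_mul _ hm ((hgx x).enorm.pow_const _)] at h2
    calc _ ≤ _ := ENNReal.rpow_le_rpow h2 hpr.le
      _ = _ := by
        rw [← ENNReal.rpow_mul, one_div, inv_mul_cancel₀ hpr.ne', ENNReal.rpow_one]; rfl
  rw [eLpNorm_eq_lintegral_rpow_enorm_toReal hp0 hp', eLpNorm_eq_lintegral_rpow_enorm_toReal hp0 hp']
  refine ENNReal.rpow_le_rpow ?_ (by positivity)
  refine (lintegral_mono key).trans ?_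
  -- After Tonelli, translation invariance makes the inner integral independent of t, and the kernel
  -- integrates to 1.
  rw [lintegral_lintegral_swap]
  · have (t : E) : ∫⁻ x, ENNReal.ofReal (φ.normed μ t) * ‖g (x - t)‖ₑ ^ p.toReal ∂μ =
        ENNReal.ofReal (φ.normed μ t) * ∫⁻ x, ‖g x‖ₑ ^ p.toReal ∂μ := by
      rw [lintegral_const_mul' _ _ ENNReal.ofReal_ne_top,
        lintegral_sub_right_eq_self (fun x => ‖g x‖ₑ ^ p.toReal) t]
    simp_rw [this]
    rw [lintegral_mul_const _ hm, lintegral_normed_eq_one, one_mul]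
  · refine Measurable.aemeasurable ?_
    refine (hm.comp measurable_snd).mul ?_
    exact (hg.measurable.comp (measurable_fst.sub measurable_snd)).enorm.pow_const _

/-- Mollifications of a continuous function with compact support converge in `L^p`. -/
lemma tendsto_eLpNorm_mollify_sub_of_continuous {φ : ℕ → ContDiffBump (0 : E)}
    (hφ : Tendsto (fun n => (φ n).rOut) atTop (𝓝 0)) {g : E → ℝ} (hg : Continuous g)
    (hgc : HasCompactSupport g) {p : ℝ≥0∞} (hp' : p ≠ ⊤) :
    Tendsto (fun n => eLpNorm (mollify μ (φ n) g - g) p μ) atTop (𝓝 0) := by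
  set s := Metric.cthickening 1 (tsupport g)
  have hs : IsCompact s := hgc.cthickening
  have huc : UniformContinuous g := hgc.uniformContinuous_of_continuous hg
  set C : ℝ≥0∞ := μ s ^ (1 / p.toReal)
  have hC : C ≠ ⊤ := ENNReal.rpow_ne_top_of_nonneg (by positivity) hs.measure_ne_top
  have hlim : Tendsto (fun ε : ℝ => ENNReal.ofReal ε * C) (𝓝[>] 0) (𝓝 0) := by
    have : Tendsto (fun ε : ℝ => ENNReal.ofReal ε * C) (𝓝 0) (𝓝 (ENNReal.ofReal 0 * C)) :=
      ENNReal.Tendsto.mul_const (ENNReal.tendsto_ofReal tendsto_id) (Or.inr hC)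
    rw [ENNReal.ofReal_zero, zero_mul] at this
    exact this.mono_left nhdsWithin_le_nhds
  rw [ENNReal.tendsto_nhds_zero]
  intro η hη
  obtain ⟨ε, hε, hεpos⟩ := ((ENNReal.tendsto_nhds_zero.1 hlim η hη).and self_mem_nhdsWithin).exists
  obtain ⟨r, hr, hrε⟩ := Metric.uniformContinuous_iff.1 huc ε hεpos
  -- Radius below `r` makes the uniform error at most `ε`; radius below 1 keeps the supports in the
  -- fixed compact set `s`.
  filter_upwards [hφ.eventually_lt_const hr, hφ.eventually_lt_const one_pos] with n hn hn1
  refine (eLpNorm_sub_le_of_dist_bdd μ hp' hs.measurableSet (le_of_lt hεpos) ?_ ?_ ?_).trans hε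
  · intro x
    exact ContDiffBump.dist_normed_convolution_le hg.aestronglyMeasurable fun y hy =>
      (hrε ((Metric.mem_ball.1 hy).trans hn)).le
  · intro x hx
    have := support_convolution_subset (ContinuousLinearMap.lsmul ℝ ℝ) (μ := μ) hx
    rw [ContDiffBump.support_normed_eq] at this
    obtain ⟨a, ha, b, hb, rfl⟩ := this
    refine Metric.mem_cthickening_of_dist_le _ b _ _ (subset_tsupport _ hb) ?_
    rw [mem_ball_zero_iff] at ha
    simpa [dist_eq_norm] using (ha.trans hn1).le
  · exact (subset_tsupport g).trans (Metric.self_subset_cthickening _)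

/-- Mollifications converge in `L^p`. -/
lemma tendsto_eLpNorm_mollify_sub {φ : ℕ → ContDiffBump (0 : E)}
    (hφ : Tendsto (fun n => (φ n).rOut) atTop (𝓝 0)) {f : E → ℝ} {p : ℝ≥0∞}
    (hp : 1 ≤ p) (hp' : p ≠ ⊤) (hf : MemLp f p μ) :
    Tendsto (fun n => eLpNorm (mollify μ (φ n) f - f) p μ) atTop (𝓝 0) := by
  rw [ENNReal.tendsto_nhds_zero]
  intro η hη
  -- A three-thirds argument: the contraction property controls the mollification of f - g uniformly
  -- in n.
  obtain ⟨g, hgc, hfg, hg, hgp⟩ := hf.exists_hasCompactSupport_eLpNorm_sub_le hp'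
    (ε := η / 3) (by simpa using hη.ne')
  have hfl := hf.locallyIntegrable hp
  have hgl := hgp.locallyIntegrable hp
  filter_upwards [ENNReal.tendsto_nhds_zero.1
    (tendsto_eLpNorm_mollify_sub_of_continuous hφ hg hgc hp' (μ := μ)) (η / 3)
      (ENNReal.div_pos hη.ne' (by simp))] with n hn
  have hfgm : AEStronglyMeasurable (f - g) μ := (hf.sub hgp).1
  have hm1 : AEStronglyMeasurable (mollify μ (φ n) (f - g)) μ :=
    (contDiff_mollify _ (hfl.sub hgl)).continuous.aestronglyMeasurable
  have hm2 : AEStronglyMeasurable (mollify μ (φ n) g - g) μ :=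
    ((contDiff_mollify _ hgl).continuous.sub hg).aestronglyMeasurable
  have e : mollify μ (φ n) f - f =
      (mollify μ (φ n) (f - g) + (mollify μ (φ n) g - g)) - (f - g) := by
    rw [mollify_sub _ hfl hgl]; abel
  rw [e]
  calc _ ≤ _ := eLpNorm_sub_le (hm1.add hm2) hfgm hp
    _ ≤ _ := add_le_add_left (eLpNorm_add_le hm1 hm2 hp) _
    _ ≤ η / 3 + η / 3 + η / 3 := by
      gcongr
      exact (eLpNorm_mollify_le _ hp hp' hfgm).trans hfg
    _ = η := ENNReal.add_thirds η

/-- A sequence of bump functions with radii tending to `0` and bounded eccentricity. -/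
def shrinkingBump (n : ℕ) : ContDiffBump (0 : E) where
  rIn := 1 / (n + 1)
  rOut := 2 * (1 / (n + 1))
  rIn_pos := Nat.one_div_pos_of_nat
  rIn_lt_rOut := by
    have : 0 < 1 / ((n : ℝ) + 1) := Nat.one_div_pos_of_nat
    linarith

omit [NormedSpace ℝ E] [FiniteDimensional ℝ E] [MeasurableSpace E] [BorelSpace E] in
lemma tendsto_shrinkingBump_rOut :
    Tendsto (fun n => (shrinkingBump (E := E) n).rOut) atTop (𝓝 0) := by
  simpa [shrinkingBump] using! (tendsto_one_div_add_atTop_nhds_zero_nat (𝕜 := ℝ)).const_mul 2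

/-- This is Lebesgue differentiation: the fixed ratio 2 of outer to inner radius makes the kernels
comparable to averages over balls. -/
lemma ae_tendsto_mollify_shrinkingBump {f : E → ℝ} (hf : LocallyIntegrable f μ) :
    ∀ᵐ x ∂μ, Tendsto (fun n => mollify μ (shrinkingBump n) f x) atTop (𝓝 (f x)) :=
  ContDiffBump.ae_convolution_tendsto_right_of_locallyIntegrable (K := 2)
    tendsto_shrinkingBump_rOut (Eventually.of_forall fun _ => le_rfl) hf

end Mollification

/-- Passage to the limit in `∫ B hₙ Dₙ`, with `Dₙ` convergent in `L^p`, `hₙ` bounded and convergent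
almost everywhere and `B` in the dual space. -/
lemma tendsto_integral_mul_mul {X : Type*} [MeasurableSpace X] {μ : Measure X} {p q : ℝ≥0∞}
    [ENNReal.HolderTriple q p 1] {B a h : X → ℝ} {D H : ℕ → X → ℝ} {C : ℝ}
    (hB : MemLp B q μ) (ha : MemLp a p μ)
    (hD : ∀ n, AEStronglyMeasurable (D n) μ)
    (hDa : Tendsto (fun n => eLpNorm (D n - a) p μ) atTop (𝓝 0))
    (hH : ∀ n, AEStronglyMeasurable (H n) μ) (hHC : ∀ n, ∀ᵐ x ∂μ, ‖H n x‖ ≤ C)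
    (hHh : ∀ᵐ x ∂μ, Tendsto (fun n => H n x) atTop (𝓝 (h x))) :
    Tendsto (fun n => ∫ x, B x * (H n x * D n x) ∂μ) atTop (𝓝 (∫ x, B x * (h x * a x) ∂μ)) := by
  have hBa : Integrable (fun x => B x * a x) μ := memLp_one_iff_integrable.1 (ha.mul' hB)
  have hBm : ∀ n, AEStronglyMeasurable (fun x => B x * H n x) μ := fun n => hB.1.mul (hH n)
  have hlim : Tendsto (fun n => ∫ x, H n x * (B x * a x) ∂μ) atTop
      (𝓝 (∫ x, h x * (B x * a x) ∂μ)) := by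
    refine tendsto_integral_of_dominated_convergence (fun x => C * ‖B x * a x‖)
      (fun n => (hH n).mul hBa.1) (hBa.norm.const_mul C) (fun n => ?_) ?_
    · filter_upwards [hHC n] with x hx
      rw [norm_mul]
      gcongr
    · filter_upwards [hHh] with x hx using hx.mul_const _
  -- For small n nothing is known about the integrability of `D n`; convergence gives it eventually,
  -- which is enough.
  have hmem : ∀ᶠ n in atTop, MemLp (D n - a) p μ := by
    filter_upwards [hDa.eventually_lt_const ENNReal.zero_lt_top] with n hn
    exact ⟨(hD n).sub ha.1, hn⟩
  have hBH : ∀ n, MemLp (fun x => B x * H n x) q μ := fun n => by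
    refine MemLp.of_le_mul (c := C) hB (hBm n) ?_
    filter_upwards [hHC n] with x hx
    rw [norm_mul, mul_comm]
    gcongr
  have hle : ∀ n, eLpNorm (fun x => B x * H n x) q μ ≤ ENNReal.ofReal C * eLpNorm B q μ :=
    fun n => by
      refine eLpNorm_le_mul_eLpNorm_of_ae_le_mul ?_ _
      filter_upwards [hHC n] with x hx
      rw [norm_mul, mul_comm]
      gcongr
  have hint : ∀ᶠ n in atTop, Integrable (fun x => B x * H n x * (D n - a) x) μ := by
    filter_upwards [hmem] with n hn
    exact memLp_one_iff_integrable.1 (hn.mul' (hBH n))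
  -- In the splitting Hₙ Dₙ = Hₙ (Dₙ - a) + Hₙ a, Hölder with the uniform bound `C` handles this
  -- first part; `hlim` is the second.
  have hdiff : Tendsto (fun n => ∫ x, B x * H n x * (D n - a) x ∂μ) atTop (𝓝 0) := by
    have := tendsto_integral_of_L1' (μ := μ) (fun _ => (0 : ℝ))
      (F := fun n x => B x * H n x * (D n - a) x) (l := atTop) aestronglyMeasurable_const hint ?_
    · simpa using this
    · have hlim0 : Tendsto (fun n => ENNReal.ofReal C * eLpNorm B q μ * eLpNorm (D n - a) p μ)
          atTop (𝓝 0) := by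
        have := ENNReal.Tendsto.const_mul hDa
          (Or.inr (ENNReal.mul_ne_top (ENNReal.ofReal_ne_top (r := C)) hB.2.ne))
        simpa using this
      refine tendsto_of_tendsto_of_tendsto_of_le_of_le tendsto_const_nhds hlim0
        (fun _ => zero_le) fun n => ?_
      have h0 : ((fun x => B x * H n x * (D n - a) x) - fun _ => (0 : ℝ)) =
          (fun x => B x * H n x) • (D n - a) := by
        ext x; simp
      simp only [h0]
      refine (eLpNorm_smul_le_mul_eLpNorm ((hD n).sub ha.1) (hBm n) (p := q) (q := p)).trans ?_
      gcongr
      exact hle n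
  have hsum := hdiff.add hlim
  rw [zero_add] at hsum
  have e : ∫ x, h x * (B x * a x) ∂μ = ∫ x, B x * (h x * a x) ∂μ := by
    congr 1; ext x; ring
  rw [e] at hsum
  refine hsum.congr' ?_
  filter_upwards [hint] with n hn
  rw [← integral_add hn]
  · congr 1; ext x; simp; ring
  · refine (hBa.norm.const_mul C).mono' ((hH n).mul hBa.1) ?_
    filter_upwards [hHC n] with x hx
    rw [norm_mul]
    gcongr

/-! ### Weak partial derivatives in Euclidean open sets -/

section WeakPartials

variable {N : ℕ}

local notation "𝔼" => EuclideanSpace ℝ (Fin N)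

/-- The `i`-th standard basis vector. -/
abbrev stdVec (i : Fin N) : EuclideanSpace ℝ (Fin N) := EuclideanSpace.single i (1 : ℝ)

/-- The functions `a i` are the weak partial derivatives of `f` in `U`. -/
structure HasWeakPartials (U : Set 𝔼) (f : 𝔼 → ℝ) (a : Fin N → 𝔼 → ℝ) : Prop where
  locallyIntegrableOn : LocallyIntegrableOn f U volume
  locallyIntegrableOn_partial (i : Fin N) : LocallyIntegrableOn (a i) U volume
  integral_eq (i : Fin N) (ψ : 𝔼 → ℝ) : ContDiff ℝ ∞ ψ → HasCompactSupport ψ → tsupport ψ ⊆ U →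
    ∫ y, f y * fderiv ℝ ψ y (stdVec i) = -∫ y, a i y * ψ y

/-- A smooth function with compact support in `U`, equal to `1` near `K`. -/
lemma exists_smooth_cutoff {U K : Set 𝔼} (hU : IsOpen U) (hK : IsCompact K) (hKU : K ⊆ U) :
    ∃ χ : 𝔼 → ℝ, ContDiff ℝ ∞ χ ∧ HasCompactSupport χ ∧ tsupport χ ⊆ U ∧
      (∀ᶠ x in 𝓝ˢ K, χ x = 1) ∧ ∀ x, χ x ∈ Icc (0 : ℝ) 1 := by
  obtain ⟨L, hL, hKL, hLU⟩ := exists_compact_between hK hU hKU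
  obtain ⟨χ, h1, h0, h01⟩ := exists_contMDiffMap_one_nhds_of_subset_interior (n := (⊤ : ℕ∞))
    (𝓘(ℝ, 𝔼)) hK.isClosed hKL
  have hs : tsupport χ ⊆ L := by
    refine closure_minimal (fun x hx => ?_) hL.isClosed
    by_contra hxL
    exact hx (h0 x hxL)
  exact ⟨χ, χ.contMDiff.contDiff, hL.of_isClosed_subset (isClosed_tsupport _) hs,
    hs.trans hLU, h1, h01⟩

/-- The factor k is bounded and the product vanishes off the compact set `tsupport k`, so only
integrability on that set matters. -/
lemma memLp_mul_of_tsupport_subset {U : Set 𝔼} {f k : 𝔼 → ℝ} {p : ℝ≥0∞}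
    (hf : ∀ K, IsCompact K → K ⊆ U → MemLp f p (volume.restrict K))
    (hk : Continuous k) (hkc : HasCompactSupport k) (hkU : tsupport k ⊆ U) :
    MemLp (fun y => k y * f y) p volume := by
  obtain ⟨C, hC⟩ := hkc.exists_bound_of_continuous hk
  have h0 : MemLp (fun y => k y * f y) p (volume.restrict (tsupport k)) :=
    (hf _ hkc hkU).of_le_mul (c := C) (hk.aestronglyMeasurable.mul (hf _ hkc hkU).1)
      (Eventually.of_forall fun y => by rw [norm_mul]; gcongr; exact hC y)
  have := (memLp_indicator_iff_restrict (isClosed_tsupport k).measurableSet).2 h0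
  rwa [indicator_eq_self.2] at this
  exact Function.support_mul_subset_left _ _ |>.trans (subset_tsupport k)

lemma integrable_mul_of_tsupport_subset {U : Set 𝔼} {f k : 𝔼 → ℝ}
    (hf : LocallyIntegrableOn f U volume)
    (hk : Continuous k) (hkc : HasCompactSupport k) (hkU : tsupport k ⊆ U) :
    Integrable (fun y => k y * f y) volume := by
  rw [← memLp_one_iff_integrable]
  refine memLp_mul_of_tsupport_subset (fun K hK hKU => ?_) hk hkc hkU
  exact memLp_one_iff_integrable.2 (hf.integrableOn_compact_subset hKU hK)

lemma continuous_fderiv_stdVec {ψ : 𝔼 → ℝ} (hψ : ContDiff ℝ 1 ψ) (i : Fin N) :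
    Continuous fun y => fderiv ℝ ψ y (stdVec i) :=
  (hψ.continuous_fderiv one_ne_zero).clm_apply continuous_const

lemma tsupport_fderiv_stdVec_subset (ψ : 𝔼 → ℝ) (i : Fin N) :
    tsupport (fun y => fderiv ℝ ψ y (stdVec i)) ⊆ tsupport ψ :=
  tsupport_fderiv_apply_subset ℝ _

lemma hasCompactSupport_fderiv_stdVec {ψ : 𝔼 → ℝ} (hψ : HasCompactSupport ψ) (i : Fin N) :
    HasCompactSupport fun y => fderiv ℝ ψ y (stdVec i) :=
  hψ.fderiv_apply ℝ _

lemma contDiff_fderiv_stdVec {ψ : 𝔼 → ℝ} (hψ : ContDiff ℝ ∞ ψ) (i : Fin N) :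
    ContDiff ℝ ∞ fun y => fderiv ℝ ψ y (stdVec i) :=
  (hψ.fderiv_right (m := ∞) (by simp)).clm_apply contDiff_const

/-- The product with a smooth cutoff function has global weak partial derivatives. -/
lemma HasWeakPartials.cutoff_mul {U : Set 𝔼} {f : 𝔼 → ℝ} {a : Fin N → 𝔼 → ℝ}
    (h : HasWeakPartials U f a) {χ : 𝔼 → ℝ} (hχ : ContDiff ℝ ∞ χ) (hχc : HasCompactSupport χ)
    (hχU : tsupport χ ⊆ U) :
    HasWeakPartials univ (fun y => χ y * f y)
      (fun i y => χ y * a i y + fderiv ℝ χ y (stdVec i) * f y) where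
  locallyIntegrableOn := by
    rw [locallyIntegrableOn_univ]
    exact (integrable_mul_of_tsupport_subset h.locallyIntegrableOn hχ.continuous hχc
      hχU).locallyIntegrable
  locallyIntegrableOn_partial i := by
    rw [locallyIntegrableOn_univ]
    refine Integrable.locallyIntegrable (Integrable.add ?_ ?_)
    · exact integrable_mul_of_tsupport_subset (h.locallyIntegrableOn_partial i) hχ.continuous hχc
        hχU
    · exact integrable_mul_of_tsupport_subset h.locallyIntegrableOn
        (contDiff_fderiv_stdVec hχ i).continuous (hasCompactSupport_fderiv_stdVec hχc i)
        ((tsupport_fderiv_stdVec_subset χ i).trans hχU)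
  integral_eq i ψ hψ hψc _ := by
    -- Although ψ may leave U, χψ is admissible in U; the product rule for χψ creates the extra term
    -- with the derivative of χ.
    have hp : ContDiff ℝ ∞ (fun y => χ y * ψ y) := hχ.mul hψ
    have hpU : tsupport (fun y => χ y * ψ y) ⊆ U := (tsupport_mul_subset_left).trans hχU
    have key := h.integral_eq i _ hp hχc.mul_right hpU
    have hd (y : 𝔼) : fderiv ℝ (fun y => χ y * ψ y) y (stdVec i) =
        χ y * fderiv ℝ ψ y (stdVec i) + ψ y * fderiv ℝ χ y (stdVec i) := by
      have h1 : DifferentiableAt ℝ χ y := hχ.differentiable (by simp) y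
      have h2 : DifferentiableAt ℝ ψ y := hψ.differentiable (by simp) y
      rw [fderiv_fun_mul h1 h2]
      simp
    simp_rw [hd] at key
    have i1 : Integrable (fun y => (χ y * fderiv ℝ ψ y (stdVec i)) * f y) volume :=
      integrable_mul_of_tsupport_subset h.locallyIntegrableOn
        (hχ.continuous.mul (contDiff_fderiv_stdVec hψ i).continuous) hχc.mul_right
        ((tsupport_mul_subset_left).trans hχU)
    have i2 : Integrable (fun y => (fderiv ℝ χ y (stdVec i) * ψ y) * f y) volume :=
      integrable_mul_of_tsupport_subset h.locallyIntegrableOn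
        ((contDiff_fderiv_stdVec hχ i).continuous.mul hψ.continuous)
        (hasCompactSupport_fderiv_stdVec hχc i).mul_right
        ((tsupport_mul_subset_left).trans ((tsupport_fderiv_stdVec_subset χ i).trans hχU))
    have i3 : Integrable (fun y => (χ y * ψ y) * a i y) volume :=
      integrable_mul_of_tsupport_subset (h.locallyIntegrableOn_partial i)
        (hχ.continuous.mul hψ.continuous) hχc.mul_right ((tsupport_mul_subset_left).trans hχU)
    have e1 : ∫ y, f y * (χ y * fderiv ℝ ψ y (stdVec i) + ψ y * fderiv ℝ χ y (stdVec i)) =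
        (∫ y, (χ y * fderiv ℝ ψ y (stdVec i)) * f y) +
          ∫ y, (fderiv ℝ χ y (stdVec i) * ψ y) * f y := by
      rw [← integral_add i1 i2]; congr 1; ext y; ring
    have e2 : ∫ y, (χ y * a i y + fderiv ℝ χ y (stdVec i) * f y) * ψ y =
        (∫ y, (χ y * ψ y) * a i y) + ∫ y, (fderiv ℝ χ y (stdVec i) * ψ y) * f y := by
      rw [← integral_add i3 i2]; congr 1; ext y; ring
    have e3 : ∫ y, χ y * f y * fderiv ℝ ψ y (stdVec i) =
        ∫ y, (χ y * fderiv ℝ ψ y (stdVec i)) * f y := by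
      congr 1; ext y; ring
    have e4 : ∫ y, a i y * (χ y * ψ y) = ∫ y, (χ y * ψ y) * a i y := by
      congr 1; ext y; ring
    rw [e3, e2]
    rw [e1, e4] at key
    linarith

/-- Partial derivatives commute with mollification. -/
lemma HasWeakPartials.fderiv_mollify {f : 𝔼 → ℝ} {a : Fin N → 𝔼 → ℝ}
    (h : HasWeakPartials univ f a) (φ : ContDiffBump (0 : 𝔼)) (x : 𝔼) (i : Fin N) :
    fderiv ℝ (mollify volume φ f) x (stdVec i) = mollify volume φ (a i) x := by
  have hf : LocallyIntegrable f volume := locallyIntegrableOn_univ.1 h.locallyIntegrableOn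
  set k := φ.normed (volume : Measure 𝔼)
  have hk : ContDiff ℝ ∞ k := φ.contDiff_normed
  have hkc : HasCompactSupport k := φ.hasCompactSupport_normed
  have hd := hkc.hasFDerivAt_convolution_left (ContinuousLinearMap.lsmul ℝ ℝ)
    (hk.of_le (by simp)) hf x
  have hd' : fderiv ℝ (mollify volume φ f) x = _ := hd.fderiv
  rw [hd', convolution_eq_swap]
  have hint : Integrable (fun t => (ContinuousLinearMap.precompL 𝔼
      (ContinuousLinearMap.lsmul ℝ ℝ) (fderiv ℝ k (x - t))) (f t)) volume :=
    ((hkc.fderiv ℝ).convolutionExists_left _ (hk.continuous_fderiv (by simp)) hf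
      x).integrable_swap
  rw [ContinuousLinearMap.integral_apply hint]
  -- The derivative falls on the kernel, and the reflected kernel is itself a test function. The
  -- sign from the reflection cancels the one in the weak derivative.
  set ψ : 𝔼 → ℝ := fun t => k (x - t)
  have hψ : ContDiff ℝ ∞ ψ := hk.comp (contDiff_const.sub contDiff_id)
  have hψc : HasCompactSupport ψ := hkc.comp_homeomorph (Homeomorph.subLeft x)
  have key := h.integral_eq i ψ hψ hψc (subset_univ _)
  have hdψ (t : 𝔼) : fderiv ℝ ψ t (stdVec i) = -fderiv ℝ k (x - t) (stdVec i) := by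
    have h1 : HasFDerivAt k (fderiv ℝ k (x - t)) (x - t) :=
      (hk.differentiable (by simp) _).hasFDerivAt
    have h2 := h1.comp t ((hasFDerivAt_id t).const_sub x)
    have h3 : fderiv ℝ ψ t = _ := h2.fderiv
    rw [h3]; simp
  rw [mollify_eq_swap]
  simp only [hdψ, mul_neg, integral_neg, neg_inj] at key
  calc _ = ∫ y, f y * fderiv ℝ k (x - y) (stdVec i) := by
        congr 1; ext t
        simp [ContinuousLinearMap.precompL_apply, mul_comm]
    _ = ∫ y, a i y * ψ y := key
    _ = _ := by congr 1; ext t; simp only [ψ]; ring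

/-- Local approximation by smooth functions in the Sobolev norm. -/
lemma HasWeakPartials.exists_approx {U : Set 𝔼} (hU : IsOpen U) {f : 𝔼 → ℝ}
    {a : Fin N → 𝔼 → ℝ} (h : HasWeakPartials U f a) {p : ℝ≥0∞} (hp : 1 ≤ p) (hp' : p ≠ ⊤)
    (hf : ∀ K, IsCompact K → K ⊆ U → MemLp f p (volume.restrict K))
    (ha : ∀ i K, IsCompact K → K ⊆ U → MemLp (a i) p (volume.restrict K))
    {K : Set 𝔼} (hK : IsCompact K) (hKU : K ⊆ U) :
    ∃ F : ℕ → 𝔼 → ℝ, (∀ n, ContDiff ℝ ∞ (F n)) ∧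
      ((∀ᵐ x ∂(volume.restrict U), 0 ≤ f x) → ∀ n x, 0 ≤ F n x) ∧
      (∀ᵐ x ∂(volume.restrict K), Tendsto (fun n => F n x) atTop (𝓝 (f x))) ∧
      ∀ i, Tendsto (fun n => eLpNorm ((fun x => fderiv ℝ (F n) x (stdVec i)) - a i) p
        (volume.restrict K)) atTop (𝓝 0) := by
  -- As χ = 1 near K, neither f nor its weak gradient is altered on K, and χ ≥ 0 preserves
  -- nonnegativity.
  obtain ⟨χ, hχ, hχc, hχU, hχ1, hχ01⟩ := exists_smooth_cutoff hU hK hKU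
  have hw := h.cutoff_mul hχ hχc hχU
  have hli := locallyIntegrableOn_univ.1 hw.locallyIntegrableOn
  refine ⟨fun n => mollify volume (shrinkingBump n) (fun y => χ y * f y),
    fun n => contDiff_mollify _ hli, fun h0 n x => ?_, ?_, fun i => ?_⟩
  · refine mollify_nonneg _ ?_ x
    filter_upwards [(ae_restrict_iff' hU.measurableSet).1 h0] with y hy
    by_cases hyU : y ∈ U
    · exact mul_nonneg (hχ01 y).1 (hy hyU)
    · simp [image_eq_zero_of_notMem_tsupport fun h' => hyU (hχU h')]
  · rw [ae_restrict_iff' hK.measurableSet]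
    filter_upwards [ae_tendsto_mollify_shrinkingBump hli] with x hx hxK
    simpa [hχ1.self_of_nhdsSet x hxK] using hx
  · simp only [hw.fderiv_mollify]
    have hmem : MemLp (fun y => χ y * a i y + fderiv ℝ χ y (stdVec i) * f y) p volume :=
      (memLp_mul_of_tsupport_subset (ha i) hχ.continuous hχc hχU).add
        (memLp_mul_of_tsupport_subset hf (contDiff_fderiv_stdVec hχ i).continuous
        (hasCompactSupport_fderiv_stdVec hχc i)
        ((tsupport_fderiv_stdVec_subset χ i).trans hχU))
    have hlim := tendsto_eLpNorm_mollify_sub tendsto_shrinkingBump_rOut hp hp' hmem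
    refine tendsto_of_tendsto_of_tendsto_of_le_of_le tendsto_const_nhds hlim
      (fun _ => zero_le) fun n => ?_
    refine (le_of_eq ?_).trans (eLpNorm_mono_measure _ (Measure.restrict_le_self (s := K)))
    refine eLpNorm_congr_ae ?_
    filter_upwards [ae_restrict_mem hK.measurableSet] with x hx
    have h1 : χ =ᶠ[𝓝 x] fun _ => (1 : ℝ) := hχ1.filter_mono (nhds_le_nhdsSet hx)
    have h2 : fderiv ℝ χ x = 0 := by
      rw [h1.fderiv_eq, fderiv_const_apply]
    simp [h2, h1.self_of_nhds]

end WeakPartials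

/-! ### Weak chain rule and Sobolev test functions in a Euclidean open set -/

section ChainRule

variable {N : ℕ}

local notation "𝔼" => EuclideanSpace ℝ (Fin N)

lemma fderiv_comp_stdVec {k : ℝ → ℝ} {F : 𝔼 → ℝ} {y : 𝔼} (hk : DifferentiableAt ℝ k (F y))
    (hF : DifferentiableAt ℝ F y) (i : Fin N) :
    fderiv ℝ (fun x => k (F x)) y (stdVec i) = deriv k (F y) * fderiv ℝ F y (stdVec i) := by
  have : fderiv ℝ (fun x => k (F x)) y = _ := (hk.hasDerivAt.comp_hasFDerivAt y hF.hasFDerivAt).fderiv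
  rw [this]; simp

lemma setIntegral_tsupport_eq {k g : 𝔼 → ℝ} (h : ∀ y, k y = 0 → y ∉ tsupport k → g y = 0) :
    ∫ y in tsupport k, g y = ∫ y, g y :=
  setIntegral_eq_integral_of_forall_compl_eq_zero fun y hy =>
    h y (image_eq_zero_of_notMem_tsupport hy) hy

lemma fderiv_stdVec_eq_zero {k : 𝔼 → ℝ} {y : 𝔼} (hy : y ∉ tsupport k) (i : Fin N) :
    fderiv ℝ k y (stdVec i) = 0 :=
  image_eq_zero_of_notMem_tsupport (f := fun y => fderiv ℝ k y (stdVec i))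
    fun h => hy (tsupport_fderiv_stdVec_subset k i h)

/-- Integrability after multiplication by a `C¹` function that vanishes off `U`. -/
lemma integrable_of_memLp_mul_of_tsupport_subset {U : Set 𝔼} {f k : 𝔼 → ℝ} {p : ℝ≥0∞} (hp : 1 ≤ p)
    (hf : ∀ K, IsCompact K → K ⊆ U → MemLp f p (volume.restrict K))
    (hk : Continuous k) (hkc : HasCompactSupport k) (hkU : tsupport k ⊆ U) :
    Integrable (fun y => f y * k y) volume := by
  have : ∀ K, IsCompact K → K ⊆ U → MemLp f 1 (volume.restrict K) := fun K hK hKU => by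
    have : IsFiniteMeasure (volume.restrict K) := ⟨by
      rw [Measure.restrict_apply_univ]; exact hK.measure_lt_top⟩
    exact (hf K hK hKU).mono_exponent hp
  simpa only [mul_comm] using
    memLp_one_iff_integrable.1 (memLp_mul_of_tsupport_subset this hk hkc hkU)

lemma integral_sum_add {X ι : Type*} [MeasurableSpace X] [Fintype ι] {μ : Measure X}
    {f g : ι → X → ℝ} (hf : ∀ i, Integrable (f i) μ) (hg : ∀ i, Integrable (g i) μ) :
    ∫ x, ∑ i, (f i x + g i x) ∂μ = ∑ i, (∫ x, f i x ∂μ + ∫ x, g i x ∂μ) := by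
  refine (integral_finsetSum _ fun i _ => (hf i).add (hg i)).trans ?_
  exact Finset.sum_congr rfl fun i _ => integral_add (hf i) (hg i)

/-- The chain rule for weak derivatives. -/
lemma HasWeakPartials.integral_comp_eq {U : Set 𝔼} (hU : IsOpen U) {f : 𝔼 → ℝ}
    {a : Fin N → 𝔼 → ℝ} (h : HasWeakPartials U f a) {k : ℝ → ℝ} (hk : ContDiff ℝ 1 k) {C : ℝ}
    (hkC : ∀ t, ‖k t‖ ≤ C) (hdkC : ∀ t, ‖deriv k t‖ ≤ C) (i : Fin N) {ψ : 𝔼 → ℝ}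
    (hψ : ContDiff ℝ ∞ ψ) (hψc : HasCompactSupport ψ) (hψU : tsupport ψ ⊆ U) :
    ∫ y, k (f y) * fderiv ℝ ψ y (stdVec i) = -∫ y, ψ y * (deriv k (f y) * a i y) := by
  have hfl : ∀ K, IsCompact K → K ⊆ U → MemLp f 1 (volume.restrict K) := fun K hK hKU =>
    memLp_one_iff_integrable.2 (h.locallyIntegrableOn.integrableOn_compact_subset hKU hK)
  have hal : ∀ i K, IsCompact K → K ⊆ U → MemLp (a i) 1 (volume.restrict K) := fun i K hK hKU =>
    memLp_one_iff_integrable.2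
      ((h.locallyIntegrableOn_partial i).integrableOn_compact_subset hKU hK)
  obtain ⟨F, hF, -, hFf, hFa⟩ := h.exists_approx hU le_rfl ENNReal.one_ne_top hfl hal hψc hψU
  have hdk : Continuous (deriv k) := hk.continuous_deriv le_rfl
  have hdF (n : ℕ) : Continuous fun x => fderiv ℝ (F n) x (stdVec i) :=
    (contDiff_fderiv_stdVec (hF n) i).continuous
  have hdψ : Continuous fun x => fderiv ℝ ψ x (stdVec i) :=
    (contDiff_fderiv_stdVec hψ i).continuous
  have hdψc := hasCompactSupport_fderiv_stdVec hψc i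
  have parts (n : ℕ) : ∫ y in tsupport ψ, k (F n y) * fderiv ℝ ψ y (stdVec i) =
      -∫ y in tsupport ψ, ψ y * (deriv k (F n y) * fderiv ℝ (F n) y (stdVec i)) := by
    rw [setIntegral_tsupport_eq fun y _ hy => by rw [fderiv_stdVec_eq_zero hy, mul_zero],
      setIntegral_tsupport_eq fun y h0 _ => by rw [h0, zero_mul]]
    have hkF : Differentiable ℝ fun y => k (F n y) :=
      (hk.differentiable one_ne_zero).comp ((hF n).differentiable (by simp))
    have hd (y : 𝔼) : fderiv ℝ (fun y => k (F n y)) y (stdVec i) =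
        deriv k (F n y) * fderiv ℝ (F n) y (stdVec i) :=
      fderiv_comp_stdVec (hk.differentiable one_ne_zero _) ((hF n).differentiable (by simp) _) i
    have hkFc : Continuous fun y => k (F n y) := hkF.continuous
    have hdkFc : Continuous fun y => deriv k (F n y) * fderiv ℝ (F n) y (stdVec i) :=
      (hdk.comp (hF n).continuous).mul (hdF n)
    rw [integral_mul_fderiv_eq_neg_fderiv_mul_of_integrable (g := ψ) ?_ ?_ ?_ (fun y _ => hkF y)
      fun y _ => hψ.differentiable (by simp) y]
    · congr 1
      congr 1
      ext y
      rw [hd, mul_comm]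
    · simp_rw [hd]
      exact (hdkFc.mul hψ.continuous).integrable_of_hasCompactSupport hψc.mul_left
    · exact (hkFc.mul hdψ).integrable_of_hasCompactSupport hdψc.mul_left
    · exact (hkFc.mul hψ.continuous).integrable_of_hasCompactSupport hψc.mul_left
  have lim1 : Tendsto (fun n => ∫ y in tsupport ψ, k (F n y) * fderiv ℝ ψ y (stdVec i)) atTop
      (𝓝 (∫ y in tsupport ψ, k (f y) * fderiv ℝ ψ y (stdVec i))) := by
    refine tendsto_integral_of_dominated_convergence
      (fun y => C * ‖fderiv ℝ ψ y (stdVec i)‖) (fun n => ?_) ?_ (fun n => ?_) ?_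
    · exact ((hk.continuous.comp (hF n).continuous).mul hdψ).aestronglyMeasurable
    · exact ((hdψ.integrable_of_hasCompactSupport hdψc).norm.const_mul C).restrict
    · refine Eventually.of_forall fun y => ?_
      rw [norm_mul]
      gcongr
      exact hkC _
    · filter_upwards [hFf] with y hy
      exact ((hk.continuous.tendsto _).comp hy).mul_const _
  -- The partial derivatives are only in L¹_loc, so the duality used is L¹–L^∞, with the bounded
  -- function ψ as the dual factor.
  have lim2 := tendsto_integral_mul_mul (p := 1) (q := ⊤) (μ := volume.restrict (tsupport ψ))
    (B := ψ) (H := fun n y => deriv k (F n y)) (h := fun y => deriv k (f y)) (C := C)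
    (D := fun n y => fderiv ℝ (F n) y (stdVec i))
    ((hψ.continuous.memLp_top_of_hasCompactSupport hψc volume).restrict _)
    (hal i _ hψc hψU) (fun n => (hdF n).aestronglyMeasurable) (hFa i)
    (fun n => (hdk.comp (hF n).continuous).aestronglyMeasurable)
    (fun n => Eventually.of_forall fun y => hdkC _)
    (by filter_upwards [hFf] with y hy using (hdk.tendsto _).comp hy)
  simp_rw [parts] at lim1
  have := tendsto_nhds_unique lim1 lim2.neg
  rwa [setIntegral_tsupport_eq fun y _ hy => by rw [fderiv_stdVec_eq_zero hy, mul_zero],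
      setIntegral_tsupport_eq fun y h0 _ => by rw [h0, zero_mul]] at this

/-- If the distributional divergence of `A` is nonpositive when tested with `C¹` functions, then it
may be tested with `w F(f)`, where `f ≥ 0` is a Sobolev function and `F` is bounded and
Lipschitz on `[0, ∞)`. -/
lemma HasWeakPartials.integral_test_nonneg {U : Set 𝔼} (hU : IsOpen U) {f : 𝔼 → ℝ}
    {a : Fin N → 𝔼 → ℝ} (h : HasWeakPartials U f a) {p q : ℝ≥0∞} (hp : 1 ≤ p) (hp' : p ≠ ⊤)
    (hq : 1 ≤ q) [ENNReal.HolderTriple q p 1]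
    (hf : ∀ K, IsCompact K → K ⊆ U → MemLp f p (volume.restrict K))
    (ha : ∀ i K, IsCompact K → K ⊆ U → MemLp (a i) p (volume.restrict K))
    (hf0 : ∀ᵐ x ∂(volume.restrict U), 0 ≤ f x) {A : Fin N → 𝔼 → ℝ}
    (hA : ∀ i K, IsCompact K → K ⊆ U → MemLp (A i) q (volume.restrict K))
    (hAφ : ∀ φ : 𝔼 → ℝ, ContDiff ℝ 1 φ → HasCompactSupport φ → tsupport φ ⊆ U → (∀ x, 0 ≤ φ x) →
      0 ≤ ∫ y, ∑ i, A i y * fderiv ℝ φ y (stdVec i))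
    {F : ℝ → ℝ} {ε C : ℝ} (hε : 0 < ε) (hF : ContDiffOn ℝ 1 F (Ioi (-ε)))
    (hF0 : ∀ t, 0 ≤ t → 0 ≤ F t) (hFC : ∀ t, 0 ≤ t → ‖F t‖ ≤ C)
    (hdFC : ∀ t, 0 ≤ t → ‖deriv F t‖ ≤ C)
    {w : 𝔼 → ℝ} (hw : ContDiff ℝ 1 w) (hwc : HasCompactSupport w) (hwU : tsupport w ⊆ U)
    (hw0 : ∀ x, 0 ≤ w x) :
    0 ≤ ∫ y, ∑ i, A i y * (F (f y) * fderiv ℝ w y (stdVec i) + w y * (deriv F (f y) * a i y)) := by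
  -- The approximations are nonnegative, so they stay where F is C¹ and bounded; hence each w F(Gₙ)
  -- is a legitimate C¹ test function.
  obtain ⟨G, hG, hG0, hGf, hGa⟩ := h.exists_approx hU hp hp' hf ha hwc hwU
  replace hG0 := hG0 hf0
  have hf0' : ∀ᵐ x ∂(volume.restrict (tsupport w)), 0 ≤ f x :=
    ae_mono (Measure.restrict_mono hwU le_rfl) hf0
  have hmem {t : ℝ} (ht : 0 ≤ t) : t ∈ Ioi (-ε) := by
    rw [mem_Ioi]; linarith
  have hFat {t : ℝ} (ht : 0 ≤ t) : ContDiffAt ℝ 1 F t :=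
    hF.contDiffAt (isOpen_Ioi.mem_nhds (hmem ht))
  have hdFat {t : ℝ} (ht : 0 ≤ t) : ContinuousAt (deriv F) t :=
    (hF.continuousOn_deriv_of_isOpen isOpen_Ioi le_rfl).continuousAt (isOpen_Ioi.mem_nhds (hmem ht))
  have hFG (n : ℕ) : ContDiff ℝ 1 fun y => F (G n y) :=
    hF.comp_contDiff ((hG n).of_le (by simp)) fun y => hmem (hG0 n y)
  have hdFG (n : ℕ) : Continuous fun y => deriv F (G n y) :=
    continuous_iff_continuousAt.2 fun y =>
      (hdFat (hG0 n y)).comp (f := G n) (hG n).continuous.continuousAt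
  have hdG (n : ℕ) (i : Fin N) : Continuous fun x => fderiv ℝ (G n) x (stdVec i) :=
    (contDiff_fderiv_stdVec (hG n) i).continuous
  have hdw (i : Fin N) := continuous_fderiv_stdVec hw i
  have hd (n : ℕ) (y : 𝔼) (i : Fin N) : fderiv ℝ (fun y => w y * F (G n y)) y (stdVec i) =
      F (G n y) * fderiv ℝ w y (stdVec i) +
        w y * (deriv F (G n y) * fderiv ℝ (G n) y (stdVec i)) := by
    rw [fderiv_fun_mul (hw.differentiable one_ne_zero y) ((hFG n).differentiable one_ne_zero y)]
    simp [fderiv_comp_stdVec ((hFat (hG0 n y)).differentiableAt one_ne_zero)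
      ((hG n).differentiable (by simp) y)]
    ring
  have hi1 (n : ℕ) (i : Fin N) :
      Integrable (fun y => A i y * (F (G n y) * fderiv ℝ w y (stdVec i))) volume :=
    integrable_of_memLp_mul_of_tsupport_subset hq (hA i) ((hFG n).continuous.mul (hdw i))
      (hasCompactSupport_fderiv_stdVec hwc i).mul_left
      ((tsupport_mul_subset_right).trans ((tsupport_fderiv_stdVec_subset w i).trans hwU))
  have hi2 (n : ℕ) (i : Fin N) : Integrable (fun y => A i y *
      (w y * (deriv F (G n y) * fderiv ℝ (G n) y (stdVec i)))) volume :=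
    integrable_of_memLp_mul_of_tsupport_subset hq (hA i)
      (hw.continuous.mul ((hdFG n).mul (hdG n i))) hwc.mul_right
      ((tsupport_mul_subset_left).trans hwU)
  have hpos (n : ℕ) : 0 ≤ ∑ i, ((∫ y in tsupport w, A i y * (F (G n y) * fderiv ℝ w y (stdVec i))) +
      ∫ y in tsupport w, A i y * w y * (deriv F (G n y) * fderiv ℝ (G n) y (stdVec i))) := by
    have := hAφ (fun y => w y * F (G n y)) (hw.mul (hFG n)) hwc.mul_right
      ((tsupport_mul_subset_left).trans hwU) fun y => mul_nonneg (hw0 y) (hF0 _ (hG0 n y))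
    simp_rw [hd, mul_add] at this
    rw [integral_sum_add (hi1 n) (hi2 n)] at this
    refine this.trans_eq (Finset.sum_congr rfl fun i _ => ?_)
    rw [
      setIntegral_tsupport_eq fun y _ hy => by rw [fderiv_stdVec_eq_zero hy, mul_zero, mul_zero],
      setIntegral_tsupport_eq fun y h0 _ => by rw [h0, mul_zero, zero_mul]]
    simp only [mul_assoc]
  have hAl (i : Fin N) : Integrable (fun y => A i y * fderiv ℝ w y (stdVec i)) volume :=
    integrable_of_memLp_mul_of_tsupport_subset hq (hA i) (hdw i)
      (hasCompactSupport_fderiv_stdVec hwc i) ((tsupport_fderiv_stdVec_subset w i).trans hwU)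
  have hFf : ∀ᵐ y ∂(volume.restrict (tsupport w)),
      Tendsto (fun n => F (G n y)) atTop (𝓝 (F (f y))) := by
    filter_upwards [hGf, hf0'] with y hy h0
    exact (hFat h0).continuousAt.tendsto.comp hy
  have hdFf : ∀ᵐ y ∂(volume.restrict (tsupport w)),
      Tendsto (fun n => deriv F (G n y)) atTop (𝓝 (deriv F (f y))) := by
    filter_upwards [hGf, hf0'] with y hy h0
    exact (hdFat h0).tendsto.comp hy
  have lim1 (i : Fin N) : Tendsto (fun n => ∫ y in tsupport w,
      A i y * (F (G n y) * fderiv ℝ w y (stdVec i))) atTop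
      (𝓝 (∫ y in tsupport w, A i y * (F (f y) * fderiv ℝ w y (stdVec i)))) := by
    refine tendsto_integral_of_dominated_convergence
      (fun y => C * ‖A i y * fderiv ℝ w y (stdVec i)‖) (fun n => (hi1 n i).restrict.1)
      ((hAl i).norm.const_mul C).restrict (fun n => Eventually.of_forall fun y => ?_) ?_
    · rw [mul_left_comm, norm_mul]
      gcongr
      exact hFC _ (hG0 n y)
    · filter_upwards [hFf] with y hy using (hy.mul_const _).const_mul _
  obtain ⟨Cw, hCw⟩ := hwc.exists_bound_of_continuous hw.continuous
  have hAw (i : Fin N) : MemLp (fun y => A i y * w y) q (volume.restrict (tsupport w)) := by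
    simpa only [mul_comm] using
      (memLp_mul_of_tsupport_subset (hA i) hw.continuous hwc hwU).restrict (tsupport w)
  have lim2 (i : Fin N) := tendsto_integral_mul_mul (p := p) (q := q)
    (μ := volume.restrict (tsupport w))
    (B := fun y => A i y * w y) (H := fun n y => deriv F (G n y)) (h := fun y => deriv F (f y))
    (C := C) (D := fun n y => fderiv ℝ (G n) y (stdVec i)) (hAw i)
    (ha i _ hwc hwU) (fun n => (hdG n i).aestronglyMeasurable) (hGa i)
    (fun n => (hdFG n).aestronglyMeasurable)
    (fun n => Eventually.of_forall fun y => hdFC _ (hG0 n y)) hdFf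
  have hlim := tendsto_finsetSum Finset.univ fun i _ => (lim1 i).add (lim2 i)
  have hfin := ge_of_tendsto' hlim hpos
  refine hfin.trans_eq ?_
  -- F is controlled only on (-ε, ∞), so measurability of F(f) is read off from the continuous
  -- approximations.
  have hFfm : AEStronglyMeasurable (fun y => F (f y)) (volume.restrict (tsupport w)) :=
    aestronglyMeasurable_of_tendsto_ae atTop (fun n => (hFG n).continuous.aestronglyMeasurable) hFf
  have hdFfm : AEStronglyMeasurable (fun y => deriv F (f y)) (volume.restrict (tsupport w)) :=
    aestronglyMeasurable_of_tendsto_ae atTop (fun n => (hdFG n).aestronglyMeasurable) hdFf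
  have j1 (i : Fin N) : Integrable (fun y => A i y * (F (f y) * fderiv ℝ w y (stdVec i)))
      (volume.restrict (tsupport w)) := by
    refine ((hAl i).norm.const_mul C).restrict.mono'
      ((hA i _ hwc hwU).1.mul (hFfm.mul (hdw i).aestronglyMeasurable)) ?_
    filter_upwards [hf0'] with y hy
    rw [mul_left_comm, norm_mul]
    gcongr
    exact hFC _ hy
  have j2 (i : Fin N) : Integrable (fun y => A i y * w y * (deriv F (f y) * a i y))
      (volume.restrict (tsupport w)) := by
    have hBa : Integrable (fun y => (A i y * w y) * a i y) (volume.restrict (tsupport w)) :=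
      memLp_one_iff_integrable.1 ((ha i _ hwc hwU).mul' (hAw i))
    refine (hBa.norm.const_mul C).mono'
      ((hAw i).1.mul (hdFfm.mul (ha i _ hwc hwU).1)) ?_
    filter_upwards [hf0'] with y hy
    rw [mul_left_comm, norm_mul]
    gcongr
    exact hdFC _ hy
  rw [← setIntegral_tsupport_eq (k := w) fun y h0 hy => by
    simp only [h0, fderiv_stdVec_eq_zero hy]; simp]
  simp_rw [mul_add, ← mul_assoc (A _ _) (w _)]
  exact (integral_sum_add j1 j2).symm

end ChainRule

/-! ### Coordinates in a basis through its Gram matrix -/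

section GramCoordinates

variable {N : ℕ} {V : Type*} [NormedAddCommGroup V] [InnerProductSpace ℝ V]

/-- The coefficients of `v` in the family `b`, computed by the inverse of the Gram matrix. -/
def gramCoeff (b : Fin N → V) (v : V) (i : Fin N) : ℝ :=
  ∑ j, (Matrix.gram ℝ b)⁻¹ i j * inner ℝ v (b j)

lemma det_gram_pos {b : Fin N → V} (hb : LinearIndependent ℝ b) : 0 < (Matrix.gram ℝ b).det :=
  (Matrix.posDef_gram_of_linearIndependent hb).det_pos

/-- The inner products of v with the basis are the Gram matrix applied to the coordinates of v;
invert that matrix. -/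
lemma sum_gramCoeff_smul {b : Fin N → V} (hb : LinearIndependent ℝ b)
    (hspan : ⊤ ≤ Submodule.span ℝ (range b)) (v : V) : ∑ i, gramCoeff b v i • b i = v := by
  set B := Module.Basis.mk hb hspan
  have hB (i : Fin N) : B i = b i := Module.Basis.mk_apply hb hspan i
  have hG : IsUnit (Matrix.gram ℝ b).det := (det_gram_pos hb).ne'.isUnit
  have ha (j : Fin N) : inner ℝ v (b j) = (Matrix.gram ℝ b).mulVec (B.repr v) j := by
    conv_lhs => rw [← B.sum_repr v]
    simp only [sum_inner, inner_smul_left, Matrix.mulVec, dotProduct, Matrix.gram_apply, hB]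
    refine Finset.sum_congr rfl fun i _ => ?_
    rw [real_inner_comm, mul_comm]; rfl
  have hc (i : Fin N) : gramCoeff b v i = B.repr v i := by
    have : gramCoeff b v i =
        ((Matrix.gram ℝ b)⁻¹.mulVec ((Matrix.gram ℝ b).mulVec (B.repr v))) i := by
      simp only [gramCoeff, ha]; rfl
    rw [this, Matrix.mulVec_mulVec, Matrix.nonsing_inv_mul _ hG, Matrix.one_mulVec]
  conv_rhs => rw [← B.sum_repr v]
  simp only [hc, hB]

lemma inner_eq_sum_gramCoeff {b : Fin N → V} (hb : LinearIndependent ℝ b)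
    (hspan : ⊤ ≤ Submodule.span ℝ (range b)) (v w : V) :
    inner ℝ v w = ∑ i, gramCoeff b v i * inner ℝ w (b i) := by
  conv_lhs => rw [← sum_gramCoeff_smul hb hspan v]
  simp only [sum_inner, inner_smul_left]
  exact Finset.sum_congr rfl fun i _ => by rw [real_inner_comm]; rfl

/-- The constant depends on the Gram matrix alone; in a chart it is therefore a continuous function
of the point, bounded on compact sets. -/
lemma abs_gramCoeff_le (b : Fin N → V) (v : V) (i : Fin N) :
    |gramCoeff b v i| ≤
      (∑ j, |(Matrix.gram ℝ b)⁻¹ i j| * √((Matrix.gram ℝ b) j j)) * ‖v‖ := by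
  rw [gramCoeff, Finset.sum_mul]
  refine (Finset.abs_sum_le_sum_abs _ _).trans (Finset.sum_le_sum fun j _ => ?_)
  rw [abs_mul, mul_assoc]
  gcongr
  rw [Matrix.gram_apply, real_inner_self_eq_norm_sq, Real.sqrt_sq (norm_nonneg _), mul_comm]
  exact abs_real_inner_le_norm _ _

lemma abs_inner_le_sqrt_gram (b : Fin N → V) (v : V) (i : Fin N) :
    |inner ℝ v (b i)| ≤ √((Matrix.gram ℝ b) i i) * ‖v‖ := by
  rw [Matrix.gram_apply, real_inner_self_eq_norm_sq, Real.sqrt_sq (norm_nonneg _), mul_comm]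
  exact abs_real_inner_le_norm _ _

end GramCoordinates

/-! ### Coordinate frames and the metric matrix -/

section Charts

variable {N : ℕ} {M : Type*} [TopologicalSpace M] [ChartedSpace (EuclideanSpace ℝ (Fin N)) M]
  [IsManifold (𝓡 N) ∞ M]

local notation "𝔼" => EuclideanSpace ℝ (Fin N)

/-- The coordinate frame of the chart around `x₀`, at the point `z`. -/
def frame (x₀ z : M) (i : Fin N) : TangentSpace (𝓡 N) z :=
  (trivializationAt 𝔼 (TangentSpace (𝓡 N)) x₀).symmL ℝ z (stdVec i)

/-- This replaces the derivative of the inverse chart by the tangent bundle trivialization, for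
which continuity and the basis property are available. -/
lemma coordVec_eq_frame {x₀ : M} {y : 𝔼} (hy : y ∈ (chartAt 𝔼 x₀).target) (i : Fin N) :
    coordVec x₀ y i = frame x₀ ((chartAt 𝔼 x₀).symm y) i := by
  have h1 := TangentBundle.symmL_trivializationAt (I := 𝓡 N) ((chartAt 𝔼 x₀).map_target hy)
  rw [frame, h1]
  -- The base points agree only up to `right_inv`; the vectors are compared in the model space
  -- because the tangent space type depends on the point.
  have key : ∀ y', y' = y → (mfderiv (𝓡 N) (𝓡 N) (chartAt 𝔼 x₀).symm y (stdVec i) : 𝔼) =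
      (mfderivWithin (𝓡 N) (𝓡 N) (extChartAt (𝓡 N) x₀).symm (range (𝓡 N)) y' (stdVec i) : 𝔼) := by
    rintro y' rfl
    have : range (𝓡 N) = univ := by simp
    rw [this, mfderivWithin_univ]
    rfl
  exact key _ (by simp [(chartAt 𝔼 x₀).right_inv hy])

lemma exists_basis_frame {x₀ z : M} (hz : z ∈ (chartAt 𝔼 x₀).source) :
    ∃ b : Module.Basis (Fin N) ℝ (TangentSpace (𝓡 N) z), ⇑b = frame (N := N) x₀ z := by
  have hz' : z ∈ (trivializationAt 𝔼 (TangentSpace (𝓡 N)) x₀).baseSet := by simpa using hz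
  refine ⟨(trivializationAt 𝔼 (TangentSpace (𝓡 N)) x₀).basisAt
    (EuclideanSpace.basisFun (Fin N) ℝ).toBasis hz', ?_⟩
  ext1 i
  rw [frame, Bundle.Trivialization.symmL_apply _ hz']
  simp [Bundle.Trivialization.basisAt, stdVec]

lemma linearIndependent_frame {x₀ z : M} (hz : z ∈ (chartAt 𝔼 x₀).source) :
    LinearIndependent ℝ (frame (N := N) x₀ z) := by
  obtain ⟨b, hb⟩ := exists_basis_frame hz
  exact hb ▸ b.linearIndependent

lemma span_frame {x₀ z : M} (hz : z ∈ (chartAt 𝔼 x₀).source) :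
    ⊤ ≤ Submodule.span ℝ (range (frame (N := N) x₀ z)) := by
  obtain ⟨b, hb⟩ := exists_basis_frame hz
  exact hb ▸ b.span_eq.ge

lemma mfderiv_coordVec {x₀ : M} {y : 𝔼} (hy : y ∈ (chartAt 𝔼 x₀).target) {u : M → ℝ}
    (hu : MDifferentiableAt (𝓡 N) 𝓘(ℝ, ℝ) u ((chartAt 𝔼 x₀).symm y)) (i : Fin N) :
    (mfderiv (𝓡 N) 𝓘(ℝ, ℝ) u ((chartAt 𝔼 x₀).symm y) (coordVec x₀ y i) : ℝ) =
      fderiv ℝ (fun y => u ((chartAt 𝔼 x₀).symm y)) y (stdVec i) := by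
  have h1 : MDifferentiableAt (𝓡 N) (𝓡 N) (chartAt 𝔼 x₀).symm y :=
    mdifferentiableAt_atlas_symm (chart_mem_atlas _ _) hy
  have h2 := mfderiv_comp y hu h1
  have h3 : mfderiv (𝓡 N) 𝓘(ℝ, ℝ) (u ∘ (chartAt 𝔼 x₀).symm) y = fderiv ℝ _ y := mfderiv_eq_fderiv
  rw [h3] at h2
  have h4 := congrArg (fun L : 𝔼 →L[ℝ] ℝ => L (stdVec i)) h2
  exact h4.symm

variable [Bundle.RiemannianBundle (fun x : M => TangentSpace (𝓡 N) x)]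

omit [IsManifold (𝓡 N) ∞ M] in
lemma inner_grad (u : M → ℝ) (x : M) (v : TangentSpace (𝓡 N) x) :
    inner ℝ (grad N u x) v = (mfderiv (𝓡 N) 𝓘(ℝ, ℝ) u x v : ℝ) := by
  have : FiniteDimensional ℝ (TangentSpace (𝓡 N) x) :=
    inferInstanceAs (FiniteDimensional ℝ (EuclideanSpace ℝ (Fin N)))
  have : CompleteSpace (TangentSpace (𝓡 N) x) := FiniteDimensional.complete ℝ _
  exact InnerProductSpace.toDual_symm_apply

lemma inner_grad_coordVec {x₀ : M} {y : 𝔼} (hy : y ∈ (chartAt 𝔼 x₀).target) {u : M → ℝ}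
    (hu : MDifferentiableAt (𝓡 N) 𝓘(ℝ, ℝ) u ((chartAt 𝔼 x₀).symm y)) (i : Fin N) :
    inner ℝ (grad N u ((chartAt 𝔼 x₀).symm y)) (coordVec x₀ y i) =
      fderiv ℝ (fun y => u ((chartAt 𝔼 x₀).symm y)) y (stdVec i) := by
  rw [inner_grad, mfderiv_coordVec hy hu]

lemma metricMatrix_eq_gram {x₀ : M} {y : 𝔼} (hy : y ∈ (chartAt 𝔼 x₀).target) :
    metricMatrix x₀ y = Matrix.gram ℝ (frame x₀ ((chartAt 𝔼 x₀).symm y)) := by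
  ext i j
  simp [metricMatrix, coordVec_eq_frame hy, Matrix.gram_apply]

lemma metricMatrix_det_pos {x₀ : M} {y : 𝔼} (hy : y ∈ (chartAt 𝔼 x₀).target) :
    0 < (metricMatrix x₀ y).det := by
  rw [metricMatrix_eq_gram hy]
  exact det_gram_pos (linearIndependent_frame ((chartAt 𝔼 x₀).map_target hy))

variable [IsContMDiffRiemannianBundle (𝓡 N) ∞ (EuclideanSpace ℝ (Fin N))
      (fun x : M => TangentSpace (𝓡 N) x)]

instance isContinuousRiemannianBundle_tangent :
    IsContinuousRiemannianBundle 𝔼 (fun x : M => TangentSpace (𝓡 N) x) := by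
  obtain ⟨g, hg, h⟩ := ‹IsContMDiffRiemannianBundle (𝓡 N) ∞ (EuclideanSpace ℝ (Fin N))
      (fun x : M => TangentSpace (𝓡 N) x)›.exists_contMDiff
  exact ⟨g, hg.continuous, h⟩

omit [Bundle.RiemannianBundle (fun x : M => TangentSpace (𝓡 N) x)]
  [IsContMDiffRiemannianBundle (𝓡 N) ∞ (EuclideanSpace ℝ (Fin N))
      (fun x : M => TangentSpace (𝓡 N) x)] in
lemma continuousOn_frame (x₀ : M) (i : Fin N) :
    ContinuousOn (fun z => (⟨z, frame x₀ z i⟩ : Bundle.TotalSpace 𝔼 (TangentSpace (𝓡 N) : M → Type _)))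
      (chartAt 𝔼 x₀).source := by
  have h := (trivializationAt 𝔼 (TangentSpace (𝓡 N) : M → Type _) x₀).continuousOn_symm
  have h2 : ContinuousOn (fun z : M => (z, stdVec i)) (chartAt 𝔼 x₀).source :=
    (continuous_id.prodMk continuous_const).continuousOn
  refine (h.comp h2 fun z hz => ⟨by simpa using hz, mem_univ _⟩).congr fun z hz => ?_
  have hz' : z ∈ (trivializationAt 𝔼 (TangentSpace (𝓡 N)) x₀).baseSet := by simpa using hz
  simp only [frame, Function.comp]
  rw [Bundle.Trivialization.symmL_apply _ hz']

lemma continuousOn_inner_frame (x₀ : M) (i j : Fin N) :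
    ContinuousOn (fun z => inner ℝ (frame x₀ z i) (frame x₀ z j)) (chartAt 𝔼 x₀).source :=
  ContinuousOn.inner_bundle (F := 𝔼) (b := fun z => z) (continuousOn_frame x₀ i)
    (continuousOn_frame x₀ j)

lemma continuousOn_metricMatrix (x₀ : M) :
    ContinuousOn (metricMatrix x₀) (chartAt 𝔼 x₀).target := by
  refine continuousOn_pi.2 fun i => continuousOn_pi.2 fun j => ?_
  refine ((continuousOn_inner_frame x₀ i j).comp (chartAt 𝔼 x₀).continuousOn_symm
    fun y hy => (chartAt 𝔼 x₀).map_target hy).congr fun y hy => ?_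
  rw [metricMatrix_eq_gram hy]
  rfl

end Charts

/-! ### Change of frame and the Riemannian volume of a chart -/

lemma gram_eq_of_eq_sum {N : ℕ} {V : Type*} [NormedAddCommGroup V] [InnerProductSpace ℝ V]
    {f g : Fin N → V} {P : Matrix (Fin N) (Fin N) ℝ} (h : ∀ i, f i = ∑ j, P j i • g j) :
    Matrix.gram ℝ f = P.transpose * Matrix.gram ℝ g * P := by
  ext i j
  simp only [Matrix.gram_apply, h, sum_inner, inner_sum, inner_smul_left, inner_smul_right,
    Matrix.mul_apply, Matrix.transpose_apply, Finset.sum_mul]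
  refine Finset.sum_congr rfl fun k _ => ?_
  rw [Finset.mul_sum]
  refine Finset.sum_congr rfl fun l _ => ?_
  rw [real_inner_comm]
  simp
  ring

/-- The determinant of P enters squared, and the square root leaves its absolute value, which is the
Jacobian in the change of variables formula. -/
lemma sqrt_det_gram_eq_of_eq_sum {N : ℕ} {V : Type*} [NormedAddCommGroup V]
    [InnerProductSpace ℝ V] {f g : Fin N → V} {P : Matrix (Fin N) (Fin N) ℝ}
    (h : ∀ i, f i = ∑ j, P j i • g j) :
    √(Matrix.gram ℝ f).det = |P.det| * √(Matrix.gram ℝ g).det := by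
  rw [gram_eq_of_eq_sum h, Matrix.det_mul, Matrix.det_mul, Matrix.det_transpose,
    mul_right_comm, ← sq, Real.sqrt_mul (sq_nonneg _), Real.sqrt_sq_eq_abs]

section Volume

variable {N : ℕ} {M : Type*} [TopologicalSpace M] [ChartedSpace (EuclideanSpace ℝ (Fin N)) M]
  [IsManifold (𝓡 N) ∞ M]

local notation "𝔼" => EuclideanSpace ℝ (Fin N)

/-- By the cocycle property of the tangent bundle, the frame vector of one chart is seen in the
other through the derivative of the transition map. -/
lemma frame_eq_sum {x₀ x₁ z : M} (h₀ : z ∈ (chartAt 𝔼 x₀).source)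
    (h₁ : z ∈ (chartAt 𝔼 x₁).source) (i : Fin N) :
    frame x₀ z i = ∑ j, (LinearMap.toMatrix (EuclideanSpace.basisFun (Fin N) ℝ).toBasis
      (EuclideanSpace.basisFun (Fin N) ℝ).toBasis
      (tangentCoordChange (𝓡 N) x₀ x₁ z : 𝔼 →ₗ[ℝ] 𝔼)) j i • frame x₁ z j := by
  set b := (EuclideanSpace.basisFun (Fin N) ℝ).toBasis
  have hb (i : Fin N) : b i = stdVec i := by simp [b, stdVec]
  have e0 : frame x₀ z i = (trivializationAt 𝔼 (TangentSpace (𝓡 N)) x₁).symmL ℝ z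
      (tangentCoordChange (𝓡 N) x₀ x₁ z (stdVec i)) := by
    rw [frame, TangentBundle.symmL_trivializationAt_eq_core h₀,
      TangentBundle.symmL_trivializationAt_eq_core h₁]
    refine (tangentCoordChange_comp (I := 𝓡 N) ?_).symm
    simpa using ⟨h₀, h₁⟩
  rw [e0, ← b.sum_repr (tangentCoordChange (𝓡 N) x₀ x₁ z (stdVec i)), map_sum]
  refine Finset.sum_congr rfl fun j _ => ?_
  rw [map_smul, hb, LinearMap.toMatrix_apply, hb]
  rfl

variable [Bundle.RiemannianBundle (fun x : M => TangentSpace (𝓡 N) x)]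

lemma sqrt_det_metricMatrix_eq {x₀ x₁ z : M} (h₀ : z ∈ (chartAt 𝔼 x₀).source)
    (h₁ : z ∈ (chartAt 𝔼 x₁).source) :
    √(metricMatrix x₀ (chartAt 𝔼 x₀ z)).det = |(tangentCoordChange (𝓡 N) x₀ x₁ z).det| *
      √(metricMatrix x₁ (chartAt 𝔼 x₁ z)).det := by
  rw [metricMatrix_eq_gram ((chartAt 𝔼 x₀).map_source h₀),
    metricMatrix_eq_gram ((chartAt 𝔼 x₁).map_source h₁), (chartAt 𝔼 x₀).left_inv h₀,
    (chartAt 𝔼 x₁).left_inv h₁]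
  have h := sqrt_det_gram_eq_of_eq_sum (V := TangentSpace (𝓡 N) z) (f := frame x₀ z)
    (g := frame x₁ z) (P := LinearMap.toMatrix (EuclideanSpace.basisFun (Fin N) ℝ).toBasis
      (EuclideanSpace.basisFun (Fin N) ℝ).toBasis
      (tangentCoordChange (𝓡 N) x₀ x₁ z : 𝔼 →ₗ[ℝ] 𝔼)) (frame_eq_sum h₀ h₁)
  have e := LinearMap.det_toMatrix (EuclideanSpace.basisFun (Fin N) ℝ).toBasis
    (tangentCoordChange (𝓡 N) x₀ x₁ z : 𝔼 →ₗ[ℝ] 𝔼)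
  rw [e] at h
  exact h

variable [IsContMDiffRiemannianBundle (𝓡 N) ∞ (EuclideanSpace ℝ (Fin N))
      (fun x : M => TangentSpace (𝓡 N) x)]

lemma continuousOn_sqrt_det (x₀ : M) :
    ContinuousOn (fun y => √(metricMatrix x₀ y).det) (chartAt 𝔼 x₀).target :=
  (Continuous.matrix_det continuous_id).comp_continuousOn
    (continuousOn_metricMatrix x₀) |>.sqrt

lemma sqrt_det_pos {x₀ : M} {y : 𝔼} (hy : y ∈ (chartAt 𝔼 x₀).target) :
    0 < √(metricMatrix x₀ y).det :=
  Real.sqrt_pos.2 (metricMatrix_det_pos hy)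

/-- The Riemannian volume in the coordinates of the chart around `x₀`. -/
def coordVolume (x₀ : M) : Measure 𝔼 :=
  ((volume : Measure 𝔼).restrict (chartAt 𝔼 x₀).target).withDensity
        fun y => ENNReal.ofReal (Real.sqrt (metricMatrix x₀ y).det)

lemma measurableSet_target (x₀ : M) : MeasurableSet (chartAt 𝔼 x₀).target :=
  (chartAt 𝔼 x₀).open_target.measurableSet

lemma aemeasurable_density (x₀ : M) :
    AEMeasurable (fun y => ENNReal.ofReal (Real.sqrt (metricMatrix x₀ y).det))
      ((volume : Measure 𝔼).restrict (chartAt 𝔼 x₀).target) :=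
  ((continuousOn_sqrt_det x₀).aemeasurable (measurableSet_target x₀)).ennreal_ofReal

lemma coordVolume_absolutelyContinuous (x₀ : M) :
    coordVolume x₀ ≪ (volume : Measure 𝔼).restrict (chartAt 𝔼 x₀).target :=
  withDensity_absolutelyContinuous _ _

/-- The density is strictly positive, so statements holding almost everywhere for the Riemannian
volume and for Lebesgue measure in the chart are interchangeable. -/
lemma absolutelyContinuous_coordVolume (x₀ : M) :
    (volume : Measure 𝔼).restrict (chartAt 𝔼 x₀).target ≪ coordVolume x₀ := by
  refine withDensity_absolutelyContinuous' (aemeasurable_density x₀) ?_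
  filter_upwards [ae_restrict_mem (measurableSet_target x₀)] with y hy
  simpa using sqrt_det_pos hy

lemma ae_coordVolume_iff {x₀ : M} {P : 𝔼 → Prop} : (∀ᵐ y ∂(coordVolume x₀), P y) ↔
    ∀ᵐ y ∂((volume : Measure 𝔼).restrict (chartAt 𝔼 x₀).target), P y :=
  ⟨fun h => (absolutelyContinuous_coordVolume x₀).ae_le h,
    fun h => (coordVolume_absolutelyContinuous x₀).ae_le h⟩

lemma coordVolume_apply {x₀ : M} {s : Set 𝔼} (hs : MeasurableSet s)
    (hst : s ⊆ (chartAt 𝔼 x₀).target) :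
    coordVolume x₀ s = ∫⁻ y in s, ENNReal.ofReal (Real.sqrt (metricMatrix x₀ y).det) := by
  rw [coordVolume, withDensity_apply _ hs, Measure.restrict_restrict hs, inter_eq_left.2 hst]

variable [MeasurableSpace M] [BorelSpace M]

lemma aemeasurable_chart_symm (x₀ : M) : AEMeasurable (chartAt 𝔼 x₀).symm (coordVolume x₀) :=
  ((chartAt 𝔼 x₀).continuousOn_symm.aemeasurable (measurableSet_target x₀)).mono_ac
    (coordVolume_absolutelyContinuous x₀)

lemma chartVolume_eq_map (x₀ : M) :
    chartVolume N x₀ = (coordVolume x₀).map (chartAt 𝔼 x₀).symm := rfl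

lemma measurableSet_source (x₀ : M) : MeasurableSet (chartAt 𝔼 x₀).source :=
  (chartAt 𝔼 x₀).open_source.measurableSet

lemma ae_mem_target (x₀ : M) : ∀ᵐ y ∂(coordVolume x₀), y ∈ (chartAt 𝔼 x₀).target :=
  ae_coordVolume_iff.2 (ae_restrict_mem (measurableSet_target x₀))

lemma ae_mem_source (x₀ : M) : ∀ᵐ x ∂(chartVolume N x₀), x ∈ (chartAt 𝔼 x₀).source := by
  rw [chartVolume_eq_map]
  refine (ae_map_iff (aemeasurable_chart_symm x₀) (measurableSet_source x₀)).2 ?_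
  filter_upwards [ae_mem_target x₀] with y hy using (chartAt 𝔼 x₀).map_target hy

lemma chartVolume_restrict_source (x₀ : M) :
    (chartVolume N x₀).restrict (chartAt 𝔼 x₀).source = chartVolume N x₀ :=
  Measure.restrict_eq_self_of_ae_mem (ae_mem_source x₀)

lemma aemeasurable_chart (x₀ : M) : AEMeasurable (chartAt 𝔼 x₀) (chartVolume N x₀) := by
  rw [← chartVolume_restrict_source]
  exact (chartAt 𝔼 x₀).continuousOn.aemeasurable (measurableSet_source x₀)

lemma map_chart_chartVolume (x₀ : M) :
    (chartVolume N x₀).map (chartAt 𝔼 x₀) = coordVolume x₀ := by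
  have h := aemeasurable_chart x₀ (N := N)
  rw [chartVolume_eq_map] at h ⊢
  rw [AEMeasurable.map_map_of_aemeasurable h (aemeasurable_chart_symm x₀)]
  conv_rhs => rw [← Measure.map_id (μ := coordVolume x₀)]
  refine Measure.map_congr ?_
  filter_upwards [ae_mem_target x₀] with y hy using (chartAt 𝔼 x₀).right_inv hy

lemma ae_chartVolume_iff {x₀ : M} {P : M → Prop} : (∀ᵐ x ∂(chartVolume N x₀), P x) ↔
    ∀ᵐ y ∂((volume : Measure 𝔼).restrict (chartAt 𝔼 x₀).target), P ((chartAt 𝔼 x₀).symm y) := by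
  rw [← ae_coordVolume_iff]
  refine ⟨fun h => ae_of_ae_map (aemeasurable_chart_symm x₀) h, fun h => ?_⟩
  rw [← map_chart_chartVolume] at h
  filter_upwards [ae_of_ae_map (aemeasurable_chart x₀) h, ae_mem_source x₀] with x hx hxs
  rwa [(chartAt 𝔼 x₀).left_inv hxs] at hx

lemma aestronglyMeasurable_chartVolume_iff {x₀ : M} {f : M → ℝ} :
    AEStronglyMeasurable f (chartVolume N x₀) ↔
      AEStronglyMeasurable (fun y => f ((chartAt 𝔼 x₀).symm y))
        ((volume : Measure 𝔼).restrict (chartAt 𝔼 x₀).target) := by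
  constructor
  · intro h
    rw [chartVolume_eq_map] at h
    exact (h.comp_aemeasurable (aemeasurable_chart_symm x₀)).mono_ac
      (absolutelyContinuous_coordVolume x₀)
  · intro h
    have h2 := h.mono_ac (coordVolume_absolutelyContinuous x₀)
    rw [← map_chart_chartVolume] at h2
    refine (h2.comp_aemeasurable (aemeasurable_chart x₀)).congr ?_
    filter_upwards [ae_mem_source x₀] with x hx
    simp [(chartAt 𝔼 x₀).left_inv hx]

lemma integral_chartVolume (x₀ : M) (f : M → ℝ) : ∫ x, f x ∂(chartVolume N x₀) =
    ∫ y in (chartAt 𝔼 x₀).target, √(metricMatrix x₀ y).det * f ((chartAt 𝔼 x₀).symm y) := by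
  have h1 : ∫ x, f x ∂(chartVolume N x₀) =
      ∫ y, f ((chartAt 𝔼 x₀).symm y) ∂(coordVolume x₀) := by
    by_cases hf : AEStronglyMeasurable f (chartVolume N x₀)
    · rw [chartVolume_eq_map] at hf ⊢
      exact integral_map (aemeasurable_chart_symm x₀) hf
    -- Without measurability of f neither side is integrable, and both integrals are 0 by
    -- convention.
    · rw [integral_undef fun h => hf h.1, integral_undef fun h => hf ?_]
      exact aestronglyMeasurable_chartVolume_iff.2
        (h.1.mono_ac (absolutelyContinuous_coordVolume x₀))
  rw [h1, coordVolume, integral_withDensity_eq_integral_toReal_smul₀ (aemeasurable_density x₀)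
    (Eventually.of_forall fun _ => ENNReal.ofReal_lt_top)]
  simp [ENNReal.toReal_ofReal, Real.sqrt_nonneg]

lemma measurableSet_target_inter_preimage (x₀ : M) {B : Set M} (hB : MeasurableSet B) :
    MeasurableSet ((chartAt 𝔼 x₀).target ∩ (chartAt 𝔼 x₀).symm ⁻¹' B) := by
  have := ((chartAt 𝔼 x₀).continuousOn_symm.domRestrict).measurable hB
  have := (MeasurableEmbedding.subtype_coe (measurableSet_target x₀)).measurableSet_image.2 this
  convert this using 1
  ext y
  simp [and_comm]

lemma chartVolume_apply {x₀ : M} {B : Set M} (hB : MeasurableSet B)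
    (hBs : B ⊆ (chartAt 𝔼 x₀).source) :
    chartVolume N x₀ B =
      ∫⁻ y in (chartAt 𝔼 x₀) '' B, ENNReal.ofReal (Real.sqrt (metricMatrix x₀ y).det) := by
  have hi : (chartAt 𝔼 x₀) '' B = (chartAt 𝔼 x₀).target ∩ (chartAt 𝔼 x₀).symm ⁻¹' B :=
    (chartAt 𝔼 x₀).image_eq_target_inter_inv_preimage hBs
  have hm : MeasurableSet ((chartAt 𝔼 x₀).target ∩ (chartAt 𝔼 x₀).symm ⁻¹' B) :=
    measurableSet_target_inter_preimage x₀ hB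
  rw [chartVolume_eq_map, Measure.map_apply_of_aemeasurable (aemeasurable_chart_symm x₀) hB, hi,
    ← coordVolume_apply hm inter_subset_left]
  refine measure_congr ?_
  filter_upwards [ae_mem_target x₀] with y hy
  exact propext ⟨fun h => ⟨hy, h⟩, fun h => h.2⟩

/-- The transition map has derivative `tangentCoordChange`, and its Jacobian is exactly the factor
by which √det g changes between the charts. -/
lemma chartVolume_overlap {x₀ x₁ : M} {B : Set M} (hB : MeasurableSet B)
    (h₀ : B ⊆ (chartAt 𝔼 x₀).source) (h₁ : B ⊆ (chartAt 𝔼 x₁).source) :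
    chartVolume N x₁ B = chartVolume N x₀ B := by
  have hm : MeasurableSet ((chartAt 𝔼 x₀) '' B) := by
    rw [(chartAt 𝔼 x₀).image_eq_target_inter_inv_preimage h₀]
    exact measurableSet_target_inter_preimage x₀ hB
  rw [chartVolume_apply hB h₀, chartVolume_apply hB h₁]
  have him : (chartAt 𝔼 x₁) '' B =
      (chartAt 𝔼 x₁ ∘ (chartAt 𝔼 x₀).symm) '' ((chartAt 𝔼 x₀) '' B) := by
    rw [image_image]
    refine image_congr fun z hz => ?_
    simp [(chartAt 𝔼 x₀).left_inv (h₀ hz)]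
  rw [him, lintegral_image_eq_lintegral_abs_det_fderiv_mul volume hm
    (f' := fun y => tangentCoordChange (𝓡 N) x₀ x₁ ((chartAt 𝔼 x₀).symm y))]
  · refine setLIntegral_congr_fun hm ?_
    rintro _ ⟨z, hz, rfl⟩
    simp only [Function.comp, (chartAt 𝔼 x₀).left_inv (h₀ hz)]
    rw [sqrt_det_metricMatrix_eq (h₀ hz) (h₁ hz), ENNReal.ofReal_mul (abs_nonneg _)]
  · rintro _ ⟨z, hz, rfl⟩
    have := hasFDerivWithinAt_tangentCoordChange (I := 𝓡 N) (x := x₀) (y := x₁) (z := z)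
      (by simpa using ⟨h₀ hz, h₁ hz⟩)
    rw [(chartAt 𝔼 x₀).left_inv (h₀ hz)]
    exact this.mono (by simp)
  · rintro _ ⟨z, hz, rfl⟩ _ ⟨z', hz', rfl⟩ h
    simp only [Function.comp, (chartAt 𝔼 x₀).left_inv (h₀ hz),
      (chartAt 𝔼 x₀).left_inv (h₀ hz')] at h
    rw [(chartAt 𝔼 x₁).injOn (h₁ hz) (h₁ hz') h]

/-- The Riemannian volume of a chart domain. -/
lemma riemannianVolume_restrict_source (x₀ : M) :
    (riemannianVolume N M).restrict (chartAt 𝔼 x₀).source = chartVolume N x₀ := by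
  set S := (chartAt 𝔼 x₀).source
  have hS : MeasurableSet S := measurableSet_source x₀
  have hle (x₁ : M) : (chartVolume N x₁).restrict S ≤ chartVolume N x₀ := by
    refine Measure.le_iff.2 fun B hB => ?_
    rw [Measure.restrict_apply hB]
    have e : chartVolume N x₁ (B ∩ S) = chartVolume N x₁ (B ∩ S ∩ (chartAt 𝔼 x₁).source) := by
      refine measure_congr ?_
      filter_upwards [ae_mem_source x₁] with x hx
      exact propext ⟨fun h => ⟨h, hx⟩, fun h => h.1⟩
    rw [e, chartVolume_overlap ((hB.inter hS).inter (measurableSet_source x₁))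
      (fun x hx => hx.1.2) inter_subset_right]
    exact measure_mono fun x hx => hx.1.1
  refine le_antisymm ?_ ?_
  -- To avoid commuting restriction with the supremum, each chart volume is split along S; the bound
  -- is then restricted to S, where the complementary part vanishes.
  · have h : riemannianVolume N M ≤ chartVolume N x₀ + (riemannianVolume N M).restrict Sᶜ := by
      refine iSup_le fun x₁ => ?_
      rw [← Measure.restrict_add_restrict_compl (μ := chartVolume N x₁) hS]
      exact add_le_add (hle x₁) (Measure.restrict_mono_measure
        (le_iSup (fun x : M => chartVolume N x) x₁) _)
    refine (Measure.restrict_mono_measure h S).trans ?_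
    rw [Measure.restrict_add, Measure.restrict_restrict hS]
    simp [Measure.restrict_le_self]
  · rw [← chartVolume_restrict_source x₀]
    exact Measure.restrict_mono_measure (le_iSup (fun x : M => chartVolume N x) x₀) _

end Volume

/-! ### Transfer of measurability and integrability between manifold and charts -/

section Transfer

variable {N : ℕ} {M : Type*} [TopologicalSpace M] [ChartedSpace (EuclideanSpace ℝ (Fin N)) M]

local notation "𝔼" => EuclideanSpace ℝ (Fin N)

lemma isOpen_chartDomain {Ω : Set M} (hΩ : IsOpen Ω) (x₀ : M) :
    IsOpen (chartDomain (N := N) Ω x₀) :=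
  (chartAt 𝔼 x₀).isOpen_inter_preimage_symm hΩ

lemma image_symm_subset_source {x₀ : M} {K : Set 𝔼} (hK : K ⊆ (chartAt 𝔼 x₀).target) :
    (chartAt 𝔼 x₀).symm '' K ⊆ (chartAt 𝔼 x₀).source := by
  rintro _ ⟨y, hy, rfl⟩
  exact (chartAt 𝔼 x₀).map_target (hK hy)

lemma isCompact_image_symm {x₀ : M} {K : Set 𝔼} (hK : IsCompact K)
    (hKt : K ⊆ (chartAt 𝔼 x₀).target) : IsCompact ((chartAt 𝔼 x₀).symm '' K) :=
  hK.image_of_continuousOn ((chartAt 𝔼 x₀).continuousOn_symm.mono hKt)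

lemma isCompact_image_chart {x₀ : M} {K : Set M} (hK : IsCompact K)
    (hKs : K ⊆ (chartAt 𝔼 x₀).source) : IsCompact ((chartAt 𝔼 x₀) '' K) :=
  hK.image_of_continuousOn ((chartAt 𝔼 x₀).continuousOn.mono hKs)

variable [IsManifold (𝓡 N) ∞ M]
  [Bundle.RiemannianBundle (fun x : M => TangentSpace (𝓡 N) x)]

lemma coordVec_linearIndependent {x₀ : M} {y : 𝔼} (hy : y ∈ (chartAt 𝔼 x₀).target) :
    LinearIndependent ℝ (coordVec (N := N) x₀ y) := by
  have : coordVec (N := N) x₀ y = frame x₀ ((chartAt 𝔼 x₀).symm y) :=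
    funext fun i => coordVec_eq_frame hy i
  rw [this]
  exact linearIndependent_frame ((chartAt 𝔼 x₀).map_target hy)

lemma coordVec_span {x₀ : M} {y : 𝔼} (hy : y ∈ (chartAt 𝔼 x₀).target) :
    ⊤ ≤ Submodule.span ℝ (range (coordVec (N := N) x₀ y)) := by
  have : coordVec (N := N) x₀ y = frame x₀ ((chartAt 𝔼 x₀).symm y) :=
    funext fun i => coordVec_eq_frame hy i
  rw [this]
  exact span_frame ((chartAt 𝔼 x₀).map_target hy)

/-- The covariant components of a vector field in the chart around `x₀`. -/
def lowerCoeff (x₀ : M) (G : (x : M) → TangentSpace (𝓡 N) x) (i : Fin N) (y : 𝔼) : ℝ :=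
  inner ℝ (G ((chartAt 𝔼 x₀).symm y)) (coordVec x₀ y i)

/-- The contravariant components of a vector field in the chart around `x₀`. -/
def upperCoeff (x₀ : M) (G : (x : M) → TangentSpace (𝓡 N) x) (i : Fin N) (y : 𝔼) : ℝ :=
  ∑ j, (metricMatrix x₀ y)⁻¹ i j * lowerCoeff x₀ G j y

lemma inner_eq_sum_upperCoeff {x₀ : M} {y : 𝔼} (hy : y ∈ (chartAt 𝔼 x₀).target)
    (G H : (x : M) → TangentSpace (𝓡 N) x) :
    inner ℝ (G ((chartAt 𝔼 x₀).symm y)) (H ((chartAt 𝔼 x₀).symm y)) =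
      ∑ i, upperCoeff x₀ G i y * lowerCoeff x₀ H i y :=
  inner_eq_sum_gramCoeff (V := TangentSpace (𝓡 N) ((chartAt 𝔼 x₀).symm y))
    (b := coordVec x₀ y) (coordVec_linearIndependent hy) (coordVec_span hy) _ _

lemma abs_upperCoeff_le (x₀ : M) (y : 𝔼) (G : (x : M) → TangentSpace (𝓡 N) x) (i : Fin N) :
    |upperCoeff x₀ G i y| ≤ (∑ j, |(metricMatrix x₀ y)⁻¹ i j| * √(metricMatrix x₀ y j j)) *
      ‖G ((chartAt 𝔼 x₀).symm y)‖ :=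
  abs_gramCoeff_le (V := TangentSpace (𝓡 N) ((chartAt 𝔼 x₀).symm y)) (coordVec x₀ y) _ i

lemma abs_lowerCoeff_le (x₀ : M) (y : 𝔼) (G : (x : M) → TangentSpace (𝓡 N) x) (i : Fin N) :
    |lowerCoeff x₀ G i y| ≤ √(metricMatrix x₀ y i i) * ‖G ((chartAt 𝔼 x₀).symm y)‖ :=
  abs_inner_le_sqrt_gram (V := TangentSpace (𝓡 N) ((chartAt 𝔼 x₀).symm y)) (coordVec x₀ y) _ i

lemma lowerCoeff_grad {x₀ : M} {y : 𝔼} (hy : y ∈ (chartAt 𝔼 x₀).target) {u : M → ℝ}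
    (hu : MDifferentiableAt (𝓡 N) 𝓘(ℝ, ℝ) u ((chartAt 𝔼 x₀).symm y)) (i : Fin N) :
    lowerCoeff x₀ (grad N u) i y = fderiv ℝ (fun y => u ((chartAt 𝔼 x₀).symm y)) y (stdVec i) :=
  inner_grad_coordVec hy hu i

lemma HasWeakGradient.hasWeakPartials {Ω : Set M} {f : M → ℝ}
    {G : (x : M) → TangentSpace (𝓡 N) x} (h : HasWeakGradient Ω f G) (x₀ : M) :
    HasWeakPartials (chartDomain Ω x₀) (fun y => f ((chartAt 𝔼 x₀).symm y))
      (lowerCoeff x₀ G) where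
  locallyIntegrableOn := h.locallyIntegrableOn x₀
  locallyIntegrableOn_partial := h.locallyIntegrableOn_inner x₀
  integral_eq := h.integral_eq x₀

variable [IsContMDiffRiemannianBundle (𝓡 N) ∞ (EuclideanSpace ℝ (Fin N))
      (fun x : M => TangentSpace (𝓡 N) x)]

lemma continuousOn_metricMatrix_apply (x₀ : M) (i j : Fin N) :
    ContinuousOn (fun y => metricMatrix x₀ y i j) (chartAt 𝔼 x₀).target :=
  continuousOn_pi.1 (continuousOn_pi.1 (continuousOn_metricMatrix x₀) i) j

lemma continuousOn_inv_metricMatrix_apply (x₀ : M) (i j : Fin N) :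
    ContinuousOn (fun y => (metricMatrix x₀ y)⁻¹ i j) (chartAt 𝔼 x₀).target := by
  have h : ContinuousOn (fun y => (metricMatrix x₀ y)⁻¹) (chartAt 𝔼 x₀).target := by
    simp only [Matrix.inv_def, Ring.inverse_eq_inv']
    have hc := continuousOn_metricMatrix (N := N) x₀
    refine ContinuousOn.smul (ContinuousOn.inv₀ ?_ fun y hy => (metricMatrix_det_pos hy).ne') ?_
    · exact (Continuous.matrix_det continuous_id).comp_continuousOn hc
    · exact (Continuous.matrix_adjugate continuous_id).comp_continuousOn hc
  exact continuousOn_pi.1 (continuousOn_pi.1 h i) j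

section AEStronglyMeasurable

lemma HasWeakGradient.aestronglyMeasurable_lowerCoeff {Ω : Set M} {f : M → ℝ}
    {G : (x : M) → TangentSpace (𝓡 N) x} (h : HasWeakGradient Ω f G)
    (x₀ : M) (i : Fin N) : AEStronglyMeasurable (lowerCoeff x₀ G i)
      (volume.restrict (chartDomain Ω x₀)) :=
  (h.locallyIntegrableOn_inner x₀ i).aestronglyMeasurable

lemma HasWeakGradient.aestronglyMeasurable_upperCoeff {Ω : Set M} (hΩ : IsOpen Ω) {f : M → ℝ}
    {G : (x : M) → TangentSpace (𝓡 N) x} (h : HasWeakGradient Ω f G)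
    (x₀ : M) (i : Fin N) : AEStronglyMeasurable (upperCoeff x₀ G i)
      (volume.restrict (chartDomain Ω x₀)) := by
  refine Finset.aestronglyMeasurable_fun_sum _ fun j _ => ?_
  refine AEStronglyMeasurable.mul ?_ (h.aestronglyMeasurable_lowerCoeff x₀ j)
  exact ((continuousOn_inv_metricMatrix_apply x₀ i j).mono
    inter_subset_left).aestronglyMeasurable (isOpen_chartDomain hΩ x₀).measurableSet

lemma continuousOn_lowerCoeff_grad {u : M → ℝ} (hu : ContMDiff (𝓡 N) 𝓘(ℝ, ℝ) 1 u) (x₀ : M)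
    (i : Fin N) : ContinuousOn (lowerCoeff x₀ (grad N u) i) (chartAt 𝔼 x₀).target := by
  have h1 : ContMDiffOn (𝓡 N) 𝓘(ℝ, ℝ) 1 (u ∘ (chartAt 𝔼 x₀).symm) (chartAt 𝔼 x₀).target :=
    hu.comp_contMDiffOn ((contMDiffOn_chart_symm (n := ∞)).of_le (by simp))
  have h2 : ContDiffOn ℝ 1 (u ∘ (chartAt 𝔼 x₀).symm) (chartAt 𝔼 x₀).target :=
    contMDiffOn_iff_contDiffOn.1 h1
  have h3 := h2.continuousOn_fderiv_of_isOpen (chartAt 𝔼 x₀).open_target le_rfl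
  refine (h3.clm_apply (continuousOn_const (c := stdVec i))).congr fun y hy => ?_
  exact lowerCoeff_grad hy (hu.mdifferentiable one_ne_zero _) i

/-- The norm of the gradient of a `C¹` function is continuous. -/
lemma continuous_norm_grad {u : M → ℝ} (hu : ContMDiff (𝓡 N) 𝓘(ℝ, ℝ) 1 u) :
    Continuous fun x => ‖grad N u x‖ := by
  refine continuous_iff_continuousAt.2 fun x₀ => ?_
  have h : ContinuousOn (fun y => √(∑ i, upperCoeff x₀ (grad N u) i y *
      lowerCoeff x₀ (grad N u) i y)) (chartAt 𝔼 x₀).target := by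
    refine (continuousOn_finsetSum _ fun i _ => ContinuousOn.mul ?_
      (continuousOn_lowerCoeff_grad hu x₀ i)).sqrt
    exact continuousOn_finsetSum _ fun j _ => (continuousOn_inv_metricMatrix_apply x₀ i j).mul
      (continuousOn_lowerCoeff_grad hu x₀ j)
  have h2 : ContinuousOn (fun x => ‖grad N u x‖) (chartAt 𝔼 x₀).source := by
    refine (h.comp (chartAt 𝔼 x₀).continuousOn fun x hx => (chartAt 𝔼 x₀).map_source hx).congr
      fun x hx => ?_
    simp only [Function.comp]
    rw [← inner_eq_sum_upperCoeff ((chartAt 𝔼 x₀).map_source hx), (chartAt 𝔼 x₀).left_inv hx,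
      real_inner_self_eq_norm_sq, Real.sqrt_sq (norm_nonneg _)]
  exact h2.continuousAt (chart_source_mem_nhds 𝔼 x₀)

lemma grad_eq_zero_of_notMem_tsupport {u : M → ℝ} {x : M} (hx : x ∉ tsupport u) :
    grad N u x = 0 := by
  have h : u =ᶠ[𝓝 x] fun _ => 0 := notMem_tsupport_iff_eventuallyEq.1 hx
  have h2 : mfderiv (𝓡 N) 𝓘(ℝ, ℝ) u x = 0 := by
    rw [h.mfderiv_eq, mfderiv_const]; rfl
  have h3 : inner ℝ (grad N u x) (grad N u x) = 0 := by
    rw [inner_grad, h2]; rfl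
  exact inner_self_eq_zero.1 h3

variable [MeasurableSpace M] [BorelSpace M]

lemma ae_restrict_chartDomain {Ω : Set M} (hΩ : IsOpen Ω) {P : M → Prop}
    (h : ∀ᵐ x ∂((riemannianVolume N M).restrict Ω), P x) (x₀ : M) :
    ∀ᵐ y ∂(volume.restrict (chartDomain (N := N) Ω x₀)), P ((chartAt 𝔼 x₀).symm y) := by
  rw [ae_restrict_iff' hΩ.measurableSet] at h
  have h2 := ae_chartVolume_iff.1 (riemannianVolume_restrict_source (N := N) x₀ ▸ ae_restrict_of_ae h)
  rw [ae_restrict_iff' (measurableSet_target x₀)] at h2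
  rw [ae_restrict_iff' (isOpen_chartDomain hΩ x₀).measurableSet]
  filter_upwards [h2] with y hy hyd using hy hyd.1 hyd.2

variable [SecondCountableTopology M]

variable (N M) in
lemma exists_countable_chart_cover :
    ∃ s : Set M, s.Countable ∧ ⋃ x ∈ s, (chartAt 𝔼 x).source = univ :=
  TopologicalSpace.countable_cover_nhds fun x => chart_source_mem_nhds 𝔼 x

/-- Second countability leaves countably many charts, and a countable union of null sets is null. -/
lemma ae_of_forall_chartDomain {Ω : Set M} (hΩ : IsOpen Ω) {P : M → Prop}
    (h : ∀ x₀ : M, ∀ᵐ y ∂(volume.restrict (chartDomain (N := N) Ω x₀)),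
      P ((chartAt 𝔼 x₀).symm y)) :
    ∀ᵐ x ∂((riemannianVolume N M).restrict Ω), P x := by
  rw [ae_restrict_iff' hΩ.measurableSet]
  obtain ⟨s, hs, hsu⟩ := exists_countable_chart_cover N M
  have key : ∀ᵐ x ∂((riemannianVolume N M).restrict (⋃ x ∈ s, (chartAt 𝔼 x).source)),
      x ∈ Ω → P x := by
    rw [ae_restrict_biUnion_iff _ hs]
    intro x₀ _
    rw [riemannianVolume_restrict_source, ae_chartVolume_iff,
      ae_restrict_iff' (measurableSet_target x₀)]
    have := h x₀
    rw [ae_restrict_iff' (isOpen_chartDomain hΩ x₀).measurableSet] at this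
    filter_upwards [this] with y hy hyt hyΩ using hy ⟨hyt, hyΩ⟩
  rwa [hsu, Measure.restrict_univ] at key

lemma aestronglyMeasurable_of_forall_chartDomain {Ω : Set M} (hΩ : IsOpen Ω) {f : M → ℝ}
    (h : ∀ x₀ : M, AEStronglyMeasurable (fun y => f ((chartAt 𝔼 x₀).symm y))
      (volume.restrict (chartDomain (N := N) Ω x₀))) :
    AEStronglyMeasurable f ((riemannianVolume N M).restrict Ω) := by
  rw [← aestronglyMeasurable_indicator_iff hΩ.measurableSet]
  obtain ⟨s, hs, hsu⟩ := exists_countable_chart_cover N M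
  have : Countable s := hs
  have key : AEStronglyMeasurable (Ω.indicator f)
      ((riemannianVolume N M).restrict (⋃ x : s, (chartAt 𝔼 (x : M)).source)) := by
    rw [aestronglyMeasurable_iUnion_iff]
    intro x₀
    rw [riemannianVolume_restrict_source, aestronglyMeasurable_chartVolume_iff]
    have h1 := (aestronglyMeasurable_indicator_iff
      (isOpen_chartDomain hΩ (x₀ : M)).measurableSet).2 (h x₀)
    refine h1.restrict.congr ?_
    filter_upwards [ae_restrict_mem (measurableSet_target (x₀ : M))] with y hy
    by_cases hyΩ : (chartAt 𝔼 (x₀ : M)).symm y ∈ Ω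
    · rw [indicator_of_mem (show y ∈ chartDomain Ω (x₀ : M) from ⟨hy, hyΩ⟩), indicator_of_mem hyΩ]
    · rw [indicator_of_notMem (fun h => hyΩ h.2), indicator_of_notMem hyΩ]
  rwa [← biUnion_eq_iUnion s (fun x _ => (chartAt 𝔼 x).source), hsu, Measure.restrict_univ] at key

lemma HasWeakGradient.aestronglyMeasurable {Ω : Set M} (hΩ : IsOpen Ω) {f : M → ℝ}
    {G : (x : M) → TangentSpace (𝓡 N) x} (h : HasWeakGradient Ω f G) :
    AEStronglyMeasurable f ((riemannianVolume N M).restrict Ω) :=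
  aestronglyMeasurable_of_forall_chartDomain hΩ fun x₀ =>
    (h.locallyIntegrableOn x₀).aestronglyMeasurable

/-- A weak gradient is not assumed measurable as a section. Measurability comes from its locally
integrable covariant components and the continuous inverse metric. -/
lemma HasWeakGradient.aestronglyMeasurable_inner_grad {Ω : Set M} (hΩ : IsOpen Ω) {f : M → ℝ}
    {G : (x : M) → TangentSpace (𝓡 N) x} (h : HasWeakGradient Ω f G) {u : M → ℝ}
    (hu : ContMDiff (𝓡 N) 𝓘(ℝ, ℝ) 1 u) :
    AEStronglyMeasurable (fun x => inner ℝ (G x) (grad N u x))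
      ((riemannianVolume N M).restrict Ω) := by
  refine aestronglyMeasurable_of_forall_chartDomain hΩ fun x₀ => ?_
  have hm := (isOpen_chartDomain (N := N) hΩ x₀).measurableSet
  have h1 : AEStronglyMeasurable (fun y => ∑ i, upperCoeff x₀ G i y *
      lowerCoeff x₀ (grad N u) i y) (volume.restrict (chartDomain Ω x₀)) :=
    Finset.aestronglyMeasurable_fun_sum _ fun i _ => (h.aestronglyMeasurable_upperCoeff hΩ x₀ i).mul
      (((continuousOn_lowerCoeff_grad hu x₀ i).mono inter_subset_left).aestronglyMeasurable hm)
  refine h1.congr ?_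
  filter_upwards [ae_restrict_mem hm] with y hy
  exact (inner_eq_sum_upperCoeff hy.1 _ _).symm

lemma HasWeakGradient.aestronglyMeasurable_norm {Ω : Set M} (hΩ : IsOpen Ω) {f : M → ℝ}
    {G : (x : M) → TangentSpace (𝓡 N) x} (h : HasWeakGradient Ω f G) :
    AEStronglyMeasurable (fun x => ‖G x‖) ((riemannianVolume N M).restrict Ω) := by
  refine aestronglyMeasurable_of_forall_chartDomain hΩ fun x₀ => ?_
  have hm := (isOpen_chartDomain (N := N) hΩ x₀).measurableSet
  have h1 : AEStronglyMeasurable (fun y => ∑ i, upperCoeff x₀ G i y *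
      lowerCoeff x₀ G i y) (volume.restrict (chartDomain Ω x₀)) :=
    Finset.aestronglyMeasurable_fun_sum _ fun i _ => (h.aestronglyMeasurable_upperCoeff hΩ x₀ i).mul
      (h.aestronglyMeasurable_lowerCoeff x₀ i)
  refine (Real.continuous_sqrt.comp_aestronglyMeasurable h1).congr ?_
  filter_upwards [ae_restrict_mem hm] with y hy
  rw [← inner_eq_sum_upperCoeff hy.1, real_inner_self_eq_norm_sq, Real.sqrt_sq (norm_nonneg _)]

end AEStronglyMeasurable

section Compact

variable [MeasurableSpace M] [BorelSpace M]

lemma coordVolume_lt_top {x₀ : M} {K : Set 𝔼} (hK : IsCompact K)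
    (hKt : K ⊆ (chartAt 𝔼 x₀).target) : coordVolume x₀ K < ⊤ := by
  rw [coordVolume_apply hK.measurableSet hKt]
  have hi : IntegrableOn (fun y => √(metricMatrix x₀ y).det) K volume :=
    ((continuousOn_sqrt_det x₀).mono hKt).integrableOn_compact hK
  exact (lintegral_mono fun y => Real.ofReal_le_enorm _).trans_lt hi.2

/-- The density is bounded on compact subsets of a chart. Finiteness on compact sets is what makes
continuous compactly supported functions integrable later. -/
instance isLocallyFiniteMeasure_riemannianVolume :
    IsLocallyFiniteMeasure (riemannianVolume N M) := by
  refine ⟨fun x₀ => ?_⟩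
  obtain ⟨K, hK, hKt, hKc⟩ := local_compact_nhds
    ((chartAt 𝔼 x₀).open_target.mem_nhds (mem_chart_target 𝔼 x₀))
  have hO : IsOpen ((chartAt 𝔼 x₀).source ∩ (chartAt 𝔼 x₀) ⁻¹' (interior K)) :=
    (chartAt 𝔼 x₀).isOpen_inter_preimage isOpen_interior
  refine ⟨_, hO.mem_nhds ⟨mem_chart_source 𝔼 x₀, mem_interior_iff_mem_nhds.2 hK⟩, ?_⟩
  rw [← inter_eq_left.2 (inter_subset_left (s := (chartAt 𝔼 x₀).source)
    (t := (chartAt 𝔼 x₀) ⁻¹' (interior K))), ← Measure.restrict_apply hO.measurableSet,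
    riemannianVolume_restrict_source, chartVolume_eq_map,
    Measure.map_apply_of_aemeasurable (aemeasurable_chart_symm x₀) hO.measurableSet]
  refine (measure_mono_ae ?_).trans_lt (coordVolume_lt_top hKc hKt)
  filter_upwards [ae_mem_target x₀] with y hy hyO
  have := hyO.2
  rw [mem_preimage, (chartAt 𝔼 x₀).right_inv hy] at this
  exact interior_subset this

/-- The continuous positive density attains a positive minimum on K; the constant is its inverse. -/
lemma exists_restrict_le_smul_coordVolume {x₀ : M} {K : Set 𝔼} (hK : IsCompact K)
    (hKt : K ⊆ (chartAt 𝔼 x₀).target) :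
    ∃ c : ℝ≥0∞, c ≠ ⊤ ∧ (volume : Measure 𝔼).restrict K ≤ c • (coordVolume x₀).restrict K := by
  rcases K.eq_empty_or_nonempty with rfl | hne
  · exact ⟨0, by simp, by simp⟩
  obtain ⟨y₀, hy₀, hmin⟩ := hK.exists_isMinOn hne ((continuousOn_sqrt_det x₀).mono hKt)
  have hpos := sqrt_det_pos (hKt hy₀)
  refine ⟨(ENNReal.ofReal √(metricMatrix x₀ y₀).det)⁻¹, by simpa using hpos, ?_⟩
  refine Measure.le_iff.2 fun B hB => ?_
  rw [Measure.smul_apply, Measure.restrict_apply hB, Measure.restrict_apply hB,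
    coordVolume_apply (hB.inter hK.measurableSet) (inter_subset_right.trans hKt), smul_eq_mul]
  have h1 : ENNReal.ofReal √(metricMatrix x₀ y₀).det * volume (B ∩ K) ≤
      ∫⁻ y in B ∩ K, ENNReal.ofReal √(metricMatrix x₀ y).det := by
    rw [← setLIntegral_const]
    exact setLIntegral_mono_ae' (hB.inter hK.measurableSet)
      (Eventually.of_forall fun y hy => ENNReal.ofReal_le_ofReal (hmin hy.2))
  calc volume (B ∩ K) = (ENNReal.ofReal √(metricMatrix x₀ y₀).det)⁻¹ *
        (ENNReal.ofReal √(metricMatrix x₀ y₀).det * volume (B ∩ K)) := by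
        rw [← mul_assoc, ENNReal.inv_mul_cancel (by simpa using hpos) ENNReal.ofReal_ne_top, one_mul]
    _ ≤ _ := by gcongr

variable [T2Space M]

lemma memLp_comp_chart_symm {x₀ : M} {K : Set 𝔼} (hK : IsCompact K)
    (hKt : K ⊆ (chartAt 𝔼 x₀).target) {f : M → ℝ} {p : ℝ≥0∞}
    (hf : MemLp f p ((riemannianVolume N M).restrict ((chartAt 𝔼 x₀).symm '' K))) :
    MemLp (fun y => f ((chartAt 𝔼 x₀).symm y)) p (volume.restrict K) := by
  have hKs := image_symm_subset_source hKt
  have hKm := (isCompact_image_symm hK hKt).measurableSet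
  rw [← Measure.restrict_restrict_of_subset hKs, riemannianVolume_restrict_source,
    chartVolume_eq_map, Measure.restrict_map_of_aemeasurable (aemeasurable_chart_symm x₀) hKm] at hf
  -- The inverse chart is injective only on the chart target, which has full measure, so the two
  -- sets agree almost everywhere.
  have hset : (chartAt 𝔼 x₀).symm ⁻¹' ((chartAt 𝔼 x₀).symm '' K) =ᵐ[coordVolume x₀] K := by
    filter_upwards [ae_mem_target x₀] with y hy
    refine propext ⟨?_, fun h => mem_image_of_mem _ h⟩
    rintro ⟨y', hy', h⟩
    rwa [← (chartAt 𝔼 x₀).symm.injOn (hKt hy') hy h]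
  rw [Measure.restrict_congr_set hset] at hf
  have h2 := hf.comp_of_map ((aemeasurable_chart_symm x₀).mono_measure Measure.restrict_le_self)
  obtain ⟨c, hc, hle⟩ := exists_restrict_le_smul_coordVolume hK hKt
  exact h2.of_measure_le_smul hc hle

lemma LpLoc.memLp_comp_chart_symm {Ω : Set M} {r : ℝ} {f : M → ℝ} (hf : LpLoc N r Ω f) {x₀ : M}
    {K : Set 𝔼} (hK : IsCompact K) (hKΩ : K ⊆ chartDomain Ω x₀) :
    MemLp (fun y => f ((chartAt 𝔼 x₀).symm y)) (ENNReal.ofReal r) (volume.restrict K) := by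
  have hKt : K ⊆ (chartAt 𝔼 x₀).target := hKΩ.trans inter_subset_left
  refine RiemannianHardy.memLp_comp_chart_symm hK hKt (hf _ (isCompact_image_symm hK hKt) ?_)
  rintro _ ⟨y, hy, rfl⟩
  exact (hKΩ hy).2

end Compact

end Transfer

/-! ### Extension by zero between a chart and the manifold -/

section ChartFunctions

variable {N : ℕ} {M : Type*} [TopologicalSpace M] [ChartedSpace (EuclideanSpace ℝ (Fin N)) M]

local notation "𝔼" => EuclideanSpace ℝ (Fin N)

/-- A function of the coordinates of the chart around `x₀`, as a function on the manifold, extended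
by zero. -/
def ofChart (x₀ : M) (φ : 𝔼 → ℝ) : M → ℝ :=
  (chartAt 𝔼 x₀).source.indicator fun x => φ (chartAt 𝔼 x₀ x)

/-- A function on the manifold, seen in the chart around `x₀` and extended by zero. -/
def toChart (x₀ : M) (w : M → ℝ) : 𝔼 → ℝ :=
  (chartAt 𝔼 x₀).target.indicator fun y => w ((chartAt 𝔼 x₀).symm y)

lemma ofChart_symm {x₀ : M} {φ : 𝔼 → ℝ} {y : 𝔼} (hy : y ∈ (chartAt 𝔼 x₀).target) :
    ofChart x₀ φ ((chartAt 𝔼 x₀).symm y) = φ y := by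
  rw [ofChart, indicator_of_mem ((chartAt 𝔼 x₀).map_target hy), (chartAt 𝔼 x₀).right_inv hy]

lemma toChart_of_mem {x₀ : M} {w : M → ℝ} {y : 𝔼} (hy : y ∈ (chartAt 𝔼 x₀).target) :
    toChart x₀ w y = w ((chartAt 𝔼 x₀).symm y) := indicator_of_mem hy _

/-- The image of the support is compact, hence closed in a Hausdorff space, so extending by zero
does not enlarge the support beyond the chart. -/
lemma tsupport_ofChart_subset [T2Space M] {x₀ : M} {φ : 𝔼 → ℝ} (hφ : HasCompactSupport φ)
    (hφt : tsupport φ ⊆ (chartAt 𝔼 x₀).target) :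
    tsupport (ofChart x₀ φ) ⊆ (chartAt 𝔼 x₀).symm '' tsupport φ := by
  refine closure_minimal (fun x hx => ?_) (isCompact_image_symm hφ hφt).isClosed
  have hxs : x ∈ (chartAt 𝔼 x₀).source := by
    by_contra h
    exact hx (indicator_of_notMem h _)
  refine ⟨chartAt 𝔼 x₀ x, subset_tsupport _ fun h => hx ?_, (chartAt 𝔼 x₀).left_inv hxs⟩
  rw [ofChart, indicator_of_mem hxs, h]

lemma tsupport_toChart_subset {x₀ : M} {w : M → ℝ} (hw : HasCompactSupport w)
    (hws : tsupport w ⊆ (chartAt 𝔼 x₀).source) :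
    tsupport (toChart x₀ w) ⊆ (chartAt 𝔼 x₀) '' tsupport w := by
  refine closure_minimal (fun y hy => ?_) (isCompact_image_chart hw hws).isClosed
  have hyt : y ∈ (chartAt 𝔼 x₀).target := by
    by_contra h
    exact hy (indicator_of_notMem h _)
  refine ⟨(chartAt 𝔼 x₀).symm y, subset_tsupport _ fun h => hy ?_, (chartAt 𝔼 x₀).right_inv hyt⟩
  rw [toChart, indicator_of_mem hyt, h]

variable [IsManifold (𝓡 N) ∞ M]

lemma isC1c_ofChart [T2Space M] {Ω : Set M} {x₀ : M} {φ : 𝔼 → ℝ} (hφ : ContDiff ℝ 1 φ)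
    (hφc : HasCompactSupport φ) (hφU : tsupport φ ⊆ chartDomain Ω x₀) :
    IsC1c N Ω (ofChart x₀ φ) := by
  have hφt : tsupport φ ⊆ (chartAt 𝔼 x₀).target := hφU.trans inter_subset_left
  have hsub := tsupport_ofChart_subset hφc hφt
  have hK := isCompact_image_symm hφc hφt
  refine ⟨contMDiff_of_tsupport fun x hx => ?_, hK.of_isClosed_subset (isClosed_tsupport _) hsub,
    hsub.trans ?_⟩
  · have hxs : x ∈ (chartAt 𝔼 x₀).source := image_symm_subset_source hφt (hsub hx)
    have h1 : ContMDiffAt (𝓡 N) 𝓘(ℝ, ℝ) 1 (φ ∘ chartAt 𝔼 x₀) x :=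
      hφ.contMDiff.contMDiffAt.comp x (((contMDiffOn_chart (I := 𝓡 N) (n := ∞) (H := 𝔼) (x := x₀)).of_le
        (by simp)).contMDiffAt ((chartAt 𝔼 x₀).open_source.mem_nhds hxs))
    refine h1.congr_of_eventuallyEq ?_
    filter_upwards [(chartAt 𝔼 x₀).open_source.mem_nhds hxs] with z hz
    exact indicator_of_mem hz _
  · rintro _ ⟨y, hy, rfl⟩
    exact (hφU hy).2

lemma contDiff_toChart {x₀ : M} {w : M → ℝ} (hw : ContMDiff (𝓡 N) 𝓘(ℝ, ℝ) 1 w)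
    (hwc : HasCompactSupport w) (hws : tsupport w ⊆ (chartAt 𝔼 x₀).source) :
    ContDiff ℝ 1 (toChart (N := N) x₀ w) := by
  refine contMDiff_iff_contDiff.1 (contMDiff_of_tsupport fun y hy => ?_)
  obtain ⟨x, hx, rfl⟩ := tsupport_toChart_subset hwc hws hy
  have ht := (chartAt 𝔼 x₀).open_target.mem_nhds ((chartAt 𝔼 x₀).map_source (hws hx))
  have h1 : ContMDiffOn (𝓡 N) 𝓘(ℝ, ℝ) 1 (w ∘ (chartAt 𝔼 x₀).symm) (chartAt 𝔼 x₀).target :=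
    hw.comp_contMDiffOn ((contMDiffOn_chart_symm (n := ∞)).of_le (by simp))
  refine (h1.contMDiffAt ht).congr_of_eventuallyEq ?_
  filter_upwards [ht] with z hz
  exact indicator_of_mem hz _

variable [Bundle.RiemannianBundle (fun x : M => TangentSpace (𝓡 N) x)]

lemma lowerCoeff_grad_ofChart [T2Space M] {Ω : Set M} {x₀ : M} {φ : 𝔼 → ℝ} (hφ : ContDiff ℝ 1 φ)
    (hφc : HasCompactSupport φ) (hφU : tsupport φ ⊆ chartDomain Ω x₀) {y : 𝔼}
    (hy : y ∈ (chartAt 𝔼 x₀).target) (i : Fin N) :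
    lowerCoeff x₀ (grad N (ofChart x₀ φ)) i y = fderiv ℝ φ y (stdVec i) := by
  rw [lowerCoeff_grad hy ((isC1c_ofChart hφ hφc hφU).contMDiff.mdifferentiable one_ne_zero _)]
  congr 1
  refine Filter.EventuallyEq.fderiv_eq ?_
  filter_upwards [(chartAt 𝔼 x₀).open_target.mem_nhds hy] with z hz using ofChart_symm hz

lemma lowerCoeff_grad_eq_fderiv_toChart {x₀ : M} {w : M → ℝ} (hw : ContMDiff (𝓡 N) 𝓘(ℝ, ℝ) 1 w)
    {y : 𝔼} (hy : y ∈ (chartAt 𝔼 x₀).target) (i : Fin N) :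
    lowerCoeff x₀ (grad N w) i y = fderiv ℝ (toChart x₀ w) y (stdVec i) := by
  rw [lowerCoeff_grad hy (hw.mdifferentiable one_ne_zero _)]
  congr 1
  refine Filter.EventuallyEq.fderiv_eq ?_
  filter_upwards [(chartAt 𝔼 x₀).open_target.mem_nhds hy] with z hz using (toChart_of_mem hz).symm

variable [IsContMDiffRiemannianBundle (𝓡 N) ∞ (EuclideanSpace ℝ (Fin N))
      (fun x : M => TangentSpace (𝓡 N) x)] [MeasurableSpace M] [BorelSpace M]

/-- An integral over `Ω` of a function supported in the domain of a chart, in coordinates. -/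
lemma setIntegral_eq_integral_chartDomain {Ω : Set M} (x₀ : M) {h : M → ℝ}
    (h0 : ∀ x, x ∉ Ω → h x = 0) (h1 : ∀ x, x ∉ (chartAt 𝔼 x₀).source → h x = 0) :
    ∫ x in Ω, h x ∂(riemannianVolume N M) = ∫ y in chartDomain Ω x₀,
      √(metricMatrix x₀ y).det * h ((chartAt 𝔼 x₀).symm y) := by
  rw [setIntegral_eq_integral_of_forall_compl_eq_zero h0,
    ← setIntegral_eq_integral_of_forall_compl_eq_zero h1, riemannianVolume_restrict_source,
    integral_chartVolume]
  refine (setIntegral_eq_of_subset_of_forall_sdiff_eq_zero (measurableSet_target x₀)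
    inter_subset_left fun y hy => ?_)
  rw [h0 _ fun h => hy.2 ⟨hy.1, h⟩, mul_zero]

end ChartFunctions

/-! ### Sobolev test functions supported in one chart -/

section LocalTest

variable {N : ℕ} {M : Type*} [TopologicalSpace M] [ChartedSpace (EuclideanSpace ℝ (Fin N)) M]
  [Bundle.RiemannianBundle (fun x : M => TangentSpace (𝓡 N) x)]

local notation "𝔼" => EuclideanSpace ℝ (Fin N)

/-- The components of `√ det g |G|^(p-2) G` in the chart around `x₀`. -/
def flux (p : ℝ) (x₀ : M) (G : (x : M) → TangentSpace (𝓡 N) x) (i : Fin N) (y : 𝔼) : ℝ :=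
  √(metricMatrix x₀ y).det * (‖G ((chartAt 𝔼 x₀).symm y)‖ ^ (p - 2) * upperCoeff x₀ G i y)

variable [IsManifold (𝓡 N) ∞ M]
  [IsContMDiffRiemannianBundle (𝓡 N) ∞ (EuclideanSpace ℝ (Fin N))
      (fun x : M => TangentSpace (𝓡 N) x)] [MeasurableSpace M] [BorelSpace M]

lemma sum_flux_mul {p : ℝ} {x₀ : M} {y : 𝔼} (hy : y ∈ (chartAt 𝔼 x₀).target)
    (G H : (x : M) → TangentSpace (𝓡 N) x) : ∑ i, flux p x₀ G i y * lowerCoeff x₀ H i y =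
    √(metricMatrix x₀ y).det * (‖G ((chartAt 𝔼 x₀).symm y)‖ ^ (p - 2) *
      inner ℝ (G ((chartAt 𝔼 x₀).symm y)) (H ((chartAt 𝔼 x₀).symm y))) := by
  rw [inner_eq_sum_upperCoeff hy, Finset.mul_sum, Finset.mul_sum]
  refine Finset.sum_congr rfl fun i _ => ?_
  rw [flux]
  ring

/-- The point is t = 0 with p < 2, where the negative power has a conventional value; both sides
vanish because p > 1. -/
lemma rpow_sub_two_mul_self {p t : ℝ} (hp : 1 < p) (ht : 0 ≤ t) :
    t ^ (p - 2) * t = t ^ (p - 1) := by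
  rcases ht.eq_or_lt with rfl | ht
  · rw [mul_zero, Real.zero_rpow (by linarith)]
  · rw [← Real.rpow_add_one ht.ne']
    ring_nf

variable [T2Space M]

lemma memLp_lowerCoeff {Ω : Set M} {f : M → ℝ} {G : (x : M) → TangentSpace (𝓡 N) x}
    (h : HasWeakGradient Ω f G) {p : ℝ} (hG : LpLoc N p Ω fun x => ‖G x‖) {x₀ : M} (i : Fin N)
    {K : Set 𝔼} (hK : IsCompact K) (hKU : K ⊆ chartDomain Ω x₀) :
    MemLp (lowerCoeff x₀ G i) (ENNReal.ofReal p) (volume.restrict K) := by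
  obtain ⟨C, hC⟩ := hK.exists_bound_of_continuousOn
    ((continuousOn_metricMatrix_apply x₀ i i).sqrt.mono (hKU.trans inter_subset_left))
  refine (hG.memLp_comp_chart_symm hK hKU).of_le_mul (c := C)
    ((h.aestronglyMeasurable_lowerCoeff x₀ i).mono_measure (Measure.restrict_mono hKU le_rfl)) ?_
  filter_upwards [ae_restrict_mem hK.measurableSet] with y hy
  rw [Real.norm_eq_abs, norm_norm]
  refine (abs_lowerCoeff_le x₀ y G i).trans ?_
  gcongr
  exact (Real.le_norm_self _).trans (hC y hy)

/-- On compact sets the flux is at most a constant times |G|^(p-1), and |G| ∈ L^p puts this power in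
the dual exponent p/(p-1). -/
lemma memLp_flux {Ω : Set M} (hΩ : IsOpen Ω) {f : M → ℝ} {G : (x : M) → TangentSpace (𝓡 N) x}
    (h : HasWeakGradient Ω f G) {p : ℝ} (hp : 1 < p) (hG : LpLoc N p Ω fun x => ‖G x‖) {x₀ : M}
    (i : Fin N) {K : Set 𝔼} (hK : IsCompact K) (hKU : K ⊆ chartDomain Ω x₀) :
    MemLp (flux p x₀ G i) (ENNReal.ofReal (p / (p - 1))) (volume.restrict K) := by
  have hKt := hKU.trans inter_subset_left
  have hG1 := hG.memLp_comp_chart_symm hK hKU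
  have hG2 := hG1.norm_rpow_div (ENNReal.ofReal (p - 1))
  rw [ENNReal.toReal_ofReal (by linarith), ← ENNReal.ofReal_div_of_pos (by linarith)] at hG2
  obtain ⟨C, hC⟩ := hK.exists_bound_of_continuousOn
    (f := fun y => √(metricMatrix x₀ y).det *
      (∑ j, |(metricMatrix x₀ y)⁻¹ i j| * √(metricMatrix x₀ y j j)))
    (((continuousOn_sqrt_det x₀).mul (continuousOn_finsetSum _ fun j _ =>
      (continuousOn_inv_metricMatrix_apply x₀ i j).abs.mul
        (continuousOn_metricMatrix_apply x₀ j j).sqrt)).mono hKt)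
  refine hG2.of_le_mul (c := C) ?_ ?_
  · exact (((continuousOn_sqrt_det x₀).mono hKt).aestronglyMeasurable hK.measurableSet).mul
      ((hG1.1.aemeasurable.pow_const _).aestronglyMeasurable.mul
        ((h.aestronglyMeasurable_upperCoeff hΩ x₀ i).mono_measure
          (Measure.restrict_mono hKU le_rfl)))
  filter_upwards [ae_restrict_mem hK.measurableSet] with y hy
  have hpow := rpow_sub_two_mul_self hp (norm_nonneg (G ((chartAt 𝔼 x₀).symm y)))
  set r := ‖G ((chartAt 𝔼 x₀).symm y)‖ with hr
  have hr0 : 0 ≤ r := norm_nonneg _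
  rw [flux, norm_norm, ← hr, Real.norm_of_nonneg (Real.rpow_nonneg hr0 _), ← hpow, norm_mul,
    norm_mul, Real.norm_of_nonneg (Real.sqrt_nonneg _), Real.norm_of_nonneg (Real.rpow_nonneg hr0 _)]
  calc √(metricMatrix x₀ y).det * (r ^ (p - 2) * ‖upperCoeff x₀ G i y‖)
      ≤ √(metricMatrix x₀ y).det * (r ^ (p - 2) *
        ((∑ j, |(metricMatrix x₀ y)⁻¹ i j| * √(metricMatrix x₀ y j j)) * r)) := by
        gcongr
        exact abs_upperCoeff_le x₀ y G i
    _ = (√(metricMatrix x₀ y).det *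
        (∑ j, |(metricMatrix x₀ y)⁻¹ i j| * √(metricMatrix x₀ y j j))) * (r ^ (p - 2) * r) := by
        ring
    _ ≤ C * (r ^ (p - 2) * r) := by
        gcongr
        exact (Real.le_norm_self _).trans (hC y hy)

/-- A weakly `p`-superharmonic function may be tested with `w F(ρ)`, for `w` supported in a
chart. -/
lemma integral_test_nonneg_of_tsupport_subset_source {Ω : Set M} (hΩ : IsOpen Ω) {p : ℝ}
    (hp : 1 < p) {ρ : M → ℝ} {G : (x : M) → TangentSpace (𝓡 N) x} (hρ : MemW1pLoc p Ω ρ G)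
    (hρ0 : ∀ᵐ x ∂((riemannianVolume N M).restrict Ω), 0 ≤ ρ x)
    (hsuper : ∀ φ : M → ℝ, IsC1c N Ω φ → (∀ x, 0 ≤ φ x) →
      0 ≤ ∫ x in Ω, ‖G x‖ ^ (p - 2) * inner ℝ (G x) (grad N φ x) ∂(riemannianVolume N M))
    {F : ℝ → ℝ} {ε C : ℝ} (hε : 0 < ε) (hF : ContDiffOn ℝ 1 F (Ioi (-ε)))
    (hF0 : ∀ t, 0 ≤ t → 0 ≤ F t) (hFC : ∀ t, 0 ≤ t → ‖F t‖ ≤ C)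
    (hdFC : ∀ t, 0 ≤ t → ‖deriv F t‖ ≤ C)
    {w : M → ℝ} (hw : IsC1c N Ω w) (hw0 : ∀ x, 0 ≤ w x) {x₀ : M}
    (hws : tsupport w ⊆ (chartAt 𝔼 x₀).source) :
    0 ≤ ∫ x in Ω, ‖G x‖ ^ (p - 2) * (F (ρ x) * inner ℝ (G x) (grad N w x) +
      w x * (deriv F (ρ x) * ‖G x‖ ^ 2)) ∂(riemannianVolume N M) := by
  have hU := isOpen_chartDomain (N := N) hΩ x₀
  have hconj : (p / (p - 1)).HolderConjugate p :=
    ((Real.holderConjugate_iff_eq_conjExponent hp).2 rfl).symm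
  have : ENNReal.HolderTriple (ENNReal.ofReal (p / (p - 1))) (ENNReal.ofReal p) 1 :=
    hconj.ennrealOfReal
  have hw's := tsupport_toChart_subset hw.hasCompactSupport hws
  have hw'U : tsupport (toChart (N := N) x₀ w) ⊆ chartDomain Ω x₀ := by
    refine hw's.trans ?_
    rintro _ ⟨x, hx, rfl⟩
    refine ⟨(chartAt 𝔼 x₀).map_source (hws hx), ?_⟩
    rw [mem_preimage, (chartAt 𝔼 x₀).left_inv (hws hx)]
    exact hw.tsupport_subset hx
  have hw'c : HasCompactSupport (toChart (N := N) x₀ w) :=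
    (isCompact_image_chart hw.hasCompactSupport hws).of_isClosed_subset (isClosed_tsupport _) hw's
  have hw'0 (y : 𝔼) : 0 ≤ toChart (N := N) x₀ w y := indicator_nonneg (fun y _ => hw0 _) y
  -- The remaining hypothesis, that the flux has nonpositive divergence in coordinates, is proved
  -- last by carrying φ to the manifold with `ofChart`.
  have key := (hρ.hasWeakGradient.hasWeakPartials x₀).integral_test_nonneg hU
    (p := ENNReal.ofReal p) (q := ENNReal.ofReal (p / (p - 1)))
    (ENNReal.one_le_ofReal.2 hp.le) ENNReal.ofReal_ne_top (ENNReal.one_le_ofReal.2 hconj.lt.le)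
    (fun K hK hKU => hρ.lpLoc.memLp_comp_chart_symm hK hKU)
    (fun i K hK hKU => memLp_lowerCoeff hρ.hasWeakGradient hρ.lpLoc_norm i hK hKU)
    (ae_restrict_chartDomain hΩ hρ0 x₀)
    (A := flux p x₀ G)
    (fun i K hK hKU => memLp_flux hΩ hρ.hasWeakGradient hp hρ.lpLoc_norm i hK hKU)
    (fun φ hφ hφc hφU hφ0 => ?_) hε hF hF0 hFC hdFC
    (contDiff_toChart hw.contMDiff hw.hasCompactSupport hws) hw'c hw'U hw'0
  · refine key.trans_eq ?_
    have hz (x : M) (hx : x ∉ tsupport w) : ‖G x‖ ^ (p - 2) * (F (ρ x) * inner ℝ (G x) (grad N w x) +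
        w x * (deriv F (ρ x) * ‖G x‖ ^ 2)) = 0 := by
      rw [grad_eq_zero_of_notMem_tsupport hx, image_eq_zero_of_notMem_tsupport hx, inner_zero_right]
      ring
    rw [setIntegral_eq_integral_chartDomain x₀ (fun x hx => hz x fun h => hx (hw.tsupport_subset h))
        fun x hx => hz x fun h => hx (hws h),
      ← setIntegral_eq_integral_of_forall_compl_eq_zero (s := chartDomain Ω x₀)]
    · refine setIntegral_congr_fun hU.measurableSet fun y hy => ?_
      simp_rw [← lowerCoeff_grad_eq_fderiv_toChart hw.contMDiff hy.1, toChart_of_mem hy.1, mul_add,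
        Finset.sum_add_distrib]
      have e1 := sum_flux_mul (p := p) hy.1 G (grad N w)
      have e2 := sum_flux_mul (p := p) hy.1 G G
      rw [real_inner_self_eq_norm_sq] at e2
      calc _ = F (ρ ((chartAt 𝔼 x₀).symm y)) * ∑ i, flux p x₀ G i y * lowerCoeff x₀ (grad N w) i y +
          w ((chartAt 𝔼 x₀).symm y) * deriv F (ρ ((chartAt 𝔼 x₀).symm y)) *
            ∑ i, flux p x₀ G i y * lowerCoeff x₀ G i y := by
            rw [Finset.mul_sum, Finset.mul_sum]
            congr 1 <;> exact Finset.sum_congr rfl fun i _ => by ring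
        _ = _ := by rw [e1, e2]; ring
    · intro y hy
      have hy' : y ∉ tsupport (toChart x₀ w) := fun h => hy (hw'U h)
      refine Finset.sum_eq_zero fun i _ => ?_
      rw [fderiv_stdVec_eq_zero hy', image_eq_zero_of_notMem_tsupport hy']
      ring
  · have hφ' := isC1c_ofChart hφ hφc hφU
    have hts := tsupport_ofChart_subset hφc (hφU.trans inter_subset_left)
    have h0 := hsuper _ hφ' fun x => indicator_nonneg (fun x _ => hφ0 _) x
    have hz (x : M) (hx : x ∉ tsupport (ofChart x₀ φ)) :
        ‖G x‖ ^ (p - 2) * inner ℝ (G x) (grad N (ofChart x₀ φ) x) = 0 := by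
      rw [grad_eq_zero_of_notMem_tsupport hx, inner_zero_right, mul_zero]
    rw [setIntegral_eq_integral_chartDomain x₀
      (fun x hx => hz x fun h => hx (hφ'.tsupport_subset h))
      fun x hx => hz x fun h => hx (image_symm_subset_source (hφU.trans inter_subset_left) (hts h)),
      ] at h0
    rw [← setIntegral_eq_integral_of_forall_compl_eq_zero (s := chartDomain Ω x₀)]
    · refine h0.trans_eq (setIntegral_congr_fun hU.measurableSet fun y hy => ?_)
      rw [← sum_flux_mul hy.1]
      exact Finset.sum_congr rfl fun i _ => by rw [lowerCoeff_grad_ofChart hφ hφc hφU hy.1]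
    · intro y hy
      refine Finset.sum_eq_zero fun i _ => ?_
      rw [fderiv_stdVec_eq_zero fun h => hy (hφU h), mul_zero]

end LocalTest

/-! ### Linearity and chain rule for the Riemannian gradient -/

section Gradient

variable {N : ℕ} {M : Type*} [TopologicalSpace M] [ChartedSpace (EuclideanSpace ℝ (Fin N)) M]
  [Bundle.RiemannianBundle (fun x : M => TangentSpace (𝓡 N) x)]

local notation "𝔼" => EuclideanSpace ℝ (Fin N)

lemma inner_grad' (u : M → ℝ) (x : M) (v : TangentSpace (𝓡 N) x) :
    inner ℝ v (grad N u x) = (mfderiv (𝓡 N) 𝓘(ℝ, ℝ) u x v : ℝ) :=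
  (real_inner_comm _ _).trans (inner_grad u x v)

lemma inner_grad_sum {ι : Type} {t : Finset ι} {w : ι → M → ℝ} {x : M}
    (hw : ∀ i ∈ t, MDifferentiableAt (𝓡 N) 𝓘(ℝ, ℝ) (w i) x) (v : TangentSpace (𝓡 N) x) :
    inner ℝ v (grad N (∑ i ∈ t, w i) x) = ∑ i ∈ t, inner ℝ v (grad N (w i) x) := by
  have h := (HasMFDerivAt.sum fun i hi => (hw i hi).hasMFDerivAt).mfderiv
  simp_rw [inner_grad']
  rw [h]
  have h' (L : ι → 𝔼 →L[ℝ] ℝ) (v : 𝔼) : (∑ i ∈ t, L i) v = ∑ i ∈ t, L i v := by simp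
  exact h' _ v

lemma inner_grad_comp {k : ℝ → ℝ} {k' : ℝ} {u : M → ℝ} {x : M}
    (hu : MDifferentiableAt (𝓡 N) 𝓘(ℝ, ℝ) u x) (hk : HasDerivAt k k' (u x))
    (v : TangentSpace (𝓡 N) x) :
    inner ℝ v (grad N (fun x => k (u x)) x) = k' * inner ℝ v (grad N u x) := by
  have h := (hk.hasFDerivAt.hasMFDerivAt.comp x hu.hasMFDerivAt).mfderiv
  simp_rw [inner_grad']
  have h2 := congrArg (fun L : TangentSpace (𝓡 N) x →L[ℝ] ℝ => L v) h
  refine h2.trans ?_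
  exact mul_comm _ _

end Gradient

/-! ### Sobolev test functions on the manifold -/

section GlobalTest

variable {N : ℕ} {M : Type*} [TopologicalSpace M] [ChartedSpace (EuclideanSpace ℝ (Fin N)) M]
  [Bundle.RiemannianBundle (fun x : M => TangentSpace (𝓡 N) x)]
  [IsManifold (𝓡 N) ∞ M]
  [IsContMDiffRiemannianBundle (𝓡 N) ∞ (EuclideanSpace ℝ (Fin N))
      (fun x : M => TangentSpace (𝓡 N) x)] [MeasurableSpace M] [BorelSpace M]
  [SecondCountableTopology M] [T2Space M]

local notation "𝔼" => EuclideanSpace ℝ (Fin N)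

/-- A function that is bounded by a locally integrable one and has compact support is integrable. -/
lemma integrable_of_norm_le_of_tsupport {Ω : Set M} (hΩ : IsOpen Ω) {f g : M → ℝ} {K : Set M}
    (hK : IsCompact K) (hKΩ : K ⊆ Ω) (hf : AEStronglyMeasurable f ((riemannianVolume N M).restrict Ω))
    (hg : IntegrableOn g K (riemannianVolume N M))
    (hfg : ∀ᵐ x ∂((riemannianVolume N M).restrict Ω), x ∈ K → ‖f x‖ ≤ g x)
    (h0 : ∀ x, x ∉ K → f x = 0) : Integrable f ((riemannianVolume N M).restrict Ω) := by
  refine IntegrableOn.of_forall_sdiff_eq_zero (s := K) ?_ hΩ.measurableSet fun x hx => h0 x hx.2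
  refine Integrable.mono' hg (hf.mono_measure (Measure.restrict_mono hKΩ le_rfl)) ?_
  filter_upwards [ae_mono (Measure.restrict_mono hKΩ le_rfl) hfg, ae_restrict_mem hK.measurableSet]
    with x hx hxK using hx hxK

lemma LpLoc.integrableOn_rpow {Ω : Set M} {p : ℝ} (hp : 0 < p) {f : M → ℝ} (hf : LpLoc N p Ω f)
    {K : Set M} (hK : IsCompact K) (hKΩ : K ⊆ Ω) :
    IntegrableOn (fun x => ‖f x‖ ^ p) K (riemannianVolume N M) := by
  have := (hf K hK hKΩ).integrable_norm_rpow (by simpa using hp) ENNReal.ofReal_ne_top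
  rwa [ENNReal.toReal_ofReal hp.le] at this

/-- The two terms are of order |G|^(p-1) and |G|^p on the support of w. Integrability is needed to
distribute the integral over a partition of unity. -/
lemma integrable_test {Ω : Set M} (hΩ : IsOpen Ω) {p : ℝ}
    (hp : 1 < p) {ρ : M → ℝ} {G : (x : M) → TangentSpace (𝓡 N) x} (hρ : MemW1pLoc p Ω ρ G)
    (hρ0 : ∀ᵐ x ∂((riemannianVolume N M).restrict Ω), 0 ≤ ρ x)
    {F : ℝ → ℝ} {C : ℝ} (hFm : Measurable F)
    (hFC : ∀ t, 0 ≤ t → ‖F t‖ ≤ C) (hdFC : ∀ t, 0 ≤ t → ‖deriv F t‖ ≤ C)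
    {w : M → ℝ} (hw : IsC1c N Ω w) :
    Integrable (fun x => ‖G x‖ ^ (p - 2) * (F (ρ x) * inner ℝ (G x) (grad N w x) +
      w x * (deriv F (ρ x) * ‖G x‖ ^ 2))) ((riemannianVolume N M).restrict Ω) := by
  have hm := (hρ.hasWeakGradient.aestronglyMeasurable hΩ).aemeasurable
  have hmG := hρ.hasWeakGradient.aestronglyMeasurable_norm hΩ
  have hmGw := hρ.hasWeakGradient.aestronglyMeasurable_inner_grad hΩ hw.contMDiff
  have hwcont : Continuous w := hw.contMDiff.continuous
  obtain ⟨D, hD⟩ := hw.hasCompactSupport.isCompact.exists_bound_of_continuousOn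
    (continuous_norm_grad hw.contMDiff).continuousOn
  obtain ⟨E, hE⟩ := hw.hasCompactSupport.isCompact.exists_bound_of_continuousOn
    hwcont.continuousOn
  refine integrable_of_norm_le_of_tsupport (K := tsupport w) hΩ hw.hasCompactSupport
    hw.tsupport_subset (g := fun x => (C * |D|) * (1 + ‖G x‖ ^ p) + (C * E) * ‖G x‖ ^ p) ?_ ?_ ?_ ?_
  · refine (hmG.aemeasurable.pow_const _).aestronglyMeasurable.mul (AEStronglyMeasurable.add
      ((hFm.comp_aemeasurable hm).aestronglyMeasurable.mul hmGw)
      (hwcont.aestronglyMeasurable.mul (AEStronglyMeasurable.mul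
        ((measurable_deriv F).comp_aemeasurable hm).aestronglyMeasurable (hmG.pow 2))))
  · have h1 : IntegrableOn (fun x => ‖G x‖ ^ p) (tsupport w) (riemannianVolume N M) := by
      simpa only [norm_norm] using
        hρ.lpLoc_norm.integrableOn_rpow (by linarith) hw.hasCompactSupport hw.tsupport_subset
    have h2 : IntegrableOn (fun _ => (1 : ℝ)) (tsupport w) (riemannianVolume N M) :=
      integrableOn_const hw.hasCompactSupport.isCompact.measure_lt_top.ne
    exact ((h2.add h1).const_mul _).add (h1.const_mul _)
  · filter_upwards [hρ0] with x hx hxK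
    have hC0 : 0 ≤ C := (norm_nonneg _).trans (hFC 0 le_rfl)
    have hE0 : 0 ≤ E := (norm_nonneg _).trans (hE x hxK)
    have hr : 0 ≤ ‖G x‖ := norm_nonneg _
    have e1 := rpow_sub_two_mul_self hp hr
    have e2 : ‖G x‖ ^ (p - 2) * ‖G x‖ ^ 2 = ‖G x‖ ^ p := by
      rw [pow_two, ← mul_assoc, e1]
      rcases hr.eq_or_lt with h | h
      · rw [← h, mul_zero, Real.zero_rpow (by linarith)]
      · rw [← Real.rpow_add_one h.ne']; ring_nf
    -- Only the p-th power is known to be integrable on compacts; the constant 1 is harmless because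
    -- the support of w has finite volume.
    have e3 : ‖G x‖ ^ (p - 1) ≤ 1 + ‖G x‖ ^ p := by
      rcases le_total ‖G x‖ 1 with h | h
      · have := Real.rpow_le_one hr h (by linarith : 0 ≤ p - 1)
        have := Real.rpow_nonneg hr p
        linarith
      · have := Real.rpow_le_rpow_of_exponent_le h (by linarith : p - 1 ≤ p)
        linarith
    have hD' : ‖grad N w x‖ ≤ |D| := by
      have := hD x hxK
      rw [norm_norm] at this
      exact this.trans (le_abs_self D)
    have hin : |inner ℝ (G x) (grad N w x)| ≤ ‖G x‖ * |D| :=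
      (abs_real_inner_le_norm _ _).trans (by gcongr)
    have hpow0 : 0 ≤ ‖G x‖ ^ (p - 2) := Real.rpow_nonneg hr _
    rw [Real.norm_eq_abs, abs_mul, abs_of_nonneg hpow0]
    calc ‖G x‖ ^ (p - 2) * |F (ρ x) * inner ℝ (G x) (grad N w x) + w x * (deriv F (ρ x) * ‖G x‖ ^ 2)|
        ≤ ‖G x‖ ^ (p - 2) * (C * (‖G x‖ * |D|) + E * (C * ‖G x‖ ^ 2)) := by
          refine mul_le_mul_of_nonneg_left ((abs_add_le _ _).trans ?_) hpow0
          rw [abs_mul, abs_mul, abs_mul, abs_of_nonneg (sq_nonneg ‖G x‖)]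
          gcongr
          · exact hFC _ hx
          · exact hE x hxK
          · exact hdFC _ hx
      _ = (C * |D|) * (‖G x‖ ^ (p - 2) * ‖G x‖) + (C * E) * (‖G x‖ ^ (p - 2) * ‖G x‖ ^ 2) := by ring
      _ ≤ _ := by
          rw [e1, e2]
          gcongr
  · intro x hx
    rw [grad_eq_zero_of_notMem_tsupport hx, image_eq_zero_of_notMem_tsupport hx, inner_zero_right]
    ring

/-- A compactly supported function is a finite sum of functions supported in charts. -/
lemma exists_chart_decomposition {Ω : Set M} {w : M → ℝ} (hw : IsC1c N Ω w) (hw0 : ∀ x, 0 ≤ w x) :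
    ∃ (n : ℕ) (c : Fin n → M) (v : Fin n → M → ℝ), w = ∑ i, v i ∧
      ∀ i, IsC1c N Ω (v i) ∧ (∀ x, 0 ≤ v i x) ∧ tsupport (v i) ⊆ (chartAt 𝔼 (c i)).source := by
  have : LocallyCompactSpace M := ChartedSpace.locallyCompactSpace 𝔼 M
  obtain ⟨t, ht⟩ := hw.hasCompactSupport.isCompact.elim_finite_subcover
    (fun x : M => (chartAt 𝔼 x).source) (fun x => (chartAt 𝔼 x).open_source)
    fun x _ => mem_iUnion.2 ⟨x, mem_chart_source 𝔼 x⟩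
  let c : Fin t.card → M := fun i => t.equivFin.symm i
  have hc : tsupport w ⊆ ⋃ i, (chartAt 𝔼 (c i)).source := by
    intro x hx
    obtain ⟨y, hy, hxy⟩ := mem_iUnion₂.1 (ht hx)
    refine mem_iUnion.2 ⟨t.equivFin ⟨y, hy⟩, ?_⟩
    simpa [c] using hxy
  obtain ⟨f, hf⟩ := SmoothPartitionOfUnity.exists_isSubordinate (𝓡 N) (isClosed_tsupport w)
    (fun i => (chartAt 𝔼 (c i)).source) (fun i => (chartAt 𝔼 (c i)).open_source) hc
  refine ⟨t.card, c, fun i x => f i x * w x, ?_, fun i => ⟨⟨?_, ?_, ?_⟩, ?_, ?_⟩⟩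
  · ext x
    rw [Finset.sum_apply, ← Finset.sum_mul]
    by_cases hx : x ∈ tsupport w
    · have := f.sum_eq_one hx
      rw [finsum_eq_sum_of_fintype] at this
      rw [this, one_mul]
    · rw [image_eq_zero_of_notMem_tsupport hx, mul_zero]
  · exact ((f i).contMDiff.of_le (by simp)).mul hw.contMDiff
  · exact hw.hasCompactSupport.mul_left
  · exact (tsupport_mul_subset_right).trans hw.tsupport_subset
  · exact fun x => mul_nonneg (f.nonneg i x) (hw0 x)
  · exact (tsupport_mul_subset_left).trans (hf i)

/-- A weakly `p`-superharmonic function may be tested with `w F(ρ)`. -/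
lemma integral_test_nonneg {Ω : Set M} (hΩ : IsOpen Ω) {p : ℝ}
    (hp : 1 < p) {ρ : M → ℝ} {G : (x : M) → TangentSpace (𝓡 N) x} (hρ : MemW1pLoc p Ω ρ G)
    (hρ0 : ∀ᵐ x ∂((riemannianVolume N M).restrict Ω), 0 ≤ ρ x)
    (hsuper : ∀ φ : M → ℝ, IsC1c N Ω φ → (∀ x, 0 ≤ φ x) →
      0 ≤ ∫ x in Ω, ‖G x‖ ^ (p - 2) * inner ℝ (G x) (grad N φ x) ∂(riemannianVolume N M))
    {F : ℝ → ℝ} {ε C : ℝ} (hε : 0 < ε) (hF : ContDiffOn ℝ 1 F (Ioi (-ε))) (hFm : Measurable F)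
    (hF0 : ∀ t, 0 ≤ t → 0 ≤ F t) (hFC : ∀ t, 0 ≤ t → ‖F t‖ ≤ C)
    (hdFC : ∀ t, 0 ≤ t → ‖deriv F t‖ ≤ C)
    {w : M → ℝ} (hw : IsC1c N Ω w) (hw0 : ∀ x, 0 ≤ w x) :
    0 ≤ ∫ x in Ω, ‖G x‖ ^ (p - 2) * (F (ρ x) * inner ℝ (G x) (grad N w x) +
      w x * (deriv F (ρ x) * ‖G x‖ ^ 2)) ∂(riemannianVolume N M) := by
  obtain ⟨n, c, v, hwv, hv⟩ := exists_chart_decomposition hw hw0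
  have hsum (x : M) : ‖G x‖ ^ (p - 2) * (F (ρ x) * inner ℝ (G x) (grad N w x) +
      w x * (deriv F (ρ x) * ‖G x‖ ^ 2)) = ∑ i, ‖G x‖ ^ (p - 2) * (F (ρ x) *
        inner ℝ (G x) (grad N (v i) x) + v i x * (deriv F (ρ x) * ‖G x‖ ^ 2)) := by
    rw [← Finset.mul_sum, Finset.sum_add_distrib, ← Finset.mul_sum, ← Finset.sum_mul, hwv,
      inner_grad_sum fun i _ => (hv i).1.contMDiff.mdifferentiable one_ne_zero x, Finset.sum_apply]
  simp_rw [hsum]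
  rw [integral_finsetSum _ fun i _ => integrable_test hΩ hp hρ hρ0 hFm hFC hdFC (hv i).1]
  exact Finset.sum_nonneg fun i _ => integral_test_nonneg_of_tsupport_subset_source hΩ hp hρ hρ0
    hsuper hε hF hF0 hFC hdFC (hv i).1 (hv i).2.1 (hv i).2.2

end GlobalTest

/-! ### Fatou's lemma and the pointwise Young inequality -/

section RealLemmas

/-- Fatou's lemma for integrals. -/
lemma integrable_and_integral_le_of_tendsto {X : Type*} [MeasurableSpace X] {μ : Measure X}
    {f : ℕ → X → ℝ} {g : X → ℝ} {B : ℝ} (hf : ∀ n, Integrable (f n) μ) (hf0 : ∀ n x, 0 ≤ f n x)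
    (hfB : ∀ n, ∫ x, f n x ∂μ ≤ B) (hg : AEStronglyMeasurable g μ) (hg0 : 0 ≤ᵐ[μ] g)
    (hfg : ∀ᵐ x ∂μ, g x = 0 ∨ Tendsto (fun n => f n x) atTop (𝓝 (g x))) :
    Integrable g μ ∧ ∫ x, g x ∂μ ≤ B := by
  have hB : 0 ≤ B := (integral_nonneg (hf0 0)).trans (hfB 0)
  have key : ∫⁻ x, ENNReal.ofReal (g x) ∂μ ≤ ENNReal.ofReal B := by
    calc ∫⁻ x, ENNReal.ofReal (g x) ∂μ
        ≤ ∫⁻ x, liminf (fun n => ENNReal.ofReal (f n x)) atTop ∂μ := by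
          refine lintegral_mono_ae ?_
          filter_upwards [hfg] with x hx
          rcases hx with hx | hx
          · simp [hx]
          · exact ((ENNReal.continuous_ofReal.tendsto _).comp hx).liminf_eq.ge
      _ ≤ liminf (fun n => ∫⁻ x, ENNReal.ofReal (f n x) ∂μ) atTop :=
          lintegral_liminf_le' fun n => (hf n).1.aemeasurable.ennreal_ofReal
      _ ≤ liminf (fun _ => ENNReal.ofReal B) atTop := by
          refine liminf_le_liminf (Eventually.of_forall fun n => ?_)
          rw [← ofReal_integral_eq_lintegral_ofReal (hf n) (Eventually.of_forall (hf0 n))]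
          exact ENNReal.ofReal_le_ofReal (hfB n)
      _ = ENNReal.ofReal B := liminf_const _
  refine ⟨⟨hg, ?_⟩, ?_⟩
  · rw [hasFiniteIntegral_iff_ofReal hg0]
    exact key.trans_lt ENNReal.ofReal_lt_top
  · rw [integral_eq_lintegral_of_nonneg_ae hg0 hg]
    exact ENNReal.toReal_le_of_le_ofReal hB key

lemma rpow_sub_two_mul_sq {p t : ℝ} (hp : 1 < p) (ht : 0 ≤ t) : t ^ (p - 2) * t ^ 2 = t ^ p := by
  rw [pow_two, ← mul_assoc, rpow_sub_two_mul_self hp ht]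
  rcases ht.eq_or_lt with rfl | h
  · rw [mul_zero, Real.zero_rpow (by linarith)]
  · rw [← Real.rpow_add_one h.ne']; ring_nf

/-- Young's inequality in the form in which it gives the sharp Hardy constant. -/
lemma young_hardy {p A B : ℝ} (hp : 1 < p) (hA : 0 ≤ A) (hB : 0 ≤ B) :
    p * (A ^ (p - 1) * B) - (p - 1) * A ^ p ≤
      (p - 1) / p * ((p / (p - 1)) ^ p * B ^ p - A ^ p) := by
  have hp1 : 0 < p - 1 := by linarith
  have hp0 : 0 < p := by linarith
  have hconj : (p / (p - 1)).HolderConjugate p :=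
    ((Real.holderConjugate_iff_eq_conjExponent hp).2 rfl).symm
  -- Weighting B by c leads to the Hardy constant c^p/((p-1)(c-1)), which is least at c = p/(p-1),
  -- with value c^p.
  have hy := Real.young_inequality_of_nonneg (Real.rpow_nonneg hA (p - 1))
    (mul_nonneg hconj.nonneg hB) hconj
  have e : (A ^ (p - 1)) ^ (p / (p - 1)) = A ^ p := by
    rw [← Real.rpow_mul hA]
    congr 1
    field_simp
  rw [e, Real.mul_rpow hconj.nonneg hB] at hy
  have h2 := mul_le_mul_of_nonneg_left hy hp1.le
  have e1 : (p - 1) * (A ^ (p - 1) * (p / (p - 1) * B)) = p * (A ^ (p - 1) * B) := by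
    field_simp
  have e2 : (p - 1) * (A ^ p / (p / (p - 1)) + (p / (p - 1)) ^ p * B ^ p / p) - (p - 1) * A ^ p =
      (p - 1) / p * ((p / (p - 1)) ^ p * B ^ p - A ^ p) := by
    generalize (p / (p - 1)) ^ p = c
    field_simp
    ring
  linarith

/-- Here r = |∇ρ|, s = ρ + ε, t = u, I = ∇ρ·∇u and B = |∇u|. Cauchy–Schwarz turns the tested
integrand into the left side of `young_hardy` with A = a r / s. -/
lemma test_le {p r s a t I B : ℝ} (hp : 1 < p) (hr : 0 ≤ r) (hs : 0 < s) (hB : 0 ≤ B)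
    (hI : |I| ≤ r * B) (ha : a = |t|) :
    r ^ (p - 2) * (s ^ (1 - p) * (p * a ^ (p - 2) * t * I) +
      a ^ p * ((1 - p) * s ^ (1 - p - 1) * r ^ 2)) ≤
      (p - 1) / p * ((p / (p - 1)) ^ p * B ^ p - (a * (r / s)) ^ p) := by
  have ha0 : 0 ≤ a := ha ▸ abs_nonneg t
  have hrs : 0 ≤ r / s := div_nonneg hr hs.le
  refine le_trans ?_ (young_hardy hp (mul_nonneg ha0 hrs) hB)
  have e1 : (a * (r / s)) ^ (p - 1) = a ^ (p - 1) * (r ^ (p - 1) * s ^ (1 - p)) := by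
    rw [Real.mul_rpow ha0 hrs, Real.div_rpow hr hs.le, div_eq_mul_inv, ← Real.rpow_neg hs.le, neg_sub]
  have e2 : (a * (r / s)) ^ p = a ^ p * (r ^ p * s ^ (1 - p - 1)) := by
    rw [Real.mul_rpow ha0 hrs, Real.div_rpow hr hs.le, div_eq_mul_inv, ← Real.rpow_neg hs.le]
    ring_nf
  rw [e1, e2, ← rpow_sub_two_mul_self hp ha0, ← rpow_sub_two_mul_self hp hr,
    ← rpow_sub_two_mul_sq hp hr]
  have htI : t * I ≤ a * (r * B) := by
    refine (le_abs_self _).trans ?_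
    rw [abs_mul, ← ha]
    gcongr
  have h3 : 0 ≤ r ^ (p - 2) * s ^ (1 - p) * p * a ^ (p - 2) := by positivity
  have h4 := mul_le_mul_of_nonneg_left htI h3
  nlinarith [h4]

end RealLemmas

/-! ### The Hardy inequality for p-superharmonic functions -/

section Hardy

variable {N : ℕ} {M : Type*} [TopologicalSpace M] [ChartedSpace (EuclideanSpace ℝ (Fin N)) M]
  [Bundle.RiemannianBundle (fun x : M => TangentSpace (𝓡 N) x)]
  [IsManifold (𝓡 N) ∞ M]
  [IsContMDiffRiemannianBundle (𝓡 N) ∞ (EuclideanSpace ℝ (Fin N))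
      (fun x : M => TangentSpace (𝓡 N) x)] [MeasurableSpace M] [BorelSpace M]
  [SecondCountableTopology M] [T2Space M]

/-- Since p > 1, t ↦ |t|^p is C¹ even at 0, so this may serve as the weight w in
`integral_test_nonneg`. -/
lemma IsC1c.abs_rpow {Ω : Set M} {u : M → ℝ} (hu : IsC1c N Ω u) {p : ℝ} (hp : 1 < p) :
    IsC1c N Ω fun x => |u x| ^ p := by
  have hsub : tsupport (fun x => |u x| ^ p) ⊆ tsupport u :=
    closure_mono fun x hx h => hx (by simp [h, Real.zero_rpow (by linarith : p ≠ 0)])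
  exact ⟨(contDiff_norm_rpow (E := ℝ) hp).contMDiff.comp hu.contMDiff,
    hu.hasCompactSupport.of_isClosed_subset (isClosed_tsupport _) hsub,
    hsub.trans hu.tsupport_subset⟩

lemma IsC1c.integrable_norm_grad_rpow {Ω : Set M} {u : M → ℝ} (hu : IsC1c N Ω u) {p : ℝ}
    (hp : 0 < p) : Integrable (fun x => ‖grad N u x‖ ^ p) (riemannianVolume N M) := by
  refine Continuous.integrable_of_hasCompactSupport
    ((continuous_norm_grad hu.contMDiff).rpow_const fun _ => Or.inr hp.le) ?_
  refine HasCompactSupport.intro hu.hasCompactSupport fun x hx => ?_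
  rw [grad_eq_zero_of_notMem_tsupport hx, norm_zero, Real.zero_rpow hp.ne']

lemma IsC1c.integrable_abs_rpow {Ω : Set M} {u : M → ℝ} (hu : IsC1c N Ω u) {δ : ℝ}
    (hδ : 0 < δ) : Integrable (fun x => |u x| ^ δ) (riemannianVolume N M) := by
  refine Continuous.integrable_of_hasCompactSupport
    (hu.contMDiff.continuous.abs.rpow_const fun _ => Or.inr hδ.le) ?_
  refine HasCompactSupport.intro hu.hasCompactSupport fun x hx => ?_
  rw [image_eq_zero_of_notMem_tsupport hx, abs_zero, Real.zero_rpow hδ.ne']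

variable {Ω : Set M} (hΩ : IsOpen Ω) {p : ℝ}
    (hp : 1 < p) {ρ : M → ℝ} {G : (x : M) → TangentSpace (𝓡 N) x} (hρ : MemW1pLoc p Ω ρ G)
    (hρ0 : ∀ᵐ x ∂((riemannianVolume N M).restrict Ω), 0 ≤ ρ x)
    (hsuper : ∀ φ : M → ℝ, IsC1c N Ω φ → (∀ x, 0 ≤ φ x) →
      0 ≤ ∫ x in Ω, ‖G x‖ ^ (p - 2) * inner ℝ (G x) (grad N φ x) ∂(riemannianVolume N M))

include hΩ hp hρ

/-- With ε > 0 the quotient is at most |G|/ε, and |G| ∈ L^p on the support of u. -/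
lemma integrable_hardy_regularized {ε : ℝ} (hε : 0 < ε) {u : M → ℝ} (hu : IsC1c N Ω u) :
    Integrable (fun x => (|u x| * (‖G x‖ / (|ρ x| + ε))) ^ p)
      ((riemannianVolume N M).restrict Ω) := by
  have hm := (hρ.hasWeakGradient.aestronglyMeasurable hΩ)
  have hmG := hρ.hasWeakGradient.aestronglyMeasurable_norm hΩ
  have hc := hu.contMDiff.continuous
  obtain ⟨E, hE⟩ := hu.hasCompactSupport.isCompact.exists_bound_of_continuousOn hc.continuousOn
  refine integrable_of_norm_le_of_tsupport hΩ hu.hasCompactSupport hu.tsupport_subset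
    (g := fun x => (E / ε) ^ p * ‖‖G x‖‖ ^ p) ?_
    ((hρ.lpLoc_norm.integrableOn_rpow (by linarith) hu.hasCompactSupport
      hu.tsupport_subset).const_mul _) ?_ ?_
  · exact ((hc.abs.aestronglyMeasurable.mul (hmG.div₀ (hm.norm.add_const ε))).aemeasurable.pow_const
      _).aestronglyMeasurable
  · refine Eventually.of_forall fun x hxK => ?_
    have hE0 : 0 ≤ E := (norm_nonneg _).trans (hE x hxK)
    have h0 : 0 ≤ |u x| * (‖G x‖ / (|ρ x| + ε)) := by positivity
    rw [Real.norm_of_nonneg (by positivity), norm_norm, ← Real.mul_rpow (by positivity) (by positivity)]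
    refine Real.rpow_le_rpow h0 ?_ (by linarith)
    calc |u x| * (‖G x‖ / (|ρ x| + ε)) ≤ E * (‖G x‖ / ε) := by
          gcongr
          · exact hE x hxK
          · linarith [abs_nonneg (ρ x)]
      _ = _ := by ring
  · intro x hx
    rw [image_eq_zero_of_notMem_tsupport hx, abs_zero, zero_mul, Real.zero_rpow (by linarith)]

include hρ0 hsuper

/-- Test with |u|^p F(ρ) for F(t) = (t+ε)^(1-p): on [0, ∞) the regularization keeps F and F'
bounded, and F' produces the Hardy term with the right sign. -/
lemma integral_hardy_regularized_le {ε : ℝ} (hε : 0 < ε) {u : M → ℝ} (hu : IsC1c N Ω u) :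
    ∫ x in Ω, (|u x| * (‖G x‖ / (|ρ x| + ε))) ^ p ∂(riemannianVolume N M) ≤
      (p / (p - 1)) ^ p * ∫ x in Ω, ‖grad N u x‖ ^ p ∂(riemannianVolume N M) := by
  have hp1 : 0 < p - 1 := by linarith
  let F : ℝ → ℝ := fun t => (t + ε) ^ (1 - p)
  have hF : ContDiffOn ℝ 1 F (Ioi (-ε)) :=
    ContDiffOn.rpow_const_of_ne (contDiffOn_id.add contDiffOn_const) fun t ht => by
      have : -ε < t := ht
      exact (show 0 < t + ε by linarith).ne'
  have hFm : Measurable F := (measurable_id.add_const ε).pow_const _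
  have hdF (t : ℝ) (ht : 0 ≤ t) : deriv F t = (1 - p) * (t + ε) ^ (1 - p - 1) := by
    have := ((hasDerivAt_id t).add_const ε).rpow_const (p := 1 - p) (Or.inl (by simp; linarith))
    rw [show F = fun t => (id t + ε) ^ (1 - p) from rfl, this.deriv]
    simp
  have hmono (t a : ℝ) (ht : 0 ≤ t) (ha : a ≤ 0) : (t + ε) ^ a ≤ ε ^ a :=
    Real.rpow_le_rpow_of_nonpos hε (by linarith) ha
  have hFC (t : ℝ) (ht : 0 ≤ t) : ‖F t‖ ≤ max (ε ^ (1 - p)) ((p - 1) * ε ^ (1 - p - 1)) := by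
    rw [Real.norm_of_nonneg (by positivity)]
    exact (hmono t _ ht (by linarith)).trans (le_max_left _ _)
  have hdFC (t : ℝ) (ht : 0 ≤ t) :
      ‖deriv F t‖ ≤ max (ε ^ (1 - p)) ((p - 1) * ε ^ (1 - p - 1)) := by
    have h0 : 0 ≤ (t + ε) ^ (1 - p - 1) := by positivity
    rw [hdF t ht, norm_mul, Real.norm_of_nonneg h0, Real.norm_eq_abs, abs_sub_comm, abs_of_pos hp1]
    exact (mul_le_mul_of_nonneg_left (hmono t _ ht (by linarith)) hp1.le).trans (le_max_right _ _)
  have htest := integral_test_nonneg hΩ hp hρ hρ0 hsuper hε hF hFm (fun t ht => by positivity)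
    hFC hdFC (hu.abs_rpow hp) fun x => by positivity
  have hi1 := integrable_hardy_regularized hΩ hp hρ hε hu
  have hi2 := (hu.integrable_norm_grad_rpow (p := p) (by linarith)).restrict (s := Ω)
  have hle : ∫ x in Ω, ‖G x‖ ^ (p - 2) * (F (ρ x) * inner ℝ (G x) (grad N (fun x => |u x| ^ p) x) +
      |u x| ^ p * (deriv F (ρ x) * ‖G x‖ ^ 2)) ∂(riemannianVolume N M) ≤
      ∫ x in Ω, (p - 1) / p * ((p / (p - 1)) ^ p * ‖grad N u x‖ ^ p -
        (|u x| * (‖G x‖ / (|ρ x| + ε))) ^ p) ∂(riemannianVolume N M) := by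
    refine integral_mono_ae (integrable_test hΩ hp hρ hρ0 hFm hFC hdFC (hu.abs_rpow hp))
      (((hi2.const_mul _).sub hi1).const_mul _) ?_
    filter_upwards [hρ0] with x hx
    rw [inner_grad_comp (k := fun t => |t| ^ p) (hu.contMDiff.mdifferentiable one_ne_zero x)
      (hasDerivAt_abs_rpow (u x) hp), hdF _ hx, abs_of_nonneg hx]
    exact test_le hp (norm_nonneg (G x)) (by linarith) (norm_nonneg (grad N u x))
      (abs_real_inner_le_norm _ _) rfl
  -- Both integrals are finite, so they separate and the Hardy term can be moved across.
  rw [integral_const_mul, integral_sub (hi2.const_mul _) hi1, integral_const_mul] at hle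
  have h3 := htest.trans hle
  have h4 := nonneg_of_mul_nonneg_right h3 (by positivity)
  linarith

/-- The Hardy inequality for a weakly `p`-superharmonic function `ρ`. -/
lemma hardy_inequality {u : M → ℝ} (hu : IsC1c N Ω u) :
    Integrable (fun x => (|u x| * (‖G x‖ / ρ x)) ^ p) ((riemannianVolume N M).restrict Ω) ∧
    ∫ x in Ω, (|u x| * (‖G x‖ / ρ x)) ^ p ∂(riemannianVolume N M) ≤
      (p / (p - 1)) ^ p * ∫ x in Ω, ‖grad N u x‖ ^ p ∂(riemannianVolume N M) := by
  have hm := (hρ.hasWeakGradient.aestronglyMeasurable hΩ)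
  have hmG := hρ.hasWeakGradient.aestronglyMeasurable_norm hΩ
  have hc := hu.contMDiff.continuous
  have hε (n : ℕ) : (0 : ℝ) < 1 / ((n : ℝ) + 1) := by positivity
  refine integrable_and_integral_le_of_tendsto
    (f := fun n x => (|u x| * (‖G x‖ / (|ρ x| + 1 / ((n : ℝ) + 1)))) ^ p)
    (fun n => integrable_hardy_regularized hΩ hp hρ (hε n) hu) (fun n x => by positivity)
    (fun n => integral_hardy_regularized_le hΩ hp hρ hρ0 hsuper (hε n) hu) ?_ ?_ ?_
  · exact ((hc.abs.aestronglyMeasurable.mul (hmG.div₀ hm)).aemeasurable.pow_const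
      _).aestronglyMeasurable
  · filter_upwards [hρ0] with x hx
    simp only [Pi.zero_apply]
    positivity
  · filter_upwards [hρ0] with x hx
    -- Where ρ = 0 the regularized integrands may blow up, but the limiting quotient is 0 by
    -- convention, which is enough for Fatou's lemma.
    rcases hx.eq_or_lt with h0 | h0
    · left
      rw [← h0, div_zero, mul_zero, Real.zero_rpow (by linarith)]
    · right
      have h1 : Tendsto (fun n : ℕ => |ρ x| + 1 / ((n : ℝ) + 1)) atTop (𝓝 (ρ x)) := by
        simpa [abs_of_pos h0] using
          (tendsto_one_div_add_atTop_nhds_zero_nat (𝕜 := ℝ)).const_add |ρ x|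
      exact ((tendsto_const_nhds.mul (tendsto_const_nhds.div h1 h0.ne')).rpow_const
        (Or.inr (by linarith)))

end Hardy

/-! ### Compactly supported functions on (0, ∞) under power substitutions -/

section PowerReparametrization

/-- The function `s ↦ k (s ^ β)` on `(0, ∞)`, extended by zero. -/
def rpowComp (k : ℝ → ℝ) (β : ℝ) : ℝ → ℝ := (Ioi 0).indicator fun s => k (s ^ β)

variable {k : ℝ → ℝ} {β : ℝ}

lemma tsupport_rpowComp_subset (hβ : β ≠ 0) (hkc : HasCompactSupport k) (hk0 : tsupport k ⊆ Ioi 0) :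
    tsupport (rpowComp k β) ⊆ (fun t : ℝ => t ^ (1 / β)) '' tsupport k ∧
      IsCompact ((fun t : ℝ => t ^ (1 / β)) '' tsupport k) := by
  have hc : IsCompact ((fun t : ℝ => t ^ (1 / β)) '' tsupport k) :=
    hkc.isCompact.image_of_continuousOn fun t ht =>
      (Real.continuousAt_rpow_const t _ (Or.inl (hk0 ht : (0 : ℝ) < t).ne')).continuousWithinAt
  refine ⟨closure_minimal (fun s hs => ?_) hc.isClosed, hc⟩
  have hs0 : s ∈ Ioi 0 := by
    by_contra h
    exact hs (indicator_of_notMem h _)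
  refine ⟨s ^ β, subset_tsupport _ fun h => hs ?_, ?_⟩
  · rw [rpowComp, indicator_of_mem hs0, h]
  · simp only
    rw [← Real.rpow_mul (le_of_lt hs0), mul_one_div_cancel hβ, Real.rpow_one]

lemma hasCompactSupport_rpowComp (hβ : β ≠ 0) (hkc : HasCompactSupport k)
    (hk0 : tsupport k ⊆ Ioi 0) : HasCompactSupport (rpowComp k β) :=
  (tsupport_rpowComp_subset hβ hkc hk0).2.of_isClosed_subset (isClosed_tsupport _)
    (tsupport_rpowComp_subset hβ hkc hk0).1

lemma rpowComp_eventuallyEq {s : ℝ} (hs : 0 < s) :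
    rpowComp k β =ᶠ[𝓝 s] fun s => k (s ^ β) := by
  filter_upwards [isOpen_Ioi.mem_nhds hs] with t ht using indicator_of_mem ht _

/-- The support stays in a compact subset of (0, ∞), away from the singularity of s ↦ s^β at 0,
whatever the sign of β. -/
lemma contDiff_rpowComp (hβ : β ≠ 0) (hk : ContDiff ℝ 1 k) (hkc : HasCompactSupport k)
    (hk0 : tsupport k ⊆ Ioi 0) : ContDiff ℝ 1 (rpowComp k β) := by
  refine contMDiff_iff_contDiff.1 (contMDiff_of_tsupport fun s hs => ?_)
  obtain ⟨t, ht, rfl⟩ := (tsupport_rpowComp_subset hβ hkc hk0).1 hs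
  have hs0 : 0 < t ^ (1 / β) := Real.rpow_pos_of_pos (hk0 ht) _
  refine ContDiffAt.contMDiffAt (ContDiffAt.congr_of_eventuallyEq ?_ (rpowComp_eventuallyEq hs0))
  exact hk.contDiffAt.comp _ (Real.contDiffAt_rpow_const_of_ne hs0.ne')

lemma deriv_rpowComp (hk : ContDiff ℝ 1 k) {s : ℝ} (hs : 0 < s) :
    deriv (rpowComp k β) s = deriv k (s ^ β) * (β * (s ^ β / s)) := by
  rw [(rpowComp_eventuallyEq hs).deriv_eq]
  have h1 := (hk.differentiable one_ne_zero (s ^ β)).hasDerivAt.comp s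
    (Real.hasDerivAt_rpow_const (p := β) (Or.inl hs.ne'))
  rw [← Real.rpow_sub_one hs.ne']
  exact h1.deriv

/-- Functions on the line with compact support in `(0, ∞)` which are equal to the identity on
larger and larger intervals. -/
lemma exists_truncated_id (n : ℕ) : ∃ k : ℝ → ℝ, ContDiff ℝ 1 k ∧ HasCompactSupport k ∧
    tsupport k ⊆ Ioi 0 ∧ ∀ t : ℝ, 1 / ((n : ℝ) + 1) < t → t < n + 1 → deriv k t = 1 := by
  have hn : (0 : ℝ) ≤ n := n.cast_nonneg
  have h1 : 1 / ((n : ℝ) + 1) ≤ 1 := by rw [div_le_one (by positivity)]; linarith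
  have h2 : 0 < 1 / ((n : ℝ) + 1) := by positivity
  let χ : ContDiffBump ((n : ℝ) + 2) :=
    -- Centred at n + 2, the inner ball begins at 1/(n+1) and extends past n + 1, while the outer
    -- one begins at half of 1/(n+1), still positive.
    ⟨n + 2 - 1 / ((n : ℝ) + 1), n + 2 - 1 / ((n : ℝ) + 1) / 2, by linarith, by linarith⟩
  have hts : tsupport (fun t => χ t * t) ⊆ tsupport χ := tsupport_mul_subset_left
  refine ⟨fun t => χ t * t, χ.contDiff.mul contDiff_id, χ.hasCompactSupport.mul_right,
    fun t ht => ?_, fun t ht1 ht2 => ?_⟩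
  · have h3 := hts ht
    rw [χ.tsupport_eq, Metric.mem_closedBall, Real.dist_eq, abs_le] at h3
    have h4 : -(n + 2 - 1 / ((n : ℝ) + 1) / 2) ≤ t - (n + 2) := h3.1
    rw [mem_Ioi]
    linarith
  · have hb : t ∈ Metric.ball ((n : ℝ) + 2) (n + 2 - 1 / ((n : ℝ) + 1)) := by
      rw [Metric.mem_ball, Real.dist_eq, abs_lt]
      constructor <;> linarith
    have he : (fun t => χ t * t) =ᶠ[𝓝 t] id := by
      filter_upwards [Metric.isOpen_ball.mem_nhds hb] with s hs
      rw [χ.one_of_mem_closedBall (Metric.ball_subset_closedBall hs), one_mul, id]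
    rw [he.deriv_eq, deriv_id]

end PowerReparametrization

/-! ### Weak derivatives of a power, by truncation -/

section Flat

variable {N : ℕ}

local notation "𝔼" => EuclideanSpace ℝ (Fin N)

lemma HasWeakPartials.locallyIntegrableOn_comp_mul {U : Set 𝔼} (hU : IsOpen U) {f : 𝔼 → ℝ}
    {a : Fin N → 𝔼 → ℝ} (h : HasWeakPartials U f a) {k : ℝ → ℝ} (hk : Continuous k) {C : ℝ}
    (hkC : ∀ t, ‖k t‖ ≤ C) (i : Fin N) :
    LocallyIntegrableOn (fun y => k (f y) * a i y) U volume := by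
  rw [locallyIntegrableOn_iff hU.isLocallyClosed]
  intro K hKU hK
  have h1 := (h.locallyIntegrableOn_partial i).integrableOn_compact_subset hKU hK
  refine (h1.norm.const_mul C).mono' ((hk.comp_aestronglyMeasurable
    (h.locallyIntegrableOn.integrableOn_compact_subset hKU hK).1).mul h1.1)
    (Eventually.of_forall fun y => ?_)
  rw [norm_mul]
  gcongr
  exact hkC _

/-- Uniqueness of weak derivatives, for two functions which become equal after composition. -/
lemma HasWeakPartials.deriv_mul_ae_eq {U : Set 𝔼} (hU : IsOpen U) {f g : 𝔼 → ℝ}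
    {a b : Fin N → 𝔼 → ℝ} (hf : HasWeakPartials U f a) (hg : HasWeakPartials U g b)
    {k l : ℝ → ℝ} (hk : ContDiff ℝ 1 k) (hkc : HasCompactSupport k) (hl : ContDiff ℝ 1 l)
    (hlc : HasCompactSupport l) (hkl : ∀ᵐ y ∂(volume.restrict U), k (f y) = l (g y)) (i : Fin N) :
    ∀ᵐ y ∂(volume.restrict U), deriv k (f y) * a i y = deriv l (g y) * b i y := by
  have bound {k : ℝ → ℝ} (hk : ContDiff ℝ 1 k) (hkc : HasCompactSupport k) :
      ∃ C, (∀ t, ‖k t‖ ≤ C) ∧ ∀ t, ‖deriv k t‖ ≤ C := by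
    obtain ⟨C, hC⟩ := hkc.exists_bound_of_continuous hk.continuous
    obtain ⟨C', hC'⟩ := hkc.deriv.exists_bound_of_continuous (hk.continuous_deriv le_rfl)
    exact ⟨max C C', fun t => (hC t).trans (le_max_left _ _), fun t => (hC' t).trans (le_max_right _ _)⟩
  obtain ⟨C, hkC, hdkC⟩ := bound hk hkc
  obtain ⟨C', hlC, hdlC⟩ := bound hl hlc
  have hi1 := hf.locallyIntegrableOn_comp_mul hU (hk.continuous_deriv le_rfl) hdkC i
  have hi2 := hg.locallyIntegrableOn_comp_mul hU (hl.continuous_deriv le_rfl) hdlC i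
  -- Both products are weak derivatives of the same function, so their difference annihilates all
  -- test functions.
  have key := hU.ae_eq_zero_of_integral_contDiff_smul_eq_zero (hi1.sub hi2)
    fun ψ hψ hψc hψU => ?_
  · rw [ae_restrict_iff' hU.measurableSet]
    filter_upwards [key] with y hy hyU
    exact sub_eq_zero.1 (hy hyU)
  · have e1 := hf.integral_comp_eq hU hk hkC hdkC i hψ hψc hψU
    have e2 := hg.integral_comp_eq hU hl hlC hdlC i hψ hψc hψU
    have e3 : ∫ y, k (f y) * fderiv ℝ ψ y (stdVec i) = ∫ y, l (g y) * fderiv ℝ ψ y (stdVec i) := by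
      rw [ae_restrict_iff' hU.measurableSet] at hkl
      refine integral_congr_ae ?_
      filter_upwards [hkl] with y hy
      by_cases hyU : y ∈ U
      · rw [hy hyU]
      · rw [fderiv_stdVec_eq_zero fun h => hyU (hψU h), mul_zero, mul_zero]
    have j1 := integrable_mul_of_tsupport_subset hi1 hψ.continuous hψc hψU
    have j2 := integrable_mul_of_tsupport_subset hi2 hψ.continuous hψc hψU
    simp only [smul_eq_mul, Pi.sub_apply, mul_sub]
    rw [integral_sub j1 j2]
    linarith

/-- The chain rule for `g = f ^ α`. -/
lemma HasWeakPartials.partial_eq_of_eq_rpow {U : Set 𝔼} (hU : IsOpen U) {f g : 𝔼 → ℝ}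
    {a b : Fin N → 𝔼 → ℝ} (hf : HasWeakPartials U f a) (hg : HasWeakPartials U g b) {α : ℝ}
    (hα : α ≠ 0) (hf0 : ∀ᵐ y ∂(volume.restrict U), 0 ≤ f y)
    (hgf : ∀ᵐ y ∂(volume.restrict U), g y = f y ^ α) :
    ∀ᵐ y ∂(volume.restrict U), 0 < f y → ∀ i, a i y = α⁻¹ * (f y / g y) * b i y := by
  -- With l(s) = k(s^(1/α)) one has k(f) = l(g), and both k and l are C¹ with compact support,
  -- unlike t ↦ t^α itself.
  choose k hk hkc hk0 hkd using exists_truncated_id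
  have hβ : α⁻¹ ≠ 0 := inv_ne_zero hα
  have hroot {t : ℝ} (ht : 0 ≤ t) : (t ^ α) ^ α⁻¹ = t := by
    rw [← Real.rpow_mul ht, mul_inv_cancel₀ hα, Real.rpow_one]
  have key : ∀ᵐ y ∂(volume.restrict U), ∀ n i,
      deriv (k n) (f y) * a i y = deriv (rpowComp (k n) α⁻¹) (g y) * b i y := by
    refine ae_all_iff.2 fun n => ae_all_iff.2 fun i => ?_
    refine hf.deriv_mul_ae_eq hU hg (hk n) (hkc n) (contDiff_rpowComp hβ (hk n) (hkc n) (hk0 n))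
      (hasCompactSupport_rpowComp hβ (hkc n) (hk0 n)) ?_ i
    filter_upwards [hf0, hgf] with y hy0 hy
    rw [hy]
    -- At f = 0 also g = 0, for either sign of α by the convention for powers of 0, and both
    -- truncations vanish there.
    rcases hy0.eq_or_lt with h0 | h0
    · rw [← h0, Real.zero_rpow hα, rpowComp, indicator_of_notMem (by simp)]
      exact image_eq_zero_of_notMem_tsupport fun h => lt_irrefl (0 : ℝ) (hk0 n h)
    · rw [rpowComp, indicator_of_mem (show f y ^ α ∈ Ioi 0 from Real.rpow_pos_of_pos h0 α), hroot hy0]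
  filter_upwards [key, hgf] with y hy hgy h0 i
  -- The point is now fixed; n is taken so large that the truncation is the identity near f y.
  obtain ⟨n, hn⟩ := exists_nat_gt (max (f y) (1 / f y))
  have hn1 : f y < n + 1 := by linarith [(le_max_left _ _).trans_lt hn]
  have hn2 : 1 / ((n : ℝ) + 1) < f y := by
    have : 1 / f y < n + 1 := by linarith [(le_max_right (f y) _).trans_lt hn]
    rwa [one_div_lt (by positivity) h0]
  have hg0 : 0 < g y := hgy ▸ Real.rpow_pos_of_pos h0 α
  have := hy n i
  rw [deriv_rpowComp (hk n) hg0, hgy, hroot h0.le, ← hgy, hkd n _ hn2 hn1, one_mul, one_mul] at this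
  exact this

end Flat

/-! ### The gradient of a power of a distance-like function -/

section Distance

variable {N : ℕ} {M : Type*} [TopologicalSpace M] [ChartedSpace (EuclideanSpace ℝ (Fin N)) M]
  [Bundle.RiemannianBundle (fun x : M => TangentSpace (𝓡 N) x)]
  [IsManifold (𝓡 N) ∞ M]
  [IsContMDiffRiemannianBundle (𝓡 N) ∞ (EuclideanSpace ℝ (Fin N))
      (fun x : M => TangentSpace (𝓡 N) x)] [MeasurableSpace M] [BorelSpace M]
  [SecondCountableTopology M]

local notation "𝔼" => EuclideanSpace ℝ (Fin N)

/-- The squared norm is a quadratic form in the covariant components, so a common factor c comes out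
as its absolute value. -/
lemma norm_eq_of_lowerCoeff_eq {x₀ : M} {y : 𝔼} (hy : y ∈ (chartAt 𝔼 x₀).target)
    {G H : (x : M) → TangentSpace (𝓡 N) x} {c : ℝ}
    (h : ∀ i, lowerCoeff x₀ G i y = c * lowerCoeff x₀ H i y) :
    ‖G ((chartAt 𝔼 x₀).symm y)‖ = |c| * ‖H ((chartAt 𝔼 x₀).symm y)‖ := by
  have hup (i : Fin N) : upperCoeff x₀ G i y = c * upperCoeff x₀ H i y := by
    simp_rw [upperCoeff, h, Finset.mul_sum]
    exact Finset.sum_congr rfl fun j _ => by ring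
  have h1 := inner_eq_sum_upperCoeff hy G G
  have h2 := inner_eq_sum_upperCoeff hy H H
  rw [real_inner_self_eq_norm_sq] at h1 h2
  simp_rw [hup, h] at h1
  rw [← abs_of_nonneg (norm_nonneg (G ((chartAt 𝔼 x₀).symm y))),
    ← abs_of_nonneg (norm_nonneg (H ((chartAt 𝔼 x₀).symm y))), ← abs_mul, ← sq_eq_sq_iff_abs_eq_abs,
    mul_pow, h1, h2, Finset.mul_sum]
  exact Finset.sum_congr rfl fun j _ => by ring

/-- If `ρ = d ^ α` with `|∇d| = 1`, then `|∇ρ| / ρ = |α| / d` almost everywhere where `d > 0`. -/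
lemma norm_div_eq_of_eq_rpow {Ω : Set M} (hΩ : IsOpen Ω) {ρ d : M → ℝ}
    {G D : (x : M) → TangentSpace (𝓡 N) x} (hρ : HasWeakGradient Ω ρ G)
    (hd : HasWeakGradient Ω d D) {α : ℝ} (hα : α ≠ 0)
    (hd0 : ∀ᵐ x ∂((riemannianVolume N M).restrict Ω), 0 ≤ d x)
    (hD : ∀ᵐ x ∂((riemannianVolume N M).restrict Ω), ‖D x‖ = 1)
    (hρd : ∀ᵐ x ∂((riemannianVolume N M).restrict Ω), ρ x = d x ^ α) :
    ∀ᵐ x ∂((riemannianVolume N M).restrict Ω), 0 < d x → ‖G x‖ / ρ x = |α| / d x := by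
  refine ae_of_forall_chartDomain hΩ fun x₀ => ?_
  have hU := isOpen_chartDomain (N := N) hΩ x₀
  filter_upwards [(hd.hasWeakPartials x₀).partial_eq_of_eq_rpow hU (hρ.hasWeakPartials x₀) hα
    (ae_restrict_chartDomain hΩ hd0 x₀) (ae_restrict_chartDomain hΩ hρd x₀),
    ae_restrict_chartDomain hΩ hD x₀, ae_restrict_chartDomain hΩ hρd x₀,
    ae_restrict_mem hU.measurableSet] with y hy hy1 hyρ hyU h0
  have h1 := norm_eq_of_lowerCoeff_eq hyU.1 (hy h0)
  have hρ0 : 0 < ρ ((chartAt 𝔼 x₀).symm y) := hyρ ▸ Real.rpow_pos_of_pos h0 α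
  have hα0 : 0 < |α| := abs_pos.2 hα
  rw [hy1, abs_mul, abs_inv, abs_of_pos (div_pos h0 hρ0)] at h1
  field_simp at h1 ⊢
  linarith

end Distance

/-! ### Interpolation by Hölder's inequality -/

section Interpolation

/-- Interpolation between a weighted inequality and an integrability assumption. -/
lemma integral_interpolation_le {X : Type*} [MeasurableSpace X] {μ : Measure X} {u h : X → ℝ}
    {p δ m n κ I : ℝ} (hp : 0 < p) (hδ : 0 < δ) (hm : 0 ≤ m) (hn : 0 ≤ n)
    (hmn : m / p + n / δ = 1) (hκ : 0 < κ) (hI : 0 ≤ I) (hu : AEStronglyMeasurable u μ)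
    (hhm : AEStronglyMeasurable h μ) (hh : ∀ᵐ x ∂μ, 0 ≤ h x)
    (huδ : Integrable (fun x => |u x| ^ δ) μ)
    (hp1 : Integrable (fun x => (|u x| * h x) ^ p) μ)
    (hp2 : ∫ x, (|u x| * h x) ^ p ∂μ ≤ κ ^ p * I) :
    Integrable (fun x => |u x| ^ (m + n) * h x ^ m) μ ∧
      ∫ x, |u x| ^ (m + n) * h x ^ m ∂μ ≤
        κ ^ m * I ^ (m / p) * (∫ x, |u x| ^ δ ∂μ) ^ (n / δ) := by
  -- The endpoints m = 0 and n = 0 give an infinite Hölder exponent; there the claim is trivial,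
  -- respectively the assumed weighted bound.
  rcases hm.eq_or_lt with rfl | hm
  · have : n = δ := by
      rwa [zero_div, zero_add, div_eq_one_iff_eq hδ.ne'] at hmn
    subst this
    simpa [div_self hδ.ne'] using huδ
  rcases hn.eq_or_lt with rfl | hn
  · have : m = p := by
      rwa [zero_div, add_zero, div_eq_one_iff_eq hp.ne'] at hmn
    subst this
    have he : (fun x => |u x| ^ (m + 0) * h x ^ m) =ᵐ[μ] fun x => (|u x| * h x) ^ m := by
      filter_upwards [hh] with x hx
      rw [add_zero, Real.mul_rpow (abs_nonneg _) hx]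
    rw [integrable_congr he, integral_congr_ae he]
    simpa [div_self hp.ne'] using ⟨hp1, hp2⟩
  -- Hölder pairs (|u| h)^m with |u|^n; these exponents turn the factors into (|u| h)^p and |u|^δ.
  have hPQ : (p / m).HolderConjugate (δ / n) := by
    rw [Real.holderConjugate_iff]
    refine ⟨?_, by rw [inv_div, inv_div]; exact hmn⟩
    rw [one_lt_div hm]
    have : 0 < n / δ := by positivity
    rw [← div_lt_one hp]
    linarith
  have hA : ∀ᵐ x ∂μ, 0 ≤ |u x| * h x := by
    filter_upwards [hh] with x hx using by positivity
  have e1 : (fun x => ((|u x| * h x) ^ m) ^ (p / m)) =ᵐ[μ] fun x => (|u x| * h x) ^ p := by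
    filter_upwards [hA] with x hx
    rw [← Real.rpow_mul hx, mul_div_cancel₀ _ hm.ne']
  have e2 (x : X) : (|u x| ^ n) ^ (δ / n) = |u x| ^ δ := by
    rw [← Real.rpow_mul (abs_nonneg _), mul_div_cancel₀ _ hn.ne']
  have he : (fun x => |u x| ^ (m + n) * h x ^ m) =ᵐ[μ]
      fun x => (|u x| * h x) ^ m * |u x| ^ n := by
    filter_upwards [hh] with x hx
    rw [Real.rpow_add_of_nonneg (abs_nonneg _) hm.le hn.le, Real.mul_rpow (abs_nonneg _) hx]
    ring
  have hf0 : 0 ≤ᵐ[μ] fun x => (|u x| * h x) ^ m := by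
    filter_upwards [hA] with x hx using Real.rpow_nonneg hx _
  have hg0 : 0 ≤ᵐ[μ] fun x => |u x| ^ n := Eventually.of_forall fun x => by positivity
  have memLp_of {f : X → ℝ} {r : ℝ} (hr : 0 < r) (hf : AEStronglyMeasurable f μ) (hf0 : 0 ≤ᵐ[μ] f)
      (hi : Integrable (fun x => f x ^ r) μ) : MemLp f (ENNReal.ofReal r) μ := by
    refine (integrable_norm_rpow_iff hf (by simpa using hr) ENNReal.ofReal_ne_top).1 ?_
    rw [ENNReal.toReal_ofReal hr.le]
    refine hi.congr ?_
    filter_upwards [hf0] with x hx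
    rw [Real.norm_of_nonneg hx]
  have hfL : MemLp (fun x => (|u x| * h x) ^ m) (ENNReal.ofReal (p / m)) μ :=
    memLp_of hPQ.pos ((hu.norm.mul hhm).aemeasurable.pow_const _).aestronglyMeasurable hf0
      ((integrable_congr e1).2 hp1)
  have hgL : MemLp (fun x => |u x| ^ n) (ENNReal.ofReal (δ / n)) μ :=
    memLp_of hPQ.symm.pos (hu.norm.aemeasurable.pow_const _).aestronglyMeasurable hg0
      (by simpa only [e2] using huδ)
  have := hPQ.ennrealOfReal
  rw [integrable_congr he, integral_congr_ae he]
  refine ⟨hfL.integrable_mul hgL, (integral_mul_le_Lp_mul_Lq_of_nonneg hPQ hf0 hg0 hfL hgL).trans ?_⟩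
  rw [integral_congr_ae e1]
  simp_rw [e2, one_div_div]
  have hint : 0 ≤ ∫ x, (|u x| * h x) ^ p ∂μ := integral_nonneg_of_ae (by
    filter_upwards [hA] with x hx using Real.rpow_nonneg hx _)
  have hJ : 0 ≤ ∫ x, |u x| ^ δ ∂μ := integral_nonneg fun x => by positivity
  refine mul_le_mul_of_nonneg_right ?_ (Real.rpow_nonneg hJ _)
  calc (∫ x, (|u x| * h x) ^ p ∂μ) ^ (m / p) ≤ (κ ^ p * I) ^ (m / p) :=
        Real.rpow_le_rpow hint hp2 (by positivity)
    _ = κ ^ m * I ^ (m / p) := by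
        rw [Real.mul_rpow (by positivity) hI, ← Real.rpow_mul hκ.le, mul_div_cancel₀ _ hp.ne']

end Interpolation

/-! ### The interpolated Hardy inequality and the theorem -/

section Main

variable {N : ℕ} {M : Type*} [TopologicalSpace M] [ChartedSpace (EuclideanSpace ℝ (Fin N)) M]
  [Bundle.RiemannianBundle (fun x : M => TangentSpace (𝓡 N) x)]
  [IsManifold (𝓡 N) ∞ M]
  [IsContMDiffRiemannianBundle (𝓡 N) ∞ (EuclideanSpace ℝ (Fin N))
      (fun x : M => TangentSpace (𝓡 N) x)] [MeasurableSpace M] [BorelSpace M]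
  [SecondCountableTopology M] [T2Space M]

/-- The Hardy inequality interpolated with the `L^δ` norm. -/
lemma interpolated_hardy_inequality {Ω : Set M} (hΩ : IsOpen Ω) {p : ℝ}
    (hp : 1 < p) {ρ : M → ℝ} {G : (x : M) → TangentSpace (𝓡 N) x} (hρ : MemW1pLoc p Ω ρ G)
    (hρ0 : ∀ᵐ x ∂((riemannianVolume N M).restrict Ω), 0 ≤ ρ x)
    (hsuper : ∀ φ : M → ℝ, IsC1c N Ω φ → (∀ x, 0 ≤ φ x) →
      0 ≤ ∫ x in Ω, ‖G x‖ ^ (p - 2) * inner ℝ (G x) (grad N φ x) ∂(riemannianVolume N M))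
    {δ m n : ℝ} (hδ : 0 < δ) (hm : 0 ≤ m) (hn : 0 ≤ n) (hmn : m / p + n / δ = 1)
    {u : M → ℝ} (hu : IsC1c N Ω u) :
    Integrable (fun x => |u x| ^ (m + n) * (‖G x‖ ^ m / ρ x ^ m))
      ((riemannianVolume N M).restrict Ω) ∧
    ∫ x in Ω, |u x| ^ (m + n) * (‖G x‖ ^ m / ρ x ^ m) ∂(riemannianVolume N M) ≤
      (p / (p - 1)) ^ m * (∫ x in Ω, ‖grad N u x‖ ^ p ∂(riemannianVolume N M)) ^ (m / p) *
        (∫ x in Ω, |u x| ^ δ ∂(riemannianVolume N M)) ^ (n / δ) := by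
  obtain ⟨h1, h2⟩ := hardy_inequality hΩ hp hρ hρ0 hsuper hu
  have he : (fun x => |u x| ^ (m + n) * (‖G x‖ ^ m / ρ x ^ m))
      =ᵐ[(riemannianVolume N M).restrict Ω] fun x => |u x| ^ (m + n) * (‖G x‖ / ρ x) ^ m := by
    filter_upwards [hρ0] with x hx
    rw [Real.div_rpow (norm_nonneg _) hx]
  rw [integrable_congr he, integral_congr_ae he]
  exact integral_interpolation_le (by linarith) hδ hm hn hmn
    (div_pos (by linarith) (by linarith)) (integral_nonneg fun x => by positivity)
    hu.contMDiff.continuous.aestronglyMeasurable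
    ((hρ.hasWeakGradient.aestronglyMeasurable_norm hΩ).div₀
      (hρ.hasWeakGradient.aestronglyMeasurable hΩ))
    (by filter_upwards [hρ0] with x hx using by positivity)
    (hu.integrable_abs_rpow hδ).restrict h1 h2

end Main

end RiemannianHardy

end

open RiemannianHardy
theorem mainTheorem5 {N : ℕ} {M : Type*} [EMetricSpace M] [SecondCountableTopology M]
    [ChartedSpace (EuclideanSpace ℝ (Fin N)) M] [IsManifold (𝓡 N) ∞ M]
    [Bundle.RiemannianBundle (fun x : M => TangentSpace (𝓡 N) x)]
    [IsContMDiffRiemannianBundle (𝓡 N) ∞ (EuclideanSpace ℝ (Fin N))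
      (fun x : M => TangentSpace (𝓡 N) x)]
    [IsRiemannianManifold (𝓡 N) M] [CompleteSpace M]
    [MeasurableSpace M] [BorelSpace M]
    (Ω : Set M) (hΩ : IsOpen Ω) (p : ℝ) (hp : 1 < p)
    (ρ : M → ℝ) (Dρ : (x : M) → TangentSpace (𝓡 N) x)
    (hρ : MemW1pLoc p Ω ρ Dρ)
    (hρ0 : ∀ᵐ x ∂((riemannianVolume N M).restrict Ω), 0 ≤ ρ x)
    (hsuper : IsPSuperharmonic p Ω ρ Dρ) :
    (∀ (δ b s q : ℝ), 0 < δ → 0 ≤ b → b ≤ 1 →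
      1 / s = b / p + (1 - b) / δ →
      (b ≠ 0 → 1 / (q * (p - 1)) = 1 / p + (1 - b) / (b * δ)) → (b = 0 → q = 0) →
      ∀ u : M → ℝ, IsC1c N Ω u →
        IntegrableOn (fun x => |u x| ^ s * (‖Dρ x‖ ^ (q * (p - 1)) / ρ x ^ (q * (p - 1))))
          Ω (riemannianVolume N M) ∧
        (∫ x in Ω, |u x| ^ s * (‖Dρ x‖ ^ (q * (p - 1)) / ρ x ^ (q * (p - 1)))
            ∂(riemannianVolume N M)) ^ (1 / s) ≤
          (p / (p - 1)) ^ (q * (p - 1) / s) *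
          (∫ x in Ω, ‖grad N u x‖ ^ p
            ∂(riemannianVolume N M)) ^ (b / p) *
          (∫ x in Ω, |u x| ^ δ ∂(riemannianVolume N M)) ^ ((1 - b) / δ)) ∧
    (∀ (α : ℝ) (d : M → ℝ) (Dd : (x : M) → TangentSpace (𝓡 N) x), α ≠ 0 →
      HasWeakGradient Ω d Dd →
      (∀ᵐ x ∂((riemannianVolume N M).restrict Ω), 0 ≤ d x) →
      (∀ᵐ x ∂((riemannianVolume N M).restrict Ω), ‖Dd x‖ = 1) →
      (∀ᵐ x ∂((riemannianVolume N M).restrict Ω), ρ x = d x ^ α) →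
      ∀ (δ s : ℝ), 0 < δ → s = p - 1 + δ / p →
      ∀ u : M → ℝ, IsC1c N Ω u →
        IntegrableOn (fun x => |u x| ^ s / d x ^ (p - 1))
          Ω (riemannianVolume N M) ∧
        ∫ x in Ω, |u x| ^ s / d x ^ (p - 1) ∂(riemannianVolume N M) ≤
          (p / (|α| * (p - 1))) ^ (p - 1) *
          (∫ x in Ω, ‖grad N u x‖ ^ p
            ∂(riemannianVolume N M)) ^ ((p - 1) / p) *
          (∫ x in Ω, |u x| ^ δ ∂(riemannianVolume N M)) ^ (1 / p)) := by
  have hsup := hsuper.integral_nonneg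
  refine ⟨fun δ b s q hδ hb0 hb1 hs hq hq0 u hu => ?_,
    fun α d Dd hα hd hd0 hDd hρd δ s hδ hs u hu => ?_⟩
  · have hp0 : 0 < p := by linarith
    have hs0 : 0 < s := by
      rw [← one_div_pos, hs]
      rcases hb0.eq_or_lt with rfl | h
      · simpa using hδ
      · have : 0 < b / p := by positivity
        have : 0 ≤ (1 - b) / δ := div_nonneg (by linarith) hδ.le
        linarith
    -- For b ≠ 0, factoring 1/b out of the relation for q leaves 1/s, so the weight exponent is b s.
    have hθ : q * (p - 1) = b * s := by
      rcases eq_or_ne b 0 with rfl | hb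
      · rw [hq0 rfl, zero_mul, zero_mul]
      · have h1 : 1 / (q * (p - 1)) = 1 / (b * s) := by
          rw [hq hb, ← one_div_mul_one_div, hs]
          field_simp
        rwa [one_div, one_div, inv_inj] at h1
    have hmn : b * s / p + (1 - b) * s / δ = 1 := by
      calc b * s / p + (1 - b) * s / δ = s * (b / p + (1 - b) / δ) := by ring
        _ = 1 := by rw [← hs]; field_simp
    obtain ⟨h1, h2⟩ := interpolated_hardy_inequality hΩ hp hρ hρ0 hsup hδ (mul_nonneg hb0 hs0.le)
      (mul_nonneg (by linarith : 0 ≤ 1 - b) hs0.le) hmn hu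
    rw [show b * s + (1 - b) * s = s by ring] at h1 h2
    rw [hθ]
    refine ⟨h1, ?_⟩
    have hI : 0 ≤ ∫ x in Ω, ‖grad N u x‖ ^ p ∂(riemannianVolume N M) :=
      integral_nonneg fun x => by positivity
    have hJ : 0 ≤ ∫ x in Ω, |u x| ^ δ ∂(riemannianVolume N M) :=
      integral_nonneg fun x => by positivity
    have hκ : 0 ≤ p / (p - 1) := div_nonneg hp0.le (by linarith)
    have hL : 0 ≤ ∫ x in Ω, |u x| ^ s * (‖Dρ x‖ ^ (b * s) / ρ x ^ (b * s))
        ∂(riemannianVolume N M) := integral_nonneg_of_ae (by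
      filter_upwards [hρ0] with x hx
      simp only [Pi.zero_apply]
      positivity)
    -- The stated inequality is the 1/s power of the interpolated one with m = bs and n = (1-b)s.
    refine (Real.rpow_le_rpow hL h2 (by positivity)).trans_eq ?_
    rw [Real.mul_rpow (by positivity) (by positivity), Real.mul_rpow (by positivity) (by positivity),
      ← Real.rpow_mul hκ, ← Real.rpow_mul hI, ← Real.rpow_mul hJ]
    congr 2
    · ring_nf
    · field_simp
    · field_simp
  · have hp0 : 0 < p := by linarith
    have hp1 : 0 < p - 1 := by linarith
    -- With m = p - 1 and n = δ/p the Hölder weights are (p-1)/p and 1/p, and m + n = s.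
    obtain ⟨h1, h2⟩ := interpolated_hardy_inequality hΩ hp hρ hρ0 hsup hδ hp1.le
      (n := δ / p) (by positivity) (by field_simp; ring) hu
    rw [← hs] at h1 h2
    have hα0 : 0 < |α| := abs_pos.2 hα
    have he : (fun x => |u x| ^ s / d x ^ (p - 1)) =ᵐ[(riemannianVolume N M).restrict Ω]
        fun x => (|α| ^ (p - 1))⁻¹ * (|u x| ^ s * (‖Dρ x‖ ^ (p - 1) / ρ x ^ (p - 1))) := by
      filter_upwards [hd0, hρ0, hρd, norm_div_eq_of_eq_rpow hΩ hρ.hasWeakGradient hd hα hd0 hDd hρd]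
        with x hdx hρx hx h
      -- Where d = 0 also ρ = 0, and both quotients are 0 by convention; elsewhere |∇ρ|/ρ = |α|/d.
      rcases hdx.eq_or_lt with h0 | h0
      · rw [hx, ← h0, Real.zero_rpow hα, Real.zero_rpow hp1.ne']
        simp
      · rw [← Real.div_rpow (norm_nonneg _) hρx, h h0, Real.div_rpow hα0.le hdx]
        have : 0 < |α| ^ (p - 1) := by positivity
        field_simp
    refine ⟨(integrable_congr he).2 (h1.const_mul _), ?_⟩
    rw [integral_congr_ae he, integral_const_mul]
    refine (mul_le_mul_of_nonneg_left h2 (by positivity)).trans_eq ?_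
    rw [show p / (|α| * (p - 1)) = |α|⁻¹ * (p / (p - 1)) by field_simp,
      Real.mul_rpow (by positivity) (by positivity), Real.inv_rpow hα0.le,
      show δ / p / δ = 1 / p by field_simp]
    ring
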